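/- **Diagrams.** Let $K\subset S^3$ be an oriented framed knot and let $D$ be an open diagram of $K$: an oriented tangle diagram with one incoming and one outgoing boundary point whose closure is a diagram of $K$, drawn in a strip, composed from left to right of crossings with both strands running rightward and of critical points (points where a strand turns from rightward to leftward or back). A *segment* is an edge of the underlying graph; the two segments at the boundary are the boundary segments, and $E$ is the set of the other (internal) segments. At a crossing of sign $\epsilon=\pm1$ the incoming strands are $1$ (upper left) and $2$ (lower left) and the outgoing ones are $1'$ (lower right, continuing $1$) and $2'$ (upper right, continuing $2$); strand $1$ is the overstrand if $\epsilon=1$, strand $2$ if $\epsilon=-1$. **Colorings.** A decorated representation $\rho$ of $K$ is given by a coloring of the segments by pairs $(g_i,[v_i])$, where $g_i\in SL_2(\mathbb C)$, $0\ne v_i\in\mathbb C^2$ is a row vector up to scaling and $v_ig_i=m^{-1}v_i$, such that both boundary segments have the same color and at each crossing: if $\epsilon=1$ then $(g_{1'},[v_{1'}])=(g_1,[v_1])$ and $(g_{2'},[v_{2'}])=(g_1^{-1}g_2g_1,[v_2g_1])$; if $\epsilon=-1$ then $(g_{2'},[v_{2'}])=(g_2,[v_2])$ and $(g_{1'},[v_{1'}])=(g_2g_1g_2^{-1},[v_1g_2^{-1}])$.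 The number $m$ is the meridian eigenvalue. A shadow coloring $(\rho,u)$ assigns in addition to each region of $D$ a column vector in $\mathbb C^2$, such that if $u$ is the vector on the left of segment $i$, then $g_iu$ is the vector on its right. The region parameters are the first entries of these vectors, and the segment parameters are $b_i=-v_ie_2/(v_iu)$ with $u$ the vector on the left of $i$. The coloring is *admissible* if no region or segment parameter is $0$ or $\infty$; *normalized* if it is admissible and the boundary segments have segment parameter $1$; *pinched* if $[v_1]=[v_2]$ at some crossing. It *avoids the unit circle* if at each crossing none of the shape parameters $(b_{2'}/b_1)^\epsilon$, $(b_2/b_{1'})^\epsilon$, $(b_2/(mb_1))^\epsilon$, $(mb_{2'}/b_{1'})^\epsilon$ has absolute value $1$. A *log-meridian* is $\mu\in\mathbb C$ with $e^{2\pi i\mu}=m$, and a *log-coloring* is $\beta\in\mathbb C^E$ with $e^{2\pi i\beta_j}=b_j$ for all $j\in E$. **Action.** Let $N\ge2$. Let $\Phi_{\mathsf b}$ be Faddeev's quantum dilogarithm, the meromorphic continuation to $\mathbb C$ of $\exp\int_{\mathbb R+i0}\frac{e^{-2izw}}{4\sinh(w\mathsf b)\sinh(w/\mathsf b)}\frac{dw}{w}$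 from the strip $|\operatorname{Im}z|<(\mathsf b+\mathsf b^{-1})/2$, and let $e^{\varphi_N(t)}=\Phi_{\sqrt N}\big(i\sqrt N\,t-\tfrac i2(\sqrt N+1/\sqrt N)+i/\sqrt N\big)$. Set $$\lambda^+=\varphi_N(t_{2'}-t_1)+\varphi_N(t_2-t_{1'})-\varphi_N(t_2-t_1-\tfrac\mu N+1-\tfrac1N)-\varphi_N(t_{2'}-t_{1'}+\tfrac\mu N),$$ $$\lambda^-=-\varphi_N(t_1-t_{2'}+1-\tfrac1N)-\varphi_N(t_{1'}-t_2+1-\tfrac1N)+\varphi_N(t_1-t_2+\tfrac\mu N)+\varphi_N(t_{1'}-t_{2'}-\tfrac\mu N+1-\tfrac1N),$$ and let the crossing function be $\lambda^\epsilon+2\pi i\epsilon(1-N)(t_2-t_1-\mu/N)+2\pi i\epsilon\mu(t_2+t_{1'}-t_1-t_{2'})$. Assign a variable $t_j$ to each $j\in E$ (at a chosen reference point of the segment) and $0$ to the boundary segments (at the boundary points). Along a segment the value is unchanged at critical points passed upward; it increases by $1-1/N$ at a critical point passed downward where the strand turns from rightward to leftward, and decreases by $1-1/N$ at one passed downward where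 it turns from leftward to rightward. The action $S_N(t)=S_{N,D,\mu}(t)$, $t\in\mathbb C^E$, is the sum over all crossings of $\frac1N$ times the crossing function at the values at the four ends of the crossing; only the well-defined function $e^{NS_N}$ is used. The invariant is given by the state sum $$Z_N^\psi(K,\rho,\mu)=\frac1{N^{|E|/2+1/2}}\sum_{n\in\{0,\dots,N-1\}^E}e^{NS_N((\beta+n)/N)}.$$ **Theorem.** Let $(\rho,u)$ be a normalized, non-pinched shadow coloring of $D$ that avoids the unit circle, $\mu$ a log-meridian and $\beta$ a log-coloring. Then for each $k\in\mathbb Z^E$ the integrand of the state integral $$I_k=\int_{[0,1]^E}\exp N\big(S_N(t+\beta/N)-2\pi i\,k\cdot t\big)\,dt$$ is integrable, and $$Z_N^\psi(K,\rho,\mu)=N^{|E|/2-1/2}\sum_{k\in\mathbb Z^E}I_k,$$ where the sum (which need not converge absolutely) is the limit of the rectangular partial sums over $\prod_{j\in E}\{-M_j,\dots,M_j\}$ as $\min_jM_j\to\infty$. -/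

import Mathlib

namespace StateIntegral

/-! ## The quantum dilogarithm -/

/-- Faddeev's integral for `Φ_b(z)`, `b > 0`, over the line `ℝ + iε` with `ε = min b b⁻¹`
(which lies below the first pole `iπ min b b⁻¹` of the integrand).  It converges for
`|Im z| < (b + b⁻¹) / 2`. -/
noncomputable def faddeevStrip (b : ℝ) (z : ℂ) : ℂ :=
  Complex.exp (∫ x : ℝ,
    Complex.exp (-2 * Complex.I * z * ((x : ℂ) + (min b b⁻¹ : ℝ) * Complex.I)) /
      (4 * Complex.sinh (((x : ℂ) + (min b b⁻¹ : ℝ) * Complex.I) * b) *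
        Complex.sinh (((x : ℂ) + (min b b⁻¹ : ℝ) * Complex.I) / b)) /
      ((x : ℂ) + (min b b⁻¹ : ℝ) * Complex.I))

/-- Faddeev's noncompact quantum dilogarithm `Φ_b` on all of `ℂ` for `b > 0`: the meromorphic
continuation of `faddeevStrip b` by the functional equation
`Φ_b (w - i / (2 b)) = (1 + exp (2 π w / b)) Φ_b (w + i / (2 b))`.
The point `z` is moved by `n = ⌊b Im z + 1/2⌋` steps of length `i / b` to the point
`z - i n / b`, whose imaginary part is in `[-1/(2b), 1/(2b))`. At the poles the value is `0`. -/
noncomputable def faddeev (b : ℝ) (z : ℂ) : ℂ :=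
  let n : ℤ := ⌊b * z.im + 1 / 2⌋
  let z₀ : ℂ := z - Complex.I * n / b
  faddeevStrip b z₀ *
    (∏ j ∈ Finset.range n.toNat,
      (1 + Complex.exp (2 * Real.pi / b * (z₀ + Complex.I * (j + 1 / 2) / b)))⁻¹) *
    (∏ j ∈ Finset.range (-n).toNat,
      (1 + Complex.exp (2 * Real.pi / b * (z₀ - Complex.I * (j + 1 / 2) / b))))

/-- `e^{φ_N(t)} = Φ_b (i √N t - c_b + i / √N)` with `b = √N` and `c_b = (i/2) (b + b⁻¹)`. -/
noncomputable def qlog (N : ℕ) (t : ℂ) : ℂ :=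
  faddeev (Real.sqrt N)
    (Complex.I * (Real.sqrt N : ℝ) * t
      - Complex.I / 2 * ((Real.sqrt N : ℝ) + ((Real.sqrt N : ℝ) : ℂ)⁻¹)
      + Complex.I / (Real.sqrt N : ℝ))

/-! ## Open knot diagrams -/

/-- The sign of a crossing. -/
inductive CrossingSign
  | pos
  | neg

/-- The sign as an integer. -/
def CrossingSign.toInt : CrossingSign → ℤ
  | pos => 1
  | neg => -1

/-- A point of the diagram (away from crossings): the segment it lies on, and the number `rot`
that counts the index shifts at critical points between the reference point of the segment and
this point.  If the segment carries the variable `t`, then the point carries the value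
`t + rot * (1 - 1 / N)`. The segments of a diagram with `c` crossings are numbered
`0, 1, …, 2 c` in the order in which the knot runs through them. -/
structure Port (c : ℕ) where
  seg : Fin (2 * c + 1)
  rot : ℤ

/-- A strand of the diagram meeting a vertical line: a point and the horizontal direction of the
strand there (`true` for rightward, `false` for leftward). -/
structure Strand (c : ℕ) extends Port c where
  rightward : Bool

/-- A crossing both of whose strands run from left to right. Strand `1` goes from the upper left
`in₁` to the lower right `out₁`, strand `2` goes from the lower left `in₂` to the upper right
`out₂`.  At a positive crossing strand `1` is the overstrand, at a negative one strand `2` is. -/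
structure Crossing (c : ℕ) where
  sign : CrossingSign
  in₁ : Port c
  in₂ : Port c
  out₁ : Port c
  out₂ : Port c

/-- The elementary pieces of a tangle diagram read from left to right: a crossing, a strand
opening to the right (`leftUp`, `leftDown`, with a critical point on its left) and a strand
opening to the left (`rightUp`, `rightDown`, with a critical point on its right); `Up` and `Down`
give the direction in which the critical point is passed. `p` is the label of the strand's upper
end. -/
inductive Piece (c : ℕ)
  | crossing (X : Crossing c)
  | leftUp (p : Port c)
  | leftDown (p : Port c)
  | rightUp (p : Port c)
  | rightDown (p : Port c)

/-- The strands on the left of an elementary piece, from top to bottom. -/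
def Piece.source {c : ℕ} : Piece c → List (Strand c)
  | crossing X => [⟨X.in₁, true⟩, ⟨X.in₂, true⟩]
  | leftUp _ => []
  | leftDown _ => []
  | rightUp p => [⟨p, false⟩, ⟨p, true⟩]
  | rightDown p => [⟨p, true⟩, ⟨⟨p.seg, p.rot + 1⟩, false⟩]

/-- The strands on the right of an elementary piece, from top to bottom. -/
def Piece.target {c : ℕ} : Piece c → List (Strand c)
  | crossing X => [⟨X.out₂, true⟩, ⟨X.out₁, true⟩]
  | leftUp p => [⟨p, true⟩, ⟨p, false⟩]
  | leftDown p => [⟨p, false⟩, ⟨⟨p.seg, p.rot - 1⟩, true⟩]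
  | rightUp _ => []
  | rightDown _ => []

/-- An elementary piece with horizontal strands above and below it. -/
structure Layer (c : ℕ) where
  above : List (Strand c)
  piece : Piece c
  below : List (Strand c)

def Layer.source {c : ℕ} (L : Layer c) : List (Strand c) := L.above ++ L.piece.source ++ L.below

def Layer.target {c : ℕ} (L : Layer c) : List (Strand c) := L.above ++ L.piece.target ++ L.below

/-- The layers fit together, from left to right, to a tangle diagram from `S` to `T`. -/
def Composes {c : ℕ} : List (Strand c) → List (Layer c) → List (Strand c) → Prop
  | S, [], T => S = T
  | S, L :: Ls, T => L.source = S ∧ Composes L.target Ls T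

/-- The crossings of a list of layers. -/
def crossingsOf {c : ℕ} : List (Layer c) → List (Crossing c)
  | [] => []
  | L :: Ls =>
    match L.piece with
    | .crossing X => X :: crossingsOf Ls
    | _ => crossingsOf Ls

/-- An open knot diagram with `c` crossings: a tangle diagram composed of elementary pieces, with
one incoming boundary point on the left and one outgoing boundary point on the right.  The
segments are numbered along the knot: the knot enters on segment `0`, leaves on segment `2 c`, and
each passage through a crossing leads from a segment to the next one, so that each `j < 2 c` is
the incoming segment of exactly one passage. -/
structure OpenDiagram (c : ℕ) where
  layers : List (Layer c)
  composes : Composes [⟨⟨0, 0⟩, true⟩] layers [⟨⟨Fin.last (2 * c), 0⟩, true⟩]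
  passages :
    ((crossingsOf layers).flatMap
      fun X => [(X.in₁.seg, X.out₁.seg), (X.in₂.seg, X.out₂.seg)]).Perm
    ((List.finRange (2 * c)).map fun j => (j.castSucc, j.succ))

/-- The crossings of the diagram. -/
def OpenDiagram.crossings {c : ℕ} (D : OpenDiagram c) : List (Crossing c) := crossingsOf D.layers

/-- The vertical slices of the diagram: the lists of strands between consecutive layers. -/
def OpenDiagram.slices {c : ℕ} (D : OpenDiagram c) : List (List (Strand c)) :=
  [⟨⟨0, 0⟩, true⟩] :: D.layers.map Layer.target

/-- The set `E` of internal segments. -/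
abbrev Internal (c : ℕ) : Type :=
  {j : Fin (2 * c + 1) // j ≠ 0 ∧ j ≠ Fin.last (2 * c)}

/-! ## Colorings -/

/-- A decorated matrix `(g, [v])`: a matrix in `SL₂(ℂ)` with the line spanned by a row vector
`v ≠ 0` such that `v g = m⁻¹ v`; `m` is the distinguished eigenvalue.  The line is given by a
representative `v`; everything below depends only on the line. -/
structure DecoratedMatrix where
  g : Matrix.SpecialLinearGroup (Fin 2) ℂ
  v : Fin 2 → ℂ
  m : ℂ
  v_ne_zero : v ≠ 0
  m_ne_zero : m ≠ 0
  eigen : Matrix.vecMul v (g : Matrix (Fin 2) (Fin 2) ℂ) = m⁻¹ • v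

/-- Two row vectors span the same line: `[v] = [w]`. -/
def SameLine (v w : Fin 2 → ℂ) : Prop := ∃ a : ℂ, a ≠ 0 ∧ v = a • w

/-- Equality of decorated matrices. -/
def DecoratedMatrix.Same (x y : DecoratedMatrix) : Prop := x.g = y.g ∧ SameLine x.v y.v

/-- `z` is `x ◁ y = (h⁻¹ g h, [v h])`, where `x = (g, [v])` and `y = (h, [w])`. -/
def DecoratedMatrix.IsAct (x y z : DecoratedMatrix) : Prop :=
  z.g = y.g⁻¹ * x.g * y.g ∧
    SameLine z.v (Matrix.vecMul x.v (y.g : Matrix (Fin 2) (Fin 2) ℂ))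

/-- `z` is `x ◁⁻¹ y = (h g h⁻¹, [v h⁻¹])`, where `x = (g, [v])` and `y = (h, [w])`. -/
def DecoratedMatrix.IsInvAct (x y z : DecoratedMatrix) : Prop :=
  z.g = y.g * x.g * y.g⁻¹ ∧
    SameLine z.v (Matrix.vecMul x.v ((y.g⁻¹ : Matrix.SpecialLinearGroup (Fin 2) ℂ) :
      Matrix (Fin 2) (Fin 2) ℂ))

/-- The crossing relation of a decorated coloring `ρ` of the segments. -/
def CrossingRelation {c : ℕ} (ρ : Fin (2 * c + 1) → DecoratedMatrix) (X : Crossing c) : Prop :=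
  match X.sign with
  | .pos => (ρ X.out₁.seg).Same (ρ X.in₁.seg) ∧
      (ρ X.in₂.seg).IsAct (ρ X.in₁.seg) (ρ X.out₂.seg)
  | .neg => (ρ X.out₂.seg).Same (ρ X.in₂.seg) ∧
      (ρ X.in₁.seg).IsInvAct (ρ X.in₂.seg) (ρ X.out₁.seg)

/-- A decorated `SL₂(ℂ)`-coloring of a diagram, that is (by the Wirtinger presentation) a decorated
representation of the knot.  The two boundary segments carry the same decorated matrix. -/
structure DecoratedColoring {c : ℕ} (D : OpenDiagram c) where
  color : Fin (2 * c + 1) → DecoratedMatrix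
  crossing : ∀ X ∈ D.crossings, CrossingRelation color X
  boundary : (color (Fin.last (2 * c))).Same (color 0)

/-- The meridian eigenvalue of a decorated representation: the distinguished eigenvalue of the
colors (which is the same for all segments). -/
def DecoratedColoring.meridian {c : ℕ} {D : OpenDiagram c} (ρ : DecoratedColoring D) : ℂ :=
  (ρ.color 0).m

/-- The color of the region on the right hand side of a segment with color `x`, if the region on
its left hand side has color `u`: the vector `g u`. -/
def DecoratedMatrix.cross (x : DecoratedMatrix) (u : Fin 2 → ℂ) : Fin 2 → ℂ :=
  Matrix.mulVec (x.g : Matrix (Fin 2) (Fin 2) ℂ) u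

/-- In a vertical slice, the colors of the regions met on the way from a region of color `u`
downward through the listed strands to a region of color `w` fit together. `left i` is the color
of the region on the left hand side of the segment `i`; for a rightward strand this is the region
above it in the slice, for a leftward strand it is the region below it. -/
def RegionsFit {c : ℕ} (col : Fin (2 * c + 1) → DecoratedMatrix)
    (left : Fin (2 * c + 1) → Fin 2 → ℂ) : (Fin 2 → ℂ) → List (Strand c) → (Fin 2 → ℂ) → Prop
  | u, [], w => u = w
  | u, s :: S, w =>
    if s.rightward then
      left s.seg = u ∧ RegionsFit col left ((col s.seg).cross (left s.seg)) S w
    else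
      (col s.seg).cross (left s.seg) = u ∧ RegionsFit col left (left s.seg) S w

/-- A shadow coloring `(ρ, u)`: a decorated coloring with a color in `ℂ²` for each region, such
that passing from the left to the right of a segment of color `(g, [v])` changes the color `u`
of the region to `g u`.  The coloring of the regions is given by the color `left i` of the region
on the left of the segment `i`; that on the right of `i` then has the color `g_i (left i)`.
Each region borders a segment, and the colors that a region gets from its bordering segments
agree, which is tested in each vertical slice. The regions at the very top and at the very bottom
have the same colors `top`, `bottom` in all slices. -/
structure ShadowColoring {c : ℕ} (D : OpenDiagram c) extends DecoratedColoring D where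
  left : Fin (2 * c + 1) → Fin 2 → ℂ
  top : Fin 2 → ℂ
  bottom : Fin 2 → ℂ
  fit : ∀ S ∈ D.slices, RegionsFit color left top S bottom

namespace ShadowColoring

variable {c : ℕ} {D : OpenDiagram c}

/-- The region on the right hand side of the segment `i`. -/
def right (Γ : ShadowColoring D) (i : Fin (2 * c + 1)) : Fin 2 → ℂ :=
  (Γ.color i).cross (Γ.left i)

/-- The segment parameter `b_i = - (v_i e₂) / (v_i u)`, where `u` is the color of the region on
the left of (that is, above) the segment `i`. -/
noncomputable def b (Γ : ShadowColoring D) (i : Fin (2 * c + 1)) : ℂ :=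
  -((Γ.color i).v 1) / dotProduct (Γ.color i).v (Γ.left i)

/-- Admissible: no region parameter (first entry of the color of a region) and no segment
parameter is `0` or `∞`. -/
def Admissible (Γ : ShadowColoring D) : Prop :=
  ∀ i, Γ.left i 0 ≠ 0 ∧ Γ.right i 0 ≠ 0 ∧
    (Γ.color i).v 1 ≠ 0 ∧ dotProduct (Γ.color i).v (Γ.left i) ≠ 0

/-- Normalized: admissible, with segment parameter `1` on the boundary segments. -/
def Normalized (Γ : ShadowColoring D) : Prop :=
  Γ.Admissible ∧ Γ.b 0 = 1 ∧ Γ.b (Fin.last (2 * c)) = 1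

/-- Pinched: at some crossing `[v₁] = [v₂]`. -/
def Pinched (Γ : ShadowColoring D) : Prop :=
  ∃ X ∈ D.crossings, SameLine (Γ.color X.in₁.seg).v (Γ.color X.in₂.seg).v

/-- The shape parameters `z_N, z_S, z_W, z_E` at a crossing. -/
noncomputable def shapes (Γ : ShadowColoring D) (X : Crossing c) : List ℂ :=
  [(Γ.b X.out₂.seg / Γ.b X.in₁.seg) ^ X.sign.toInt,
   (Γ.b X.in₂.seg / Γ.b X.out₁.seg) ^ X.sign.toInt,
   (Γ.b X.in₂.seg / (Γ.meridian * Γ.b X.in₁.seg)) ^ X.sign.toInt,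
   (Γ.meridian * Γ.b X.out₂.seg / Γ.b X.out₁.seg) ^ X.sign.toInt]

/-- No shape parameter has norm `1`. -/
def AvoidsUnitCircle (Γ : ShadowColoring D) : Prop :=
  ∀ X ∈ D.crossings, ∀ z ∈ Γ.shapes X, ‖z‖ ≠ 1

/-- `μ` is a log-meridian: a logarithm of the meridian eigenvalue. -/
def IsLogMeridian (Γ : ShadowColoring D) (μ : ℂ) : Prop :=
  Complex.exp (2 * Real.pi * Complex.I * μ) = Γ.meridian

/-- `β` is a log-coloring: logarithms of the segment parameters of the internal segments.
(The boundary segments get the logarithm `0`.) -/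
def IsLogColoring (Γ : ShadowColoring D) (β : Internal c → ℂ) : Prop :=
  ∀ i : Internal c, Complex.exp (2 * Real.pi * Complex.I * β i) = Γ.b i

end ShadowColoring

/-! ## The action, the state sum and the state integrals -/

/-- The exponential of `λ_N^ε(μ | t₁, t₂, t₁', t₂')`. -/
noncomputable def expLambda (N : ℕ) (ε : CrossingSign) (μ t₁ t₂ t₁' t₂' : ℂ) : ℂ :=
  match ε with
  | .pos => qlog N (t₂' - t₁) * qlog N (t₂ - t₁') /
      (qlog N (t₂ - t₁ - μ / N + 1 - 1 / N) * qlog N (t₂' - t₁' + μ / N))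
  | .neg => qlog N (t₁ - t₂ + μ / N) * qlog N (t₁' - t₂' - μ / N + 1 - 1 / N) /
      (qlog N (t₁ - t₂' + 1 - 1 / N) * qlog N (t₁' - t₂ + 1 - 1 / N))

/-- The exponential of the crossing function of sign `ε`. -/
noncomputable def expCrossing (N : ℕ) (ε : CrossingSign) (μ t₁ t₂ t₁' t₂' : ℂ) : ℂ :=
  expLambda N ε μ t₁ t₂ t₁' t₂' *
    Complex.exp (2 * Real.pi * Complex.I * ε.toInt * (1 - N) * (t₂ - t₁ - μ / N)
      + ε.toInt * (2 * Real.pi * Complex.I) * μ * (t₂ + t₁' - t₁ - t₂'))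

/-- The value at a point of the diagram, given the variables `t` of the internal segments; the
variable of the boundary segments is `0`. -/
noncomputable def Port.value {c : ℕ} (p : Port c) (N : ℕ) (t : Internal c → ℂ) : ℂ :=
  (if h : p.seg ≠ 0 ∧ p.seg ≠ Fin.last (2 * c) then t ⟨p.seg, h⟩ else 0)
    + p.rot * (1 - 1 / N)

namespace OpenDiagram

variable {c : ℕ}

/-- The function `t ↦ exp (N S_N(t))` on `ℂ^E`, where the action `S_N = S_{N, D, μ}` is the sum over
the crossings of `1 / N` times the crossing functions. (The action itself is only defined up to
the branches of the logarithm, and only enters through this function.) -/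
noncomputable def expAction (D : OpenDiagram c) (N : ℕ) (μ : ℂ) (t : Internal c → ℂ) : ℂ :=
  (D.crossings.map fun X => expCrossing N X.sign μ
    (X.in₁.value N t) (X.in₂.value N t) (X.out₁.value N t) (X.out₂.value N t)).prod

/-- The invariant `Z_N^ψ(K, ρ, μ)`, defined by its state sum. -/
noncomputable def qinv (D : OpenDiagram c) (N : ℕ) (μ : ℂ) (β : Internal c → ℂ) : ℂ :=
  1 / (((N : ℝ) ^ ((Fintype.card (Internal c) : ℝ) / 2 + 1 / 2) : ℝ) : ℂ) *
    ∑ n : Internal c → Fin N, D.expAction N μ fun i => (β i + ((n i : ℕ) : ℂ)) / N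

/-- The integrand `exp (N (S_N(t + β/N) - 2πi k·t))` of a state integral. -/
noncomputable def stateIntegrand (D : OpenDiagram c) (N : ℕ) (μ : ℂ) (β : Internal c → ℂ)
    (k : Internal c → ℤ) (t : Internal c → ℝ) : ℂ :=
  D.expAction N μ (fun i => (t i : ℂ) + β i / N) *
    Complex.exp (-(N * (2 * Real.pi * Complex.I * ∑ i, (k i : ℂ) * (t i : ℂ))))

/-- The state integral over the cube `[0, 1]^E`. -/
noncomputable def stateIntegral (D : OpenDiagram c) (N : ℕ) (μ : ℂ) (β : Internal c → ℂ)
    (k : Internal c → ℤ) : ℂ :=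
  ∫ t in Set.Icc (0 : Internal c → ℝ) 1, D.stateIntegrand N μ β k t

end OpenDiagram

end StateIntegral

/-!
The exponential `f(t) = exp (N S_N(t + β/N))` of the action is smooth on all of `ℝ^E`, but it is not
`1`-periodic; it is periodic only when restricted to the lattice `(1/N) ℤ^E`. The theorem is the
Poisson summation formula for such a function. The sum of the Fourier coefficients of `f` on the cube
at the frequencies `N k`, with `k` in a box, is the integral of `f` against a product of Dirichlet
kernels. Integrating twice by parts against the Dirichlet kernel turns it into the tail of the Fourier
series of the Bernoulli polynomial `B₂`, which is uniformly small, and leaves the trapezoidal rule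
with step `1/N` in each variable (`exists_norm_integral_sub_trapezoid_le`,
`cubeIntegral_bounded_and_tendsto`). As `f` takes equal values at opposite lattice points of the
boundary of the cube, the trapezoidal rule is the average of `f` over `(1/N) {0, …, N - 1}^E`, which
is the state sum (`tendsto_sum_integral_mul_exp`).

Smoothness. The zeros and poles of `Φ_b` lie on the imaginary axis
(`differentiableAt_faddeev_and_ne_zero`), so those of `qlog` lie on the real line. Shape parameters
off the unit circle mean precisely that the arguments of `qlog` in the action have a nonzero constant
imaginary part. Since `Φ_b` is given by pieces, its continuity across the seams needs the functional
equation of Faddeev's integral (`faddeevStrip_sub`). The logarithm of the quotient of the two sides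
is a Fourier integral whose derivative is the Fourier transform of `1 / sinh` along a line; the latter
is computed by shifting the contour by `π i`, where the integrand reproduces itself up to a factor
(`one_add_exp_mul_integral_exp_mul_inv_sinh`).

Periodicity. By the functional equation, `qlog N (t + 1) = qlog N t / (1 - e^{2πiNt})`
(`qlog_add_one`), and at the points of the state sum `1 - e^{2πiNt}` is `1` minus a shape parameter.
At each crossing these four differences are proportional to the first entries of the colors of the
four adjacent regions, up to powers of the meridian eigenvalue that cancel against those from the
exponential prefactor (`ShadowColoring.exists_proportional`). Hence raising the variable of a segment
by `1` multiplies the function of the crossing where the segment ends by the quotient of the region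
parameters on its left and on its right, and that of the crossing where it begins by the inverse
quotient (`expAction_add_period`).
-/

namespace StateIntegral

open Complex MeasureTheory Filter Topology Set

open scoped ContDiff

/-! ### Fourier integrals along horizontal lines -/


theorem integrable_exp_neg_mul_abs {a : ℝ} (ha : 0 < a) :
    Integrable fun x : ℝ => Real.exp (-a * |x|) := by
  have h : IntegrableOn (fun x : ℝ => Real.exp (-a * |x|)) (Ioi 0) :=
    (exp_neg_integrableOn_Ioi 0 ha).congr_fun
      (fun x (hx : 0 < x) => by simp only [abs_of_pos hx]) measurableSet_Ioi
  have h' : IntegrableOn (fun x : ℝ => Real.exp (-a * |x|)) (Iic 0) := by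
    rw [integrableOn_Iic_iff_integrableOn_Iio]
    have := IntegrableOn.comp_neg_Iio (c := (0 : ℝ)) (by simpa using h)
    simpa using this
  rw [← integrableOn_univ, ← Iic_union_Ioi (a := (0 : ℝ))]
  exact h'.union h

theorem integrable_of_norm_le_exp_neg_abs {f : ℝ → ℂ} (hf : Continuous f) {a C : ℝ} (ha : 0 < a)
    (h : ∀ x, ‖f x‖ ≤ C * Real.exp (-a * |x|)) : Integrable f :=
  ((integrable_exp_neg_mul_abs ha).const_mul C).mono' hf.aestronglyMeasurable
    (Eventually.of_forall h)

theorem norm_exp_neg_two_I_mul_le (z : ℂ) (x ε : ℝ) :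
    ‖exp (-2 * I * z * (x + ε * I))‖ ≤
      Real.exp (2 * ε * z.re) * Real.exp (2 * |z.im| * |x|) := by
  rw [norm_exp, ← Real.exp_add, Real.exp_le_exp]
  have : (-2 * I * z * (x + ε * I)).re = 2 * ε * z.re + 2 * (z.im * x) := by
    simp; ring
  rw [this, mul_assoc 2 |z.im|, ← abs_mul]
  gcongr
  exact le_abs_self _

/-- A Fourier transform along the line `Im w = ε` of an exponentially decaying function is
holomorphic in a strip, and may be differentiated under the integral sign. -/
theorem hasDerivAt_integral_exp_mul {k : ℝ → ℂ} (hk : Continuous k) {a C : ℝ} (ε : ℝ)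
    (hC : ∀ x, ‖k x‖ ≤ C * Real.exp (-a * |x|)) {z : ℂ} (hz : 2 * |z.im| < a) :
    Integrable (fun x : ℝ => exp (-2 * I * z * (x + ε * I)) * k x) ∧
    HasDerivAt (fun z : ℂ => ∫ x : ℝ, exp (-2 * I * z * (x + ε * I)) * k x)
      (∫ x : ℝ, exp (-2 * I * z * (x + ε * I)) * (-2 * I * (x + ε * I)) * k x) z := by
  have hint : Integrable (fun x : ℝ => exp (-2 * I * z * (x + ε * I)) * k x) := by
    refine integrable_of_norm_le_exp_neg_abs (a := a - 2 * |z.im|)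
      (C := Real.exp (2 * ε * z.re) * C) (by fun_prop) (by linarith) fun x => ?_
    rw [norm_mul]
    calc _ ≤ (Real.exp (2 * ε * z.re) * Real.exp (2 * |z.im| * |x|)) *
          (C * Real.exp (-a * |x|)) := by
          gcongr
          · exact norm_exp_neg_two_I_mul_le z x ε
          · exact hC x
      _ = _ := by
          rw [show -(a - 2 * |z.im|) * |x| = 2 * |z.im| * |x| + -a * |x| by ring, Real.exp_add]
          ring
  refine ⟨hint, ?_⟩
  have hC0 : 0 ≤ C := by
    have := (norm_nonneg _).trans (hC 0)
    simpa using this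
  -- On the ball of radius `δ` the integrand still decays at the rate `2 * δ`; half of this absorbs
  -- the linear factor `x + ε * I` of the derivative.
  set δ := (a - 2 * |z.im|) / 4 with hδ
  have hδ0 : 0 < δ := by rw [hδ]; linarith
  set D := Real.exp (2 * |ε| * (|z.re| + δ)) with hD
  have hdiff : ∀ (x : ℝ) (y : ℂ), HasDerivAt (fun y : ℂ => exp (-2 * I * y * (x + ε * I)) * k x)
      (exp (-2 * I * y * (x + ε * I)) * (-2 * I * (x + ε * I)) * k x) y := by
    intro x y
    have h1 : HasDerivAt (fun y : ℂ => -2 * I * y * (x + ε * I)) (-2 * I * (x + ε * I)) y := by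
      simpa using ((hasDerivAt_id y).const_mul (-2 * I)).mul_const ((x : ℂ) + ε * I)
    exact h1.cexp.mul_const _
  refine (hasDerivAt_integral_of_dominated_loc_of_deriv_le (μ := volume)
    (F := fun (y : ℂ) (x : ℝ) => exp (-2 * I * y * (x + ε * I)) * k x)
    (F' := fun (y : ℂ) (x : ℝ) => exp (-2 * I * y * (x + ε * I)) * (-2 * I * (x + ε * I)) * k x)
    (bound := fun x => D * (2 * (|ε| + 1 / δ)) * C * Real.exp (-δ * |x|))
    (Metric.ball_mem_nhds z hδ0) ?_ hint ?_ ?_ ?_ ?_).2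
  · exact Eventually.of_forall fun y =>
      (by fun_prop : Continuous fun x : ℝ => exp (-2 * I * y * (x + ε * I)) * k x).aestronglyMeasurable
  · exact (by fun_prop : Continuous fun x : ℝ =>
      exp (-2 * I * z * (x + ε * I)) * (-2 * I * (x + ε * I)) * k x).aestronglyMeasurable
  · refine Eventually.of_forall fun x y hy => ?_
    rw [Metric.mem_ball, dist_eq] at hy
    have him : |y.im| ≤ |z.im| + δ := by
      have h1 := (abs_im_le_norm (y - z)).trans hy.le
      have h2 := abs_sub_abs_le_abs_sub y.im z.im
      rw [sub_im] at h1; linarith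
    have hre : |y.re| ≤ |z.re| + δ := by
      have h1 := (abs_re_le_norm (y - z)).trans hy.le
      have h2 := abs_sub_abs_le_abs_sub y.re z.re
      rw [sub_re] at h1; linarith
    have h1 : Real.exp (2 * ε * y.re) ≤ D := by
      rw [hD, Real.exp_le_exp]
      calc 2 * ε * y.re ≤ |2 * ε * y.re| := le_abs_self _
        _ = 2 * |ε| * |y.re| := by rw [abs_mul, abs_mul, abs_two]
        _ ≤ _ := by gcongr
    have h2 : ‖-2 * I * ((x : ℂ) + ε * I)‖ ≤ 2 * (|ε| + 1 / δ) * Real.exp (δ * |x|) := by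
      have h3 : ‖(x : ℂ) + ε * I‖ ≤ |x| + |ε| := (norm_add_le _ _).trans (by simp)
      have h4 : |x| ≤ 1 / δ * Real.exp (δ * |x|) := by
        have := Real.add_one_le_exp (δ * |x|)
        rw [one_div, inv_mul_eq_div, le_div_iff₀ hδ0]
        linarith
      have h5 : |ε| ≤ |ε| * Real.exp (δ * |x|) :=
        le_mul_of_one_le_right (abs_nonneg _) (Real.one_le_exp (by positivity))
      have h6 : ‖(-2 : ℂ) * I‖ = 2 := by simp
      rw [norm_mul, h6]
      linarith
    rw [norm_mul, norm_mul]
    calc _ ≤ (D * Real.exp (2 * (|z.im| + δ) * |x|)) *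
          (2 * (|ε| + 1 / δ) * Real.exp (δ * |x|)) * (C * Real.exp (-a * |x|)) := by
          gcongr
          · refine (norm_exp_neg_two_I_mul_le y x ε).trans ?_
            gcongr
          · exact hC x
      _ = D * (2 * (|ε| + 1 / δ)) * C * (Real.exp (2 * (|z.im| + δ) * |x|) *
          Real.exp (δ * |x|) * Real.exp (-a * |x|)) := by ring
      _ = _ := by
          rw [← Real.exp_add, ← Real.exp_add]
          congr 2
          rw [hδ]; ring
  · exact (integrable_exp_neg_mul_abs hδ0).const_mul _
  · exact Eventually.of_forall fun x y _ => hdiff x y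

theorem norm_integral_exp_mul_le {k : ℝ → ℂ} {a C : ℝ} (ε : ℝ)
    (hC : ∀ x, ‖k x‖ ≤ C * Real.exp (-a * |x|)) {z : ℂ} (hz : 2 * |z.im| < a) :
    ‖∫ x : ℝ, exp (-2 * I * z * (x + ε * I)) * k x‖ ≤
      Real.exp (2 * ε * z.re) * (C * ∫ x : ℝ, Real.exp (-(a - 2 * |z.im|) * |x|)) := by
  rw [← mul_assoc, ← integral_const_mul]
  refine norm_integral_le_of_norm_le
    ((integrable_exp_neg_mul_abs (by linarith)).const_mul _) (Eventually.of_forall fun x => ?_)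
  rw [norm_mul]
  calc _ ≤ (Real.exp (2 * ε * z.re) * Real.exp (2 * |z.im| * |x|)) *
        (C * Real.exp (-a * |x|)) := by
        gcongr
        · exact norm_exp_neg_two_I_mul_le z x ε
        · exact hC x
    _ = _ := by
        rw [show -(a - 2 * |z.im|) * |x| = 2 * |z.im| * |x| + -a * |x| by ring, Real.exp_add]
        ring

/-- The contour shift: a function that is holomorphic on a closed horizontal strip and decays at
both ends of it has the same integral over both boundary lines. -/
theorem integral_line_eq_integral_line {f : ℂ → ℂ} {p q : ℝ} (hpq : p ≤ q)
    (hd : DifferentiableOn ℂ f {w | w.im ∈ Icc p q})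
    {a C : ℝ} (ha : 0 < a)
    (hC : ∀ x y : ℝ, 1 ≤ |x| → y ∈ Icc p q → ‖f (x + y * I)‖ ≤ C * Real.exp (-a * |x|))
    (hp : Integrable fun x : ℝ => f (x + p * I)) (hq : Integrable fun x : ℝ => f (x + q * I)) :
    ∫ x : ℝ, f (x + p * I) = ∫ x : ℝ, f (x + q * I) := by
  have hrect : ∀ R : ℝ, (∫ x in (-R)..R, f (x + p * I)) - (∫ x in (-R)..R, f (x + q * I)) =
      I • (∫ y in p..q, f ((-R : ℝ) + y * I)) - I • ∫ y in p..q, f ((R : ℝ) + y * I) := by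
    intro R
    have h := integral_boundary_rect_eq_zero_of_differentiableOn f ⟨-R, p⟩ ⟨R, q⟩
      (hd.mono fun w hw => by
        have := hw.2
        rwa [mem_preimage, uIcc_of_le hpq] at this)
    simp only at h
    linear_combination h
  have hvert : ∀ σ : ℝ → ℝ, (∀ R, |σ R| = |R|) →
      Tendsto (fun R : ℝ => ∫ y in p..q, f ((σ R : ℝ) + y * I)) atTop (𝓝 0) := by
    intro σ hσ
    refine squeeze_zero_norm' (a := fun R => C * Real.exp (-(a * R)) * |q - p|) ?_ ?_
    · filter_upwards [eventually_ge_atTop 1] with R hR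
      refine intervalIntegral.norm_integral_le_of_norm_le_const fun y hy => ?_
      rw [uIoc_of_le hpq] at hy
      have := hC (σ R) y (by rw [hσ, abs_of_pos (by linarith)]; exact hR) ⟨hy.1.le, hy.2⟩
      rwa [hσ, abs_of_pos (by linarith : 0 < R), neg_mul] at this
    · have h1 : Tendsto (fun R : ℝ => Real.exp (-(a * R))) atTop (𝓝 0) :=
        Real.tendsto_exp_neg_atTop_nhds_zero.comp (tendsto_id.const_mul_atTop ha)
      simpa using (h1.const_mul C).mul_const |q - p|
  have h1 := (intervalIntegral_tendsto_integral hp tendsto_neg_atTop_atBot tendsto_id).sub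
    (intervalIntegral_tendsto_integral hq tendsto_neg_atTop_atBot tendsto_id)
  have h2 := ((hvert (fun R => -R) (fun R => abs_neg R)).const_smul I).sub
    ((hvert (fun R => R) (fun R => rfl)).const_smul I)
  simp only [smul_zero, sub_zero] at h2
  have h3 := tendsto_nhds_unique (h1.congr fun R => hrect R) h2
  exact sub_eq_zero.mp h3

theorem sinh_line (u v : ℝ) : Complex.sinh (u + v * I) =
    ((Real.sinh u * Real.cos v : ℝ) : ℂ) + ((Real.cosh u * Real.sin v : ℝ) : ℂ) * I := by
  rw [Complex.sinh_add, Complex.cosh_mul_I, Complex.sinh_mul_I]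
  push_cast
  ring

theorem exp_abs_div_two_le_cosh (u : ℝ) : Real.exp |u| / 2 ≤ Real.cosh u := by
  rw [← Real.cosh_abs, Real.cosh_eq]
  have := Real.exp_pos (-|u|)
  linarith

theorem abs_sin_mul_exp_le_norm_sinh (u v : ℝ) :
    |Real.sin v| * (Real.exp |u| / 2) ≤ ‖Complex.sinh (u + v * I)‖ := by
  have h := abs_im_le_norm (Complex.sinh (u + v * I))
  rw [sinh_line, add_im, ofReal_im, im_ofReal_mul, I_im, zero_add, mul_one, abs_mul, ← sinh_line,
    abs_of_pos (Real.cosh_pos u), mul_comm] at h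
  exact (mul_le_mul_of_nonneg_left (exp_abs_div_two_le_cosh u) (abs_nonneg _)).trans h

theorem abs_sinh_le_norm_sinh (u v : ℝ) : |Real.sinh u| ≤ ‖Complex.sinh (u + v * I)‖ := by
  rw [sinh_line, ← Real.sqrt_sq_eq_abs, norm_add_mul_I]
  apply Real.sqrt_le_sqrt
  have h1 := Real.cosh_sq u
  have h2 := Real.sin_sq_add_cos_sq v
  nlinarith [sq_nonneg (Real.sin v)]

theorem exp_abs_div_four_le_norm_sinh {u : ℝ} (hu : 1 ≤ |u|) (v : ℝ) :
    Real.exp |u| / 4 ≤ ‖Complex.sinh (u + v * I)‖ := by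
  refine le_trans ?_ (abs_sinh_le_norm_sinh u v)
  rw [Real.abs_sinh, Real.sinh_eq, Real.exp_neg]
  have h1 : 2 ≤ Real.exp |u| := by linarith [Real.add_one_le_exp |u|]
  have h2 : (Real.exp |u|)⁻¹ ≤ 2⁻¹ := inv_anti₀ two_pos h1
  linarith

/-! ### The Fourier transform of `1 / sinh` -/


theorem sinh_ne_zero_of_sin_ne_zero (u : ℝ) {v : ℝ} (hv : Real.sin v ≠ 0) :
    Complex.sinh (u + v * I) ≠ 0 := by
  have h := abs_sin_mul_exp_le_norm_sinh u v
  have : 0 < |Real.sin v| * (Real.exp |u| / 2) := by positivity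
  exact norm_pos_iff.mp (this.trans_le h)

theorem continuous_inv_sinh_line {v : ℝ} (hv : Real.sin v ≠ 0) :
    Continuous fun u : ℝ => (Complex.sinh (u + v * I))⁻¹ :=
  Continuous.inv₀ (Complex.continuous_sinh.comp (by fun_prop))
    fun u => sinh_ne_zero_of_sin_ne_zero u hv

theorem norm_inv_sinh_line_le (u : ℝ) {v : ℝ} (hv : Real.sin v ≠ 0) :
    ‖(Complex.sinh (u + v * I))⁻¹‖ ≤ 2 / |Real.sin v| * Real.exp (-1 * |u|) := by
  rw [norm_inv, neg_one_mul, Real.exp_neg]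
  have h := abs_sin_mul_exp_le_norm_sinh u v
  have h0 : 0 < |Real.sin v| := by positivity
  calc _ ≤ (|Real.sin v| * (Real.exp |u| / 2))⁻¹ := inv_anti₀ (by positivity) h
    _ = _ := by field_simp

theorem integral_inv_cosh : ∫ u : ℝ, (Real.cosh u)⁻¹ = Real.pi := by
  have hd : ∀ u : ℝ, HasDerivAt (fun u => Real.arctan (Real.sinh u)) (Real.cosh u)⁻¹ u := by
    intro u
    convert (Real.hasDerivAt_sinh u).arctan using 1
    rw [← Real.cosh_sq']
    field_simp [(Real.cosh_pos u).ne']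
  have hint : Integrable fun u : ℝ => (Real.cosh u)⁻¹ := by
    refine ((integrable_exp_neg_mul_abs one_pos).const_mul 2).mono'
      (Real.continuous_cosh.inv₀ fun u => (Real.cosh_pos u).ne').aestronglyMeasurable
      (Eventually.of_forall fun u => ?_)
    rw [norm_inv, Real.norm_of_nonneg (Real.cosh_pos u).le, neg_one_mul, Real.exp_neg]
    calc _ ≤ (Real.exp |u| / 2)⁻¹ := inv_anti₀ (by positivity) (exp_abs_div_two_le_cosh u)
      _ = _ := by field_simp
  have htop : Tendsto (fun u => Real.arctan (Real.sinh u)) atTop (𝓝 (Real.pi / 2)) :=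
    (tendsto_nhds_of_tendsto_nhdsWithin Real.tendsto_arctan_atTop).comp
      (Real.sinhOrderIso.tendsto_atTop)
  have hbot : Tendsto (fun u => Real.arctan (Real.sinh u)) atBot (𝓝 (-(Real.pi / 2))) :=
    (tendsto_nhds_of_tendsto_nhdsWithin Real.tendsto_arctan_atBot).comp
      (Real.sinhOrderIso.tendsto_atBot)
  rw [integral_of_hasDerivAt_of_tendsto hd hint hbot htop]
  ring

theorem sin_one_ne_zero : Real.sin 1 ≠ 0 :=
  (Real.sin_pos_of_pos_of_lt_pi one_pos (by linarith [Real.pi_gt_three])).ne'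

theorem integral_inv_sinh_line_one :
    ∫ u : ℝ, (Complex.sinh (u + (1 : ℝ) * I))⁻¹ = -(Real.pi * I) := by
  have hsin : ∀ y ∈ Icc 1 (Real.pi / 2), Real.sin y ≠ 0 := fun y hy =>
    (Real.sin_pos_of_pos_of_lt_pi (by linarith [hy.1]) (by linarith [hy.2, Real.pi_gt_three])).ne'
  have hpi : (1 : ℝ) ≤ Real.pi / 2 := by linarith [Real.pi_gt_three]
  have hint : ∀ y ∈ Icc 1 (Real.pi / 2),
      Integrable fun u : ℝ => (Complex.sinh (u + y * I))⁻¹ := fun y hy =>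
    integrable_of_norm_le_exp_neg_abs (continuous_inv_sinh_line (hsin y hy)) one_pos
      fun u => norm_inv_sinh_line_le u (hsin y hy)
  have h := integral_line_eq_integral_line (f := fun w => (Complex.sinh w)⁻¹) hpi
    (a := 1) (C := 4) ?_ one_pos ?_ (hint 1 ⟨le_rfl, hpi⟩) (hint _ ⟨hpi, le_rfl⟩)
  · rw [h]
    have h1 : ∀ u : ℝ, (Complex.sinh (u + (Real.pi / 2 : ℝ) * I))⁻¹ =
        (((Real.cosh u)⁻¹ : ℝ) : ℂ) * -I := by
      intro u
      rw [sinh_line, Real.cos_pi_div_two, Real.sin_pi_div_two]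
      simp [mul_comm]
    simp_rw [h1]
    rw [integral_mul_const, integral_complex_ofReal, integral_inv_cosh]
    simp
  · intro w hw
    have h1 : Complex.sinh w ≠ 0 := by
      rw [← re_add_im w]
      exact sinh_ne_zero_of_sin_ne_zero _ (hsin _ hw)
    exact (Complex.differentiable_sinh.differentiableAt.inv h1).differentiableWithinAt
  · intro x y hx _
    rw [norm_inv, neg_one_mul, Real.exp_neg]
    calc _ ≤ (Real.exp |x| / 4)⁻¹ :=
          inv_anti₀ (by positivity) (exp_abs_div_four_le_norm_sinh hx y)
      _ = _ := by field_simp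

theorem sinh_ne_zero_of_ne_pi_mul_I {w : ℂ} (hw : w.im ∈ Icc 1 (1 + Real.pi))
    (hne : w ≠ Real.pi * I) : Complex.sinh w ≠ 0 := by
  intro h
  have hline := sinh_line w.re w.im
  rw [re_add_im, h] at hline
  have him := congrArg Complex.im hline
  have hre := congrArg Complex.re hline
  simp only [zero_im, zero_re, add_im, add_re, ofReal_im, ofReal_re, mul_I_im, mul_I_re, zero_add,
    neg_zero, add_zero] at him hre
  have hsin : Real.sin w.im = 0 := by
    rcases mul_eq_zero.mp him.symm with h | h
    · exact absurd h (Real.cosh_pos _).ne'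
    · exact h
  have hcos : Real.cos w.im ≠ 0 := by
    intro h
    have := Real.sin_sq_add_cos_sq w.im
    rw [hsin, h] at this
    norm_num at this
  have hre0 : w.re = 0 := by
    rcases mul_eq_zero.mp hre.symm with h | h
    · exact Real.sinh_eq_zero.mp h
    · exact absurd h hcos
  have him0 : w.im = Real.pi := by
    rcases lt_trichotomy w.im Real.pi with h | h | h
    · exact absurd hsin (Real.sin_pos_of_pos_of_lt_pi (by linarith [hw.1]) h).ne'
    · exact h
    · have h1 := Real.sin_pos_of_pos_of_lt_pi (x := w.im - Real.pi) (by linarith)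
        (by linarith [hw.2, Real.pi_gt_three])
      rw [Real.sin_sub_pi, hsin] at h1
      norm_num at h1
  exact hne (by rw [← re_add_im w, hre0, him0]; simp)

/-- The Fourier transform of `1 / sinh` along the line `Im w = 1`. Both this line and its translate
by `π i` see the same function up to the factor `-e^{2πs}`; subtracting `e^{2πs} / sinh` removes the
pole between the two lines without destroying the decay. -/
theorem one_add_exp_mul_integral_exp_mul_inv_sinh {s : ℂ} (hs : 2 * |s.im| < 1) :
    (1 + exp (2 * Real.pi * s)) *
      (∫ u : ℝ, exp (-2 * I * s * (u + (1 : ℝ) * I)) * (Complex.sinh (u + (1 : ℝ) * I))⁻¹) =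
    -(2 * Real.pi * I) * exp (2 * Real.pi * s) := by
  set q := exp (2 * Real.pi * s) with hq
  set c : ℂ := Real.pi * I with hc
  set E : ℂ → ℂ := fun w => exp (-2 * I * s * w) - q with hE
  have hEd : Differentiable ℂ E := by fun_prop
  have hEc : E c = 0 := by
    simp only [hE, hq, hc]
    rw [sub_eq_zero]
    congr 1
    linear_combination (-2 * s * Real.pi) * I_mul_I
  have hsc : Complex.sinh c = 0 := by rw [hc, Complex.sinh_mul_I, ← ofReal_sin]; simp
  set h : ℂ → ℂ := fun w => dslope E c w / dslope Complex.sinh c w with hh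
  have hval : ∀ w, w ≠ c → h w = E w * (Complex.sinh w)⁻¹ := by
    intro w hw
    have : w - c ≠ 0 := sub_ne_zero.mpr hw
    simp only [hh, dslope_of_ne _ hw, slope_def_field, hEc, hsc, sub_zero]
    field_simp
  have hds : ∀ {f : ℂ → ℂ}, Differentiable ℂ f → Differentiable ℂ (dslope f c) := fun hf =>
    differentiableOn_univ.mp ((differentiableOn_dslope univ_mem).mpr hf.differentiableOn)
  have hden : ∀ w : ℂ, w.im ∈ Icc 1 (1 + Real.pi) → dslope Complex.sinh c w ≠ 0 := by
    intro w hw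
    by_cases hwc : w = c
    · rw [hwc, dslope_same, (Complex.hasDerivAt_sinh c).deriv, hc, Complex.cosh_mul_I, ← ofReal_cos]
      simp
    · rw [dslope_of_ne _ hwc, slope_def_field, hsc, sub_zero]
      exact div_ne_zero (sinh_ne_zero_of_ne_pi_mul_I hw hwc) (sub_ne_zero.mpr hwc)
  have hpi := Real.pi_pos
  have hsin : Real.sin (1 + Real.pi) ≠ 0 := by
    rw [Real.sin_add_pi]; exact neg_ne_zero.mpr sin_one_ne_zero
  have hintE : ∀ y : ℝ, Real.sin y ≠ 0 → Integrable fun u : ℝ =>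
      exp (-2 * I * s * (u + y * I)) * (Complex.sinh (u + y * I))⁻¹ := fun y hy =>
    (hasDerivAt_integral_exp_mul (continuous_inv_sinh_line hy) y
      (fun u => norm_inv_sinh_line_le u hy) hs).1
  have hint1 : ∀ y : ℝ, Real.sin y ≠ 0 → Integrable fun u : ℝ =>
      q * (Complex.sinh (u + y * I))⁻¹ := fun y hy =>
    (integrable_of_norm_le_exp_neg_abs (continuous_inv_sinh_line hy) one_pos
      fun u => norm_inv_sinh_line_le u hy).const_mul q
  have hline : ∀ y : ℝ, Real.sin y ≠ 0 → (fun u : ℝ => h (u + y * I)) = fun u : ℝ =>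
      exp (-2 * I * s * (u + y * I)) * (Complex.sinh (u + y * I))⁻¹ -
        q * (Complex.sinh (u + y * I))⁻¹ := by
    intro y hy
    funext u
    rw [hval]
    · simp only [hE]; ring
    · intro h0
      have := sinh_ne_zero_of_sin_ne_zero u hy
      rw [h0, hsc] at this
      exact this rfl
  have key := integral_line_eq_integral_line (f := h) (p := 1) (q := 1 + Real.pi) (by linarith)
    (a := 1 - 2 * |s.im|)
    (C := 4 * (Real.exp (2 * (1 + Real.pi) * |s.re|) + ‖q‖))
    (fun w hw => (((hds hEd) w).div ((hds Complex.differentiable_sinh) w)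
      (hden w hw)).differentiableWithinAt) (by linarith) ?_
    (by rw [hline 1 sin_one_ne_zero]; exact (hintE 1 sin_one_ne_zero).sub (hint1 1 sin_one_ne_zero))
    (by rw [hline _ hsin]; exact (hintE _ hsin).sub (hint1 _ hsin))
  · rw [hline 1 sin_one_ne_zero, hline _ hsin,
      integral_sub (hintE 1 sin_one_ne_zero) (hint1 1 sin_one_ne_zero),
      integral_sub (hintE _ hsin) (hint1 _ hsin), integral_const_mul, integral_const_mul,
      integral_inv_sinh_line_one] at key
    have h1 : ∀ u : ℝ, (Complex.sinh (u + (1 + Real.pi : ℝ) * I))⁻¹ =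
        -(Complex.sinh (u + (1 : ℝ) * I))⁻¹ := by
      intro u
      rw [← inv_neg, ← Complex.sinh_add_pi_mul_I]
      congr 2
      push_cast; ring
    have h2 : ∀ u : ℝ, exp (-2 * I * s * (u + (1 + Real.pi : ℝ) * I)) =
        q * exp (-2 * I * s * (u + (1 : ℝ) * I)) := by
      intro u
      rw [hq, ← Complex.exp_add]
      congr 1
      push_cast
      linear_combination (-2 * s * Real.pi) * I_mul_I
    simp_rw [h1, h2, mul_neg, mul_assoc q] at key
    rw [integral_neg, integral_neg, integral_const_mul, integral_inv_sinh_line_one] at key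
    linear_combination key
  · intro x y hx hy
    have hyp : (0 : ℝ) ≤ y := by linarith [hy.1]
    have hne : (x + y * I : ℂ) ≠ c := by
      intro h0
      have := congrArg Complex.re h0
      simp [hc] at this
      rw [this] at hx; norm_num at hx
    rw [hval _ hne, norm_mul, norm_inv]
    have hn : ‖E (x + y * I)‖ ≤ (Real.exp (2 * (1 + Real.pi) * |s.re|) + ‖q‖) *
        Real.exp (2 * |s.im| * |x|) := by
      refine (norm_sub_le _ _).trans ?_
      rw [add_mul]
      refine add_le_add ((norm_exp_neg_two_I_mul_le s x y).trans ?_)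
        (le_mul_of_one_le_right (norm_nonneg _) (Real.one_le_exp (by positivity)))
      gcongr Real.exp ?_ * _
      calc 2 * y * s.re ≤ 2 * y * |s.re| := by gcongr; exact le_abs_self _
        _ ≤ _ := by gcongr; exact hy.2
    calc _ ≤ ((Real.exp (2 * (1 + Real.pi) * |s.re|) + ‖q‖) * Real.exp (2 * |s.im| * |x|)) *
          (Real.exp |x| / 4)⁻¹ := by
          gcongr
          exact exp_abs_div_four_le_norm_sinh hx y
      _ = 4 * (Real.exp (2 * (1 + Real.pi) * |s.re|) + ‖q‖) *
          (Real.exp (2 * |s.im| * |x|) * Real.exp (-|x|)) := by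
          rw [Real.exp_neg]; field_simp
      _ = _ := by
          rw [← Real.exp_add]
          congr 2
          ring

/-! ### Faddeev's quantum dilogarithm -/


theorem norm_inv_add_mul_I_le (x : ℝ) {ε : ℝ} (hε : 0 < ε) : ‖((x : ℂ) + ε * I)⁻¹‖ ≤ ε⁻¹ := by
  rw [norm_inv]
  refine inv_anti₀ hε ?_
  have := abs_im_le_norm ((x : ℂ) + ε * I)
  rw [add_im, ofReal_im, im_ofReal_mul, I_im, mul_one, zero_add] at this
  exact (le_abs_self ε).trans this

theorem add_mul_I_ne_zero (x : ℝ) {ε : ℝ} (hε : 0 < ε) : (x : ℂ) + ε * I ≠ 0 := by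
  intro h
  have := congrArg Complex.im h
  simp at this
  exact hε.ne' this

/-- The exponentially decaying factor of the integrand of `faddeevStrip`. -/
noncomputable def faddeevKernel (b x : ℝ) : ℂ :=
  (Complex.sinh ((b * x : ℝ) + (1 : ℝ) * I))⁻¹ *
    (Complex.sinh ((x / b : ℝ) + (b⁻¹ ^ 2 : ℝ) * I))⁻¹ * ((x : ℂ) + (b⁻¹ : ℝ) * I)⁻¹ / 4

/-- The exponentially decaying factor of the integral for the logarithm of the quotient of two
values of `faddeevStrip` that differ by a step of length `b⁻¹`. -/
noncomputable def stepKernel (b x : ℝ) : ℂ :=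
  -(1 / 2) * ((Complex.sinh ((b * x : ℝ) + (1 : ℝ) * I))⁻¹ * ((x : ℂ) + (b⁻¹ : ℝ) * I)⁻¹)

section

variable {b : ℝ}

theorem sin_inv_sq_ne_zero (hb : 1 < b) : Real.sin (b⁻¹ ^ 2) ≠ 0 := by
  have h0 : 0 < b⁻¹ := by positivity
  have h1 : b⁻¹ < 1 := inv_lt_one_of_one_lt₀ hb
  exact (Real.sin_pos_of_pos_of_lt_pi (by positivity) (by nlinarith [Real.pi_gt_three])).ne'

theorem continuous_inv_add_mul_I (hb : 0 < b) :
    Continuous fun x : ℝ => ((x : ℂ) + (b⁻¹ : ℝ) * I)⁻¹ :=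
  Continuous.inv₀ (by fun_prop) fun x => add_mul_I_ne_zero x (inv_pos.mpr hb)

theorem continuous_faddeevKernel (hb : 1 < b) : Continuous (faddeevKernel b) := by
  have hb0 : 0 < b := by linarith
  exact ((((continuous_inv_sinh_line sin_one_ne_zero).comp (continuous_const_mul b)).mul
    ((continuous_inv_sinh_line (sin_inv_sq_ne_zero hb)).comp (continuous_id.div_const b))).mul
    (continuous_inv_add_mul_I hb0)).div_const 4

theorem continuous_stepKernel (hb : 1 < b) : Continuous (stepKernel b) := by
  have hb0 : 0 < b := by linarith
  exact continuous_const.mul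
    (((continuous_inv_sinh_line sin_one_ne_zero).comp (continuous_const_mul b)).mul
    (continuous_inv_add_mul_I hb0))

theorem norm_faddeevKernel_le (hb : 1 < b) (x : ℝ) :
    ‖faddeevKernel b x‖ ≤ (2 / |Real.sin 1| * (2 / |Real.sin (b⁻¹ ^ 2)|) * b / 4) *
      Real.exp (-(b + b⁻¹) * |x|) := by
  have hb0 : 0 < b := by linarith
  have h1 := norm_inv_sinh_line_le (b * x) sin_one_ne_zero
  have h2 := norm_inv_sinh_line_le (x / b) (sin_inv_sq_ne_zero hb)
  have h3 := norm_inv_add_mul_I_le x (inv_pos.mpr hb0)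
  rw [inv_inv] at h3
  rw [faddeevKernel, norm_div, norm_mul, norm_mul]
  have h4 : ‖(4 : ℂ)‖ = 4 := by simp
  rw [h4]
  calc _ ≤ (2 / |Real.sin 1| * Real.exp (-1 * |b * x|)) *
        (2 / |Real.sin (b⁻¹ ^ 2)| * Real.exp (-1 * |x / b|)) * b / 4 := by gcongr
    _ = (2 / |Real.sin 1| * (2 / |Real.sin (b⁻¹ ^ 2)|) * b / 4) *
        (Real.exp (-1 * |b * x|) * Real.exp (-1 * |x / b|)) := by ring
    _ = _ := by
        rw [← Real.exp_add, abs_mul, abs_div, abs_of_pos hb0]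
        congr 2
        ring

theorem norm_stepKernel_le (hb : 1 < b) (x : ℝ) :
    ‖stepKernel b x‖ ≤ (1 / 2 * (2 / |Real.sin 1| * b)) * Real.exp (-b * |x|) := by
  have hb0 : 0 < b := by linarith
  have h1 := norm_inv_sinh_line_le (b * x) sin_one_ne_zero
  have h3 := norm_inv_add_mul_I_le x (inv_pos.mpr hb0)
  rw [inv_inv] at h3
  rw [stepKernel, norm_mul, norm_mul]
  have h4 : ‖(-(1 / 2) : ℂ)‖ = 1 / 2 := by simp
  rw [h4]
  calc _ ≤ 1 / 2 * ((2 / |Real.sin 1| * Real.exp (-1 * |b * x|)) * b) := by gcongr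
    _ = _ := by
        rw [abs_mul, abs_of_pos hb0, neg_one_mul, neg_mul]
        ring

theorem line_mul (hb : 0 < b) (x : ℝ) :
    ((x : ℂ) + (b⁻¹ : ℝ) * I) * b = (b * x : ℝ) + (1 : ℝ) * I := by
  have : (b : ℂ) ≠ 0 := ofReal_ne_zero.mpr hb.ne'
  push_cast
  field_simp

theorem line_div (hb : 0 < b) (x : ℝ) :
    ((x : ℂ) + (b⁻¹ : ℝ) * I) / b = (x / b : ℝ) + (b⁻¹ ^ 2 : ℝ) * I := by
  have : (b : ℂ) ≠ 0 := ofReal_ne_zero.mpr hb.ne'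
  push_cast
  field_simp

theorem faddeevStrip_eq (hb : 1 < b) (z : ℂ) : faddeevStrip b z =
    exp (∫ x : ℝ, exp (-2 * I * z * (x + (b⁻¹ : ℝ) * I)) * faddeevKernel b x) := by
  have hb0 : 0 < b := by linarith
  have hmin : min b b⁻¹ = b⁻¹ := min_eq_right ((inv_lt_one_of_one_lt₀ hb).le.trans hb.le)
  rw [faddeevStrip, hmin]
  congr 2
  funext x
  rw [line_mul hb0, line_div hb0, faddeevKernel]
  simp only [div_eq_mul_inv, mul_inv]
  ring

theorem differentiableAt_faddeevStrip (hb : 1 < b) {z : ℂ} (hz : 2 * |z.im| < b + b⁻¹) :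
    DifferentiableAt ℂ (faddeevStrip b) z := by
  rw [show faddeevStrip b = fun z => exp (∫ x : ℝ, exp (-2 * I * z * (x + (b⁻¹ : ℝ) * I)) *
    faddeevKernel b x) from funext (faddeevStrip_eq hb)]
  exact (hasDerivAt_integral_exp_mul (continuous_faddeevKernel hb) b⁻¹
    (norm_faddeevKernel_le hb) hz).2.differentiableAt.cexp

theorem hasDerivAt_integral_stepKernel (hb : 1 < b) {z : ℂ} (hz : 2 * |z.im| < b) :
    ∃ P' : ℂ, HasDerivAt
      (fun z => ∫ x : ℝ, exp (-2 * I * z * (x + (b⁻¹ : ℝ) * I)) * stepKernel b x) P' z ∧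
      (1 + exp (2 * Real.pi * (z / b))) * P' = 2 * Real.pi / b * exp (2 * Real.pi * (z / b)) := by
  have hb0 : 0 < b := by linarith
  have hbC : (b : ℂ) ≠ 0 := ofReal_ne_zero.mpr hb0.ne'
  refine ⟨_, (hasDerivAt_integral_exp_mul (continuous_stepKernel hb) b⁻¹
    (norm_stepKernel_le hb) hz).2, ?_⟩
  have hs : 2 * |(z / b).im| < 1 := by
    rw [div_ofReal_im, abs_div, abs_of_pos hb0, ← mul_div_assoc, div_lt_one hb0]
    exact hz
  set g : ℝ → ℂ := fun u => exp (-2 * I * (z / b) * (u + (1 : ℝ) * I)) *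
    (Complex.sinh (u + (1 : ℝ) * I))⁻¹ with hg
  have h1 : ∀ x : ℝ, exp (-2 * I * z * (x + (b⁻¹ : ℝ) * I)) * (-2 * I * (x + (b⁻¹ : ℝ) * I)) *
      stepKernel b x = I * g (b * x) := by
    intro x
    have h2 := add_mul_I_ne_zero x (inv_pos.mpr hb0)
    have h3 : -2 * I * z * (x + (b⁻¹ : ℝ) * I) =
        -2 * I * (z / b) * ((b * x : ℝ) + (1 : ℝ) * I) := by
      rw [← line_mul hb0]
      field_simp
    simp only [stepKernel, h3, hg]
    linear_combination I * exp (-2 * I * (z / b) * ((b * x : ℝ) + (1 : ℝ) * I)) *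
      (Complex.sinh ((b * x : ℝ) + (1 : ℝ) * I))⁻¹ * mul_inv_cancel₀ h2
  rw [integral_congr_ae (Eventually.of_forall h1), integral_const_mul,
    Measure.integral_comp_mul_left g, abs_of_pos (inv_pos.mpr hb0), real_smul,
    ofReal_inv]
  have h := one_add_exp_mul_integral_exp_mul_inv_sinh hs
  linear_combination I * (b : ℂ)⁻¹ * h - 2 * Real.pi * (b : ℂ)⁻¹ *
    exp (2 * Real.pi * (z / b)) * I_mul_I

theorem exp_integral_stepKernel (hb : 1 < b) {z : ℂ} (hz : 2 * |z.im| < b) :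
    exp (∫ x : ℝ, exp (-2 * I * z * (x + (b⁻¹ : ℝ) * I)) * stepKernel b x) =
      1 + exp (2 * Real.pi * (z / b)) := by
  have hb0 : 0 < b := by linarith
  set P : ℂ → ℂ := fun z => ∫ x : ℝ, exp (-2 * I * z * (x + (b⁻¹ : ℝ) * I)) * stepKernel b x
    with hP
  set q : ℂ → ℂ := fun z => exp (2 * Real.pi * (z / b)) with hq
  set g : ℝ → ℂ := fun r => exp (-P (z - r)) * (1 + q (z - r)) with hg
  have him : ∀ r : ℝ, (z - r).im = z.im := fun r => by simp
  have hd : ∀ r : ℝ, HasDerivAt g 0 r := by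
    intro r
    obtain ⟨P', hP', heq⟩ := hasDerivAt_integral_stepKernel hb (z := z - r) (by rwa [him])
    have hsub : HasDerivAt (fun r : ℂ => z - r) (-1) (r : ℂ) := (hasDerivAt_id _).const_sub z
    have h1 : HasDerivAt (fun r : ℂ => P (z - r)) (P' * -1) (r : ℂ) :=
      HasDerivAt.comp (r : ℂ) hP' hsub
    have h2 : HasDerivAt q (exp (2 * Real.pi * ((z - r) / b)) * (2 * Real.pi * (1 / b))) (z - r) :=
      (((hasDerivAt_id _).div_const (b : ℂ)).const_mul (2 * Real.pi : ℂ)).cexp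
    have h3 := HasDerivAt.comp (r : ℂ) h2 hsub
    have h4 := (h1.neg.cexp.mul (h3.const_add 1)).comp_ofReal
    refine h4.congr_deriv ?_
    simp only [Function.comp, hq, Pi.neg_apply]
    linear_combination exp (-P (z - r)) * heq
  have hconst : ∀ r, g r = g 0 := fun r =>
    is_const_of_deriv_eq_zero (fun r => (hd r).differentiableAt) (fun r => (hd r).deriv) r 0
  have hre : ∀ r : ℝ, (z - r).re = z.re - r := fun r => by simp
  have hlin : ∀ c : ℝ, 0 < c → Tendsto (fun r : ℝ => Real.exp (c * (z.re - r))) atTop (𝓝 0) := by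
    intro c hc
    refine Real.tendsto_exp_atBot.comp ?_
    refine Tendsto.const_mul_atBot hc ?_
    exact (tendsto_atBot_add_const_left atTop z.re tendsto_neg_atTop_atBot).congr
      fun r => (sub_eq_add_neg _ _).symm
  have hP0 : Tendsto (fun r : ℝ => P (z - r)) atTop (𝓝 0) := by
    have h1 := (hlin (2 * b⁻¹) (by positivity)).mul_const
      ((1 / 2 * (2 / |Real.sin 1| * b)) * ∫ x : ℝ, Real.exp (-(b - 2 * |z.im|) * |x|))
    rw [zero_mul] at h1
    refine squeeze_zero_norm (fun r => ?_) h1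
    have := norm_integral_exp_mul_le b⁻¹ (norm_stepKernel_le hb) (z := z - r) (by rwa [him])
    rwa [him, hre] at this
  have hq0 : Tendsto (fun r : ℝ => q (z - r)) atTop (𝓝 0) := by
    refine squeeze_zero_norm (fun r => ?_) (hlin (2 * Real.pi / b) (by positivity))
    rw [hq, norm_exp]
    refine le_of_eq (congrArg Real.exp ?_)
    have : (2 * Real.pi * ((z - r) / b) : ℂ) = ((2 * Real.pi / b : ℝ) : ℂ) * (z - r) := by
      push_cast; ring
    rw [this, re_ofReal_mul, hre]
  have hlim : Tendsto g atTop (𝓝 1) := by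
    have h1 := (hP0.neg.cexp).mul (hq0.const_add 1)
    simpa using h1
  have h0 : g 0 = 1 := tendsto_nhds_unique (tendsto_const_nhds.congr fun r => (hconst r).symm) hlim
  simp only [hg, ofReal_zero, sub_zero, Complex.exp_neg] at h0
  rw [inv_mul_eq_one₀ (Complex.exp_ne_zero _)] at h0
  exact h0

/-- The functional equation of Faddeev's integral. -/
theorem faddeevStrip_sub (hb : 1 < b) {z : ℂ} (hz : 2 * |z.im| < b) :
    faddeevStrip b (z - I / (2 * b)) =
      (1 + exp (2 * Real.pi / b * z)) * faddeevStrip b (z + I / (2 * b)) := by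
  have hb0 : 0 < b := by linarith
  have hbC : (b : ℂ) ≠ 0 := ofReal_ne_zero.mpr hb0.ne'
  have hI : (I / (2 * b) : ℂ) = ((2 * b)⁻¹ : ℝ) * I := by push_cast; field_simp
  have hinv : 2 * (2 * b)⁻¹ = b⁻¹ := by field_simp
  have hinv0 : 0 < (2 * b)⁻¹ := by positivity
  have hint : ∀ w : ℂ, 2 * |w.im| < b + b⁻¹ →
      Integrable fun x : ℝ => exp (-2 * I * w * (x + (b⁻¹ : ℝ) * I)) * faddeevKernel b x :=
    fun w hw => (hasDerivAt_integral_exp_mul (continuous_faddeevKernel hb) b⁻¹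
      (norm_faddeevKernel_le hb) hw).1
  have hm : 2 * |(z - I / (2 * b)).im| < b + b⁻¹ := by
    rw [hI, sub_im, im_ofReal_mul, I_im, mul_one]
    have := abs_sub z.im (2 * b)⁻¹
    rw [abs_of_pos hinv0] at this
    linarith
  have hp : 2 * |(z + I / (2 * b)).im| < b + b⁻¹ := by
    rw [hI, add_im, im_ofReal_mul, I_im, mul_one]
    have := abs_add_le z.im (2 * b)⁻¹
    rw [abs_of_pos hinv0] at this
    linarith
  rw [show (2 * Real.pi / b * z : ℂ) = 2 * Real.pi * (z / b) by ring,
    ← exp_integral_stepKernel hb hz, faddeevStrip_eq hb, faddeevStrip_eq hb, ← Complex.exp_add]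
  congr 1
  rw [← sub_eq_iff_eq_add, ← integral_sub (hint _ hm) (hint _ hp)]
  congr 1
  funext x
  rw [← sub_mul]
  set w : ℂ := (x : ℂ) + (b⁻¹ : ℝ) * I with hw
  have e1 : exp (-2 * I * (z - I / (2 * b)) * w) = exp (-2 * I * z * w) * exp (-(w / b)) := by
    rw [← Complex.exp_add]; congr 1; field_simp; linear_combination w * I_sq
  have e2 : exp (-2 * I * (z + I / (2 * b)) * w) = exp (-2 * I * z * w) * exp (w / b) := by
    rw [← Complex.exp_add]; congr 1; field_simp; linear_combination (-w) * I_sq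
  have hs : Complex.sinh (w / b) ≠ 0 := by
    rw [hw, line_div hb0]
    exact sinh_ne_zero_of_sin_ne_zero _ (sin_inv_sq_ne_zero hb)
  have e3 : exp (-(w / b)) - exp (w / b) = -2 * Complex.sinh (w / b) := by
    rw [Complex.sinh]; ring
  rw [e1, e2, ← mul_sub, e3, faddeevKernel, stepKernel, ← line_div hb0, ← hw]
  field_simp
  norm_num

theorem one_add_exp_ne_zero {w : ℂ} (hw : w.re ≠ 0) : 1 + exp w ≠ 0 := by
  intro h
  have h1 : exp w = -1 := by linear_combination h
  have h2 := congrArg norm h1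
  rw [norm_exp, norm_neg, norm_one, Real.exp_eq_one_iff] at h2
  exact hw h2

/-- The functional equation of the quantum dilogarithm, away from its zeros and poles. -/
theorem faddeev_add (hb : 0 < b) {z : ℂ} (hz : z.re ≠ 0) :
    faddeev b (z + I / b) * (1 + exp (2 * Real.pi / b * (z + I / (2 * b)))) = faddeev b z := by
  have hbC : (b : ℂ) ≠ 0 := ofReal_ne_zero.mpr hb.ne'
  have hne : 1 + exp (2 * Real.pi / b * (z + I / (2 * b))) ≠ 0 := by
    apply one_add_exp_ne_zero
    have h1 : (2 * Real.pi / b * (z + I / (2 * b)) : ℂ) =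
        ((2 * Real.pi / b : ℝ) : ℂ) * (z + ((2 * b)⁻¹ : ℝ) * I) := by
      push_cast; field_simp
    rw [h1, re_ofReal_mul, add_re, re_ofReal_mul, I_re, mul_zero, add_zero]
    have := Real.pi_pos
    positivity
  have hfloor : ⌊b * (z + I / b).im + 1 / 2⌋ = ⌊b * z.im + 1 / 2⌋ + 1 := by
    rw [← Int.floor_add_one]
    congr 1
    rw [add_im, div_ofReal_im, I_im]
    field_simp
    ring
  simp only [faddeev, hfloor]
  set n := ⌊b * z.im + 1 / 2⌋
  have hz0 : z + I / b - I * ((n + 1 : ℤ) : ℂ) / b = z - I * n / b := by push_cast; ring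
  rw [hz0]
  rcases le_or_gt 0 n with hn | hn
  · obtain ⟨m, hm⟩ := Int.eq_ofNat_of_zero_le hn
    rw [hm, show ((m : ℤ) + 1).toNat = m + 1 by omega, show (-((m : ℤ) + 1)).toNat = 0 by omega,
      show (m : ℤ).toNat = m by omega, show (-(m : ℤ)).toNat = 0 by omega, Finset.prod_range_succ,
      show z - I * ((m : ℤ) : ℂ) / b + I * ((m : ℂ) + 1 / 2) / b = z + I / (2 * b) by
        push_cast; field_simp; ring]
    simp only [Finset.range_zero, Finset.prod_empty, mul_one]
    rw [mul_assoc, mul_assoc, inv_mul_cancel₀ hne, mul_one]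
  · obtain ⟨m, hm⟩ : ∃ m : ℕ, n = -((m : ℤ) + 1) := ⟨(-n - 1).toNat, by omega⟩
    rw [hm, show (-((m : ℤ) + 1) + 1).toNat = 0 by omega,
      show (-(-((m : ℤ) + 1) + 1)).toNat = m by omega,
      show (-((m : ℤ) + 1)).toNat = 0 by omega,
      show (-(-((m : ℤ) + 1))).toNat = m + 1 by omega, Finset.prod_range_succ,
      show z - I * ((-((m : ℤ) + 1) : ℤ) : ℂ) / b - I * ((m : ℂ) + 1 / 2) / b = z + I / (2 * b) by
        push_cast; field_simp; ring]
    ring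

/-- On a neighbourhood of the strip where `faddeev` is defined by the integral, the integral still
represents it, because the integral satisfies the functional equation. -/
theorem faddeev_eq_faddeevStrip (hb : 1 < b) {z : ℂ} (hre : z.re ≠ 0) (hz : |z.im| < b⁻¹) :
    faddeev b z = faddeevStrip b z := by
  have hb0 : 0 < b := by linarith
  have hbC : (b : ℂ) ≠ 0 := ofReal_ne_zero.mpr hb0.ne'
  have hbz : |b * z.im| < 1 := by
    rw [abs_mul, abs_of_pos hb0]
    calc b * |z.im| < b * b⁻¹ := by gcongr
      _ = 1 := mul_inv_cancel₀ hb0.ne'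
  have hzero : ∀ w : ℂ, ⌊b * w.im + 1 / 2⌋ = 0 → faddeev b w = faddeevStrip b w := by
    intro w hw
    simp only [faddeev, hw]
    simp
  have hinv : b⁻¹ < b := (inv_lt_one_of_one_lt₀ hb).trans hb
  have hhalf : (I / (2 * b) : ℂ) = ((b⁻¹ / 2 : ℝ) : ℂ) * I := by push_cast; field_simp
  have hfull : (I / b : ℂ) = ((b⁻¹ : ℝ) : ℂ) * I := by push_cast; field_simp
  obtain ⟨hl, hu⟩ := abs_lt.mp hbz
  obtain ⟨hl', hu'⟩ := abs_lt.mp hz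
  have hinv0 : 0 < b⁻¹ := by positivity
  rcases lt_trichotomy ⌊b * z.im + 1 / 2⌋ 0 with h | h | h
  · have h1 : b * z.im + 1 / 2 < 0 := by
      rw [Int.floor_lt] at h; exact_mod_cast h
    have h2 := faddeev_add hb0 hre
    rw [hzero] at h2
    · have h3 := faddeevStrip_sub hb (z := z + I / (2 * b)) (by
        rw [hhalf, add_im, im_ofReal_mul, I_im, mul_one]
        have : z.im < 0 := by nlinarith
        have h4 : |z.im + b⁻¹ / 2| < b / 2 := by rw [abs_lt]; constructor <;> linarith
        linarith)
      rw [add_sub_cancel_right, add_assoc, show (I / (2 * b) + I / (2 * b) : ℂ) = I / b by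
        field_simp; norm_num] at h3
      rw [← h2, h3, mul_comm]
    · rw [Int.floor_eq_iff, add_im, div_ofReal_im, I_im, mul_add, mul_one_div_cancel hb0.ne']
      constructor <;> push_cast <;> linarith
  · exact hzero z h
  · have h1 : 1 ≤ b * z.im + 1 / 2 := by
      have : (1 : ℤ) ≤ ⌊b * z.im + 1 / 2⌋ := h
      rw [Int.le_floor] at this; exact_mod_cast this
    have hre' : (z - I / b).re ≠ 0 := by
      rw [hfull, sub_re, re_ofReal_mul, I_re, mul_zero, sub_zero]; exact hre
    have h2 := faddeev_add hb0 hre'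
    rw [sub_add_cancel, hzero (z - I / b)] at h2
    · have h3 := faddeevStrip_sub hb (z := z - I / (2 * b)) (by
        rw [hhalf, sub_im, im_ofReal_mul, I_im, mul_one]
        have : 0 < z.im := by
          by_contra hc
          nlinarith
        have h4 : |z.im - b⁻¹ / 2| < b / 2 := by rw [abs_lt]; constructor <;> linarith
        linarith)
      have h5 : z - I / b + I / (2 * b) = z - I / (2 * b) := by field_simp; ring
      rw [sub_add_cancel, sub_sub, show (I / (2 * b) + I / (2 * b) : ℂ) = I / b by
        field_simp; norm_num] at h3
      rw [h5, h3, mul_comm] at h2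
      refine mul_left_cancel₀ (one_add_exp_ne_zero ?_) h2
      have h6 : (2 * Real.pi / b * (z - I / (2 * b)) : ℂ) =
          ((2 * Real.pi / b : ℝ) : ℂ) * (z - (b⁻¹ / 2 : ℝ) * I) := by
        rw [hhalf]; push_cast; ring
      rw [h6, re_ofReal_mul, sub_re, re_ofReal_mul, I_re, mul_zero, sub_zero]
      have := Real.pi_pos
      positivity
    · rw [Int.floor_eq_iff, sub_im, div_ofReal_im, I_im, mul_sub, mul_one_div_cancel hb0.ne']
      constructor <;> push_cast <;> linarith

/-- The zeros and poles of the quantum dilogarithm lie on the imaginary axis. -/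
theorem differentiableAt_faddeev_and_ne_zero (hb : 1 < b) {z : ℂ} (hz : z.re ≠ 0) :
    DifferentiableAt ℂ (faddeev b) z ∧ faddeev b z ≠ 0 := by
  have hb0 : 0 < b := by linarith
  have hbC : (b : ℂ) ≠ 0 := ofReal_ne_zero.mpr hb0.ne'
  have hinv0 : 0 < b⁻¹ := by positivity
  have hfull : (I / b : ℂ) = ((b⁻¹ : ℝ) : ℂ) * I := by push_cast; field_simp
  have hopen : ∀ {w : ℂ}, w.re ≠ 0 → ∀ᶠ y in 𝓝 w, y.re ≠ 0 := fun {w} hw =>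
    continuous_re.continuousAt.eventually_ne hw
  have hfac : ∀ {w : ℂ}, w.re ≠ 0 → ∀ c : ℝ,
      1 + exp (2 * Real.pi / b * (w + c * I)) ≠ 0 := by
    intro w hw c
    apply one_add_exp_ne_zero
    rw [show (2 * Real.pi / b * (w + c * I) : ℂ) = ((2 * Real.pi / b : ℝ) : ℂ) * (w + c * I) by
      push_cast; ring, re_ofReal_mul, add_re, re_ofReal_mul, I_re, mul_zero, add_zero]
    have := Real.pi_pos
    positivity
  have main : ∀ n : ℕ, ∀ z : ℂ, z.re ≠ 0 → |z.im| < (n + 1) * b⁻¹ →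
      DifferentiableAt ℂ (faddeev b) z ∧ faddeev b z ≠ 0 := by
    intro n
    induction n with
    | zero =>
      intro z hz him
      rw [Nat.cast_zero, zero_add, one_mul] at him
      constructor
      · have h1 : 2 * |z.im| < b + b⁻¹ := by
          have : b⁻¹ < b := (inv_lt_one_of_one_lt₀ hb).trans hb
          linarith
        refine (differentiableAt_faddeevStrip hb h1).congr_of_eventuallyEq ?_
        have h2 : ∀ᶠ y in 𝓝 z, |y.im| < b⁻¹ :=
          (continuous_im.abs.continuousAt).eventually (gt_mem_nhds him)
        filter_upwards [hopen hz, h2] with y hy1 hy2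
        exact faddeev_eq_faddeevStrip hb hy1 hy2
      · rw [faddeev_eq_faddeevStrip hb hz him, faddeevStrip]
        exact Complex.exp_ne_zero _
    | succ n ih =>
      intro z hz him
      push_cast at him
      obtain ⟨hl, hu⟩ := abs_lt.mp him
      rcases lt_or_ge |z.im| ((n + 1) * b⁻¹) with hlt | hge
      · exact ih z hz hlt
      have hne0 : z.im ≠ 0 := by
        intro h
        rw [h, abs_zero] at hge
        have : 0 < ((n : ℝ) + 1) * b⁻¹ := by positivity
        linarith
      rcases lt_or_gt_of_ne hne0 with h0 | h0
      · have hre' : (z + I / b).re ≠ 0 := by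
          rw [hfull, add_re, re_ofReal_mul, I_re, mul_zero, add_zero]; exact hz
        obtain ⟨hd, hne⟩ := ih (z + I / b) hre' (by
          rw [hfull, add_im, im_ofReal_mul, I_im, mul_one, abs_lt]
          have : 0 ≤ (n : ℝ) * b⁻¹ := by positivity
          constructor <;> nlinarith)
        have hev : faddeev b =ᶠ[𝓝 z] fun y =>
            faddeev b (y + I / b) * (1 + exp (2 * Real.pi / b * (y + I / (2 * b)))) := by
          filter_upwards [hopen hz] with y hy
          exact (faddeev_add hb0 hy).symm
        constructor
        · refine DifferentiableAt.congr_of_eventuallyEq ?_ hev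
          have h1 : DifferentiableAt ℂ (fun y => faddeev b (y + I / b)) z :=
            DifferentiableAt.comp z hd (differentiableAt_id.add_const _)
          exact h1.mul (show DifferentiableAt ℂ
            (fun y => 1 + exp (2 * Real.pi / b * (y + I / (2 * b)))) z by fun_prop)
        · rw [← faddeev_add hb0 hz]
          refine mul_ne_zero hne ?_
          have := hfac hz (2 * b)⁻¹
          convert this using 5
          push_cast; field_simp
      · have hre' : ∀ {y : ℂ}, y.re ≠ 0 → (y - I / b).re ≠ 0 := by
          intro y hy
          rw [hfull, sub_re, re_ofReal_mul, I_re, mul_zero, sub_zero]; exact hy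
        obtain ⟨hd, hne⟩ := ih (z - I / b) (hre' hz) (by
          rw [hfull, sub_im, im_ofReal_mul, I_im, mul_one, abs_lt]
          have : 0 ≤ (n : ℝ) * b⁻¹ := by positivity
          constructor <;> nlinarith)
        have hfac' : ∀ {y : ℂ}, y.re ≠ 0 →
            1 + exp (2 * Real.pi / b * (y - I / b + I / (2 * b))) ≠ 0 := by
          intro y hy
          have := hfac (hre' hy) (2 * b)⁻¹
          convert this using 5
          push_cast; field_simp
        have heq : ∀ {y : ℂ}, y.re ≠ 0 → faddeev b y = faddeev b (y - I / b) /
            (1 + exp (2 * Real.pi / b * (y - I / b + I / (2 * b)))) := by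
          intro y hy
          rw [eq_div_iff (hfac' hy)]
          have := faddeev_add hb0 (hre' hy)
          rwa [sub_add_cancel] at this
        constructor
        · have hev : faddeev b =ᶠ[𝓝 z] fun y => faddeev b (y - I / b) /
              (1 + exp (2 * Real.pi / b * (y - I / b + I / (2 * b)))) := by
            filter_upwards [hopen hz] with y hy
            exact heq hy
          refine DifferentiableAt.congr_of_eventuallyEq ?_ hev
          have h1 : DifferentiableAt ℂ (fun y => faddeev b (y - I / b)) z :=
            DifferentiableAt.comp z hd (differentiableAt_id.sub_const _)
          exact h1.div (show DifferentiableAt ℂ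
            (fun y => 1 + exp (2 * Real.pi / b * (y - I / b + I / (2 * b)))) z by fun_prop) (hfac' hz)
        · rw [heq hz]
          exact div_ne_zero hne (hfac' hz)
  obtain ⟨n, hn⟩ := exists_nat_gt (|z.im| * b)
  refine main n z hz ?_
  rw [← div_eq_mul_inv, lt_div_iff₀ hb0]
  linarith

end

/-! ### The shift of the quantum dilogarithm by `1` -/


section

variable {N : ℕ}

theorem one_lt_sqrt_natCast (hN : 2 ≤ N) : 1 < Real.sqrt N :=
  Real.lt_sqrt_of_sq_lt (by
    have : (2 : ℝ) ≤ N := by exact_mod_cast hN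
    linarith)

/-- The argument of Faddeev's function in `qlog`. -/
noncomputable def qlogArg (N : ℕ) (t : ℂ) : ℂ :=
  I * (Real.sqrt N : ℝ) * t - I / 2 * ((Real.sqrt N : ℝ) + ((Real.sqrt N : ℝ) : ℂ)⁻¹) +
    I / (Real.sqrt N : ℝ)

theorem qlogArg_eq (N : ℕ) (t : ℂ) : qlogArg N t = (Real.sqrt N : ℝ) * (I * t) +
    (-1 / 2 * (Real.sqrt N + (Real.sqrt N)⁻¹) + (Real.sqrt N)⁻¹ : ℝ) * I := by
  rw [qlogArg]; push_cast; ring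

theorem qlogArg_re (N : ℕ) (t : ℂ) : (qlogArg N t).re = -(Real.sqrt N * t.im) := by
  rw [qlogArg_eq, add_re, re_ofReal_mul, re_ofReal_mul, I_re, I_mul_re]; ring

theorem qlogArg_re_ne_zero (hN : 2 ≤ N) {t : ℂ} (ht : t.im ≠ 0) : (qlogArg N t).re ≠ 0 := by
  rw [qlogArg_re]
  have := one_lt_sqrt_natCast hN
  exact neg_ne_zero.mpr (mul_ne_zero (by linarith) ht)

theorem differentiableAt_qlog (hN : 2 ≤ N) {t : ℂ} (ht : t.im ≠ 0) :
    DifferentiableAt ℂ (qlog N) t := by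
  have h := (differentiableAt_faddeev_and_ne_zero (one_lt_sqrt_natCast hN)
    (qlogArg_re_ne_zero hN ht)).1
  have h1 : DifferentiableAt ℂ (qlogArg N) t := by unfold qlogArg; fun_prop
  exact DifferentiableAt.comp t h h1

theorem qlog_ne_zero (hN : 2 ≤ N) {t : ℂ} (ht : t.im ≠ 0) : qlog N t ≠ 0 :=
  (differentiableAt_faddeev_and_ne_zero (one_lt_sqrt_natCast hN) (qlogArg_re_ne_zero hN ht)).2

theorem qlog_add_inv (hN : 2 ≤ N) {t : ℂ} (ht : t.im ≠ 0) :
    qlog N (t + 1 / N) * (1 - exp (2 * Real.pi * I * (t + 1 / N))) = qlog N t := by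
  set b := Real.sqrt N with hb
  have hb1 : 1 < b := one_lt_sqrt_natCast hN
  have hbC : (b : ℂ) ≠ 0 := ofReal_ne_zero.mpr (by linarith)
  have hbb : (b : ℂ) * b = N := by
    rw [← ofReal_mul, hb, Real.mul_self_sqrt (Nat.cast_nonneg N), ofReal_natCast]
  have h := faddeev_add (b := b) (by linarith) (qlogArg_re_ne_zero hN ht)
  have h1 : qlogArg N t + I / b = qlogArg N (t + 1 / N) := by
    rw [qlogArg, qlogArg, ← hb, ← hbb]
    field_simp
    ring
  have h2 : exp (2 * Real.pi / b * (qlogArg N t + I / (2 * b))) =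
      -exp (2 * Real.pi * I * (t + 1 / N)) := by
    rw [← Complex.exp_sub_pi_mul_I]
    congr 1
    rw [qlogArg, ← hb, ← hbb]
    field_simp
    ring
  rw [h1, h2, ← sub_eq_add_neg] at h
  exact h

theorem prod_one_sub_exp_add_div (hN : N ≠ 0) (t : ℂ) :
    ∏ j ∈ Finset.range N, (1 - exp (2 * Real.pi * I * (t + (j + 1) / N))) =
      1 - exp (2 * Real.pi * I * (N * t)) := by
  have hNC : (N : ℂ) ≠ 0 := Nat.cast_ne_zero.mpr hN
  set x := exp (2 * Real.pi * I * t) with hx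
  have hprim := Complex.isPrimitiveRoot_exp N hN
  set ζ := exp (2 * Real.pi * I / N) with hζ
  have h1 : (1 : ℂ) - exp (2 * Real.pi * I * (N * t)) = 1 ^ N - x ^ N := by
    rw [one_pow, hx, ← Complex.exp_nat_mul]
    congr 2; ring
  have himage : Polynomial.nthRootsFinset N (1 : ℂ) =
      (Finset.range N).image fun j => ζ ^ (j + 1) := by
    symm
    refine Finset.eq_of_subset_of_card_le (fun y hy => ?_) ?_
    · obtain ⟨j, _, rfl⟩ := Finset.mem_image.mp hy
      rw [Polynomial.mem_nthRootsFinset (Nat.pos_of_ne_zero hN), ← pow_mul, mul_comm, pow_mul,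
        hprim.pow_eq_one, one_pow]
    · rw [hprim.card_nthRootsFinset, Finset.card_image_of_injOn, Finset.card_range]
      intro i hi j hj hij
      simp only [pow_succ] at hij
      exact hprim.pow_inj (Finset.mem_range.mp hi) (Finset.mem_range.mp hj)
        (mul_right_cancel₀ (hprim.ne_zero hN) hij)
  rw [h1, hprim.pow_sub_pow_eq_prod_sub_mul 1 x (Nat.pos_of_ne_zero hN), himage,
    Finset.prod_image]
  · refine Finset.prod_congr rfl fun j _ => ?_
    rw [hx, hζ, ← Complex.exp_nat_mul, ← Complex.exp_add]
    congr 2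
    push_cast
    field_simp
    ring
  · intro i hi j hj hij
    simp only [pow_succ] at hij
    exact hprim.pow_inj (Finset.mem_range.mp hi) (Finset.mem_range.mp hj)
      (mul_right_cancel₀ (hprim.ne_zero hN) hij)

/-- The behaviour of the quantum dilogarithm under a shift by `1`: the `N` factors from the
functional equation multiply to a factor that depends on `e^{2πiNt}` only. -/
theorem qlog_add_one (hN : 2 ≤ N) {t : ℂ} (ht : t.im ≠ 0) :
    qlog N (t + 1) * (1 - exp (2 * Real.pi * I * (N * t))) = qlog N t := by
  have hNC : (N : ℂ) ≠ 0 := Nat.cast_ne_zero.mpr (by omega)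
  have him : ∀ j : ℕ, (t + j / N).im ≠ 0 := fun j => by simpa using ht
  have h : ∀ j : ℕ, qlog N (t + j / N) *
      ∏ i ∈ Finset.range j, (1 - exp (2 * Real.pi * I * (t + (i + 1) / N))) = qlog N t := by
    intro j
    induction j with
    | zero => simp
    | succ j ih =>
      rw [← ih, Finset.prod_range_succ, ← qlog_add_inv hN (him j),
        show t + (j : ℂ) / N + 1 / N = t + (j + 1) / N by ring]
      push_cast
      ring
  have h1 := h N
  rwa [prod_one_sub_exp_add_div (by omega), div_self hNC] at h1

end

/-! ### The trapezoidal rule on an interval -/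


/-- The Dirichlet kernel of the circle `ℝ / ℤ`. -/
noncomputable def dirichletKernel (M : ℕ) (s : ℝ) : ℂ :=
  ∑ k ∈ Finset.Icc (-(M : ℤ)) M, exp (-(2 * Real.pi * I * (k * s)))

/-- The second antiderivative of the Dirichlet kernel with mean `0`: the periodic Bernoulli function
`B₂ / 2` on `[0, 1]` minus the partial sum of its Fourier series. -/
noncomputable def bernoulliTail (M : ℕ) (s : ℝ) : ℝ :=
  (s ^ 2 - s) / 2 + 1 / 12 -
    ∑ k ∈ Finset.range M, Real.cos (2 * Real.pi * (k + 1) * s) / (2 * Real.pi ^ 2 * (k + 1) ^ 2)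

/-- The derivative of `bernoulliTail`. -/
noncomputable def sawtoothTail (M : ℕ) (s : ℝ) : ℝ :=
  s - 1 / 2 + ∑ k ∈ Finset.range M, Real.sin (2 * Real.pi * (k + 1) * s) / (Real.pi * (k + 1))

theorem dirichletKernel_eq (M : ℕ) (s : ℝ) : dirichletKernel M s =
    ((1 + ∑ k ∈ Finset.range M, 2 * Real.cos (2 * Real.pi * (k + 1) * s) : ℝ) : ℂ) := by
  induction M with
  | zero => simp [dirichletKernel]
  | succ M ih =>
    have h : Finset.Icc (-((M + 1 : ℕ) : ℤ)) (M + 1 : ℕ) =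
        insert (-((M : ℤ) + 1)) (insert ((M : ℤ) + 1) (Finset.Icc (-(M : ℤ)) M)) := by
      ext k; simp only [Finset.mem_Icc, Finset.mem_insert]; push_cast; omega
    have h1 : (M : ℤ) + 1 ∉ Finset.Icc (-(M : ℤ)) M := by simp
    have h2 : -((M : ℤ) + 1) ∉ insert ((M : ℤ) + 1) (Finset.Icc (-(M : ℤ)) M) := by
      simp only [Finset.mem_insert, Finset.mem_Icc]; omega
    rw [dirichletKernel, h, Finset.sum_insert h2, Finset.sum_insert h1]
    rw [dirichletKernel] at ih
    rw [ih, Finset.sum_range_succ]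
    push_cast
    rw [Complex.two_cos]
    have e1 : -(2 * Real.pi * I * (-((M : ℂ) + 1) * s)) = 2 * Real.pi * (M + 1) * s * I := by ring
    have e2 : -(2 * Real.pi * I * (((M : ℂ) + 1) * s)) = -(2 * Real.pi * (M + 1) * s) * I := by
      ring
    rw [e1, e2]
    ring

theorem continuous_dirichletKernel (M : ℕ) : Continuous (dirichletKernel M) := by
  unfold dirichletKernel; fun_prop

theorem dirichletKernel_add_natCast (M : ℕ) (s : ℝ) (j : ℕ) :
    dirichletKernel M (s + j) = dirichletKernel M s := by
  unfold dirichletKernel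
  refine Finset.sum_congr rfl fun k _ => ?_
  rw [Complex.exp_eq_exp_iff_exists_int]
  exact ⟨-(k * j), by push_cast; ring⟩

theorem hasDerivAt_sawtoothTail (M : ℕ) (s : ℝ) : HasDerivAt (sawtoothTail M)
    (1 + ∑ k ∈ Finset.range M, 2 * Real.cos (2 * Real.pi * (k + 1) * s)) s := by
  unfold sawtoothTail
  refine ((hasDerivAt_id s).sub_const _).add (HasDerivAt.fun_sum fun k _ => ?_)
  have h := (((hasDerivAt_id s).const_mul (2 * Real.pi * (k + 1))).sin).div_const
    (Real.pi * (k + 1))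
  refine h.congr_deriv ?_
  have := Real.pi_pos
  simp only [id]
  field_simp

theorem hasDerivAt_bernoulliTail (M : ℕ) (s : ℝ) :
    HasDerivAt (bernoulliTail M) (sawtoothTail M s) s := by
  have h1 : HasDerivAt (fun s : ℝ => (s ^ 2 - s) / 2 + 1 / 12) (s - 1 / 2) s := by
    have := ((((hasDerivAt_id s).pow 2).sub (hasDerivAt_id s)).div_const 2).add_const (1 / 12)
    refine this.congr_deriv ?_
    simp; ring
  have h2 : HasDerivAt (fun s : ℝ => ∑ k ∈ Finset.range M,
      Real.cos (2 * Real.pi * (k + 1) * s) / (2 * Real.pi ^ 2 * (k + 1) ^ 2))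
      (-∑ k ∈ Finset.range M, Real.sin (2 * Real.pi * (k + 1) * s) / (Real.pi * (k + 1))) s := by
    rw [← Finset.sum_neg_distrib]
    refine HasDerivAt.fun_sum fun k _ => ?_
    have h := (((hasDerivAt_id s).const_mul (2 * Real.pi * (k + 1))).cos).div_const
      (2 * Real.pi ^ 2 * (k + 1) ^ 2)
    refine h.congr_deriv ?_
    have := Real.pi_pos
    simp only [id]
    field_simp
  refine (h1.sub h2).congr_deriv ?_
  rw [sawtoothTail]; ring

theorem sawtoothTail_zero (M : ℕ) : sawtoothTail M 0 = -(1 / 2) := by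
  simp [sawtoothTail]

theorem sawtoothTail_one (M : ℕ) : sawtoothTail M 1 = 1 / 2 := by
  have h : ∀ k : ℕ, Real.sin (2 * Real.pi * (k + 1) * 1) = 0 := fun k => by
    rw [show 2 * Real.pi * ((k : ℝ) + 1) * 1 = ((2 * (k + 1) : ℕ) : ℝ) * Real.pi by push_cast; ring]
    exact Real.sin_nat_mul_pi _
  simp only [sawtoothTail, h]
  norm_num

theorem exists_tendsto_abs_bernoulliTail_le : ∃ ε : ℕ → ℝ, Tendsto ε atTop (𝓝 0) ∧
    ∀ M, ∀ s ∈ Icc (0 : ℝ) 1, |bernoulliTail M s| ≤ ε M := by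
  set c : ℕ → ℝ := fun n => 1 / (n : ℝ) ^ 2 with hc
  have hcs : Summable c := Real.summable_one_div_nat_pow.mpr one_lt_two
  refine ⟨fun M => 1 / (2 * Real.pi ^ 2) * ∑' n, c (n + (M + 1)), ?_, fun M s hs => ?_⟩
  · have h := (tendsto_sum_nat_add c).comp (tendsto_add_atTop_nat 1)
    have h' := h.const_mul (1 / (2 * Real.pi ^ 2))
    rwa [mul_zero] at h'
  · set a : ℕ → ℝ := fun n => 1 / (n : ℝ) ^ 2 * Real.cos (2 * Real.pi * n * s) with ha
    have hsum := hasSum_one_div_nat_pow_mul_cos one_ne_zero hs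
    have hB : (Polynomial.map (algebraMap ℚ ℝ) (Polynomial.bernoulli (2 * 1))).eval s =
        s ^ 2 - s + 1 / 6 := by
      simp [Polynomial.bernoulli, Finset.sum_range_succ, bernoulli_one, bernoulli_two,
        bernoulli_zero]
      ring
    rw [hB] at hsum
    have hle : ∀ n, ‖a n‖ ≤ c n := fun n => by
      rw [ha, norm_mul, hc, Real.norm_of_nonneg (by positivity)]
      exact mul_le_of_le_one_right (by positivity) (Real.abs_cos_le_one _)
    have hshift : Summable fun n => c (n + (M + 1)) := (summable_nat_add_iff (M + 1)).mpr hcs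
    have htail : ∑' n, a (n + (M + 1)) = 2 * Real.pi ^ 2 * bernoulliTail M s := by
      have h := hsum.summable.sum_add_tsum_nat_add (M + 1)
      rw [hsum.tsum_eq, Finset.sum_range_succ'] at h
      rw [bernoulliTail, mul_sub, Finset.mul_sum]
      have hpi := Real.pi_pos
      have h2 : ∀ k : ℕ, 1 / ((k + 1 : ℕ) : ℝ) ^ (2 * 1) *
          Real.cos (2 * Real.pi * ((k + 1 : ℕ) : ℝ) * s) = 2 * Real.pi ^ 2 *
          (Real.cos (2 * Real.pi * (k + 1) * s) / (2 * Real.pi ^ 2 * (k + 1) ^ 2)) := by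
        intro k; push_cast; field_simp
      simp only [h2] at h
      norm_num at h
      simp only [ha]
      norm_num
      linarith
    have h1 : |2 * Real.pi ^ 2 * bernoulliTail M s| ≤ ∑' n, c (n + (M + 1)) := by
      rw [← htail]
      exact tsum_of_norm_bounded hshift.hasSum fun n => hle _
    rw [abs_mul, abs_of_pos (by positivity)] at h1
    simp only
    rw [one_div, inv_mul_eq_div, le_div_iff₀ (by positivity)]
    linarith

theorem integral_mul_dirichletKernel {φ φ' φ'' : ℝ → ℂ} (h1 : ∀ s, HasDerivAt φ (φ' s) s)
    (h2 : ∀ s, HasDerivAt φ' (φ'' s) s) (h3 : Continuous φ'') (M : ℕ) :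
    ∫ s in (0 : ℝ)..1, φ s * dirichletKernel M s = (φ 0 + φ 1) / 2 -
      (φ' 1 * bernoulliTail M 1 - φ' 0 * bernoulliTail M 0) +
      ∫ s in (0 : ℝ)..1, φ'' s * bernoulliTail M s := by
  have hφ : Continuous φ := continuous_iff_continuousAt.mpr fun s => (h1 s).continuousAt
  have hB : Continuous (bernoulliTail M) :=
    continuous_iff_continuousAt.mpr fun s => (hasDerivAt_bernoulliTail M s).continuousAt
  have hB' : Continuous fun s => (bernoulliTail M s : ℂ) := continuous_ofReal.comp hB
  have hd : ∀ s, HasDerivAt (fun s => φ s * sawtoothTail M s - φ' s * bernoulliTail M s)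
      (φ s * dirichletKernel M s - φ'' s * bernoulliTail M s) s := by
    intro s
    rw [dirichletKernel_eq]
    refine (((h1 s).mul (hasDerivAt_sawtoothTail M s).ofReal_comp).sub
      ((h2 s).mul (hasDerivAt_bernoulliTail M s).ofReal_comp)).congr_deriv ?_
    ring
  have hc1 : Continuous fun s => φ s * dirichletKernel M s :=
    hφ.mul (continuous_dirichletKernel M)
  have hc2 : Continuous fun s => φ'' s * bernoulliTail M s := h3.mul hB'
  have h := intervalIntegral.integral_eq_sub_of_hasDerivAt (fun s _ => hd s)
    ((hc1.sub hc2).intervalIntegrable 0 1)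
  rw [intervalIntegral.integral_sub (hc1.intervalIntegrable 0 1) (hc2.intervalIntegrable 0 1),
    sawtoothTail_zero, sawtoothTail_one] at h
  push_cast at h
  linear_combination h

/-- The trapezoidal rule on `[0, 1]` with `N` intervals. -/
noncomputable def trapezoid (N : ℕ) (φ : ℝ → ℂ) : ℂ :=
  (N : ℂ)⁻¹ * ∑ j ∈ Finset.range N, (φ (j / N) + φ ((j + 1 : ℕ) / N)) / 2

theorem integral_mul_dirichletKernel_mul {N : ℕ} (hN : N ≠ 0) {φ : ℝ → ℂ} (hφ : Continuous φ)
    (M : ℕ) : ∫ t in (0 : ℝ)..1, φ t * dirichletKernel M (N * t) =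
      (N : ℂ)⁻¹ * ∑ j ∈ Finset.range N,
        ∫ s in (0 : ℝ)..1, φ ((s + j) / N) * dirichletKernel M s := by
  have hNR : (N : ℝ) ≠ 0 := Nat.cast_ne_zero.mpr hN
  set g : ℝ → ℂ := fun u => φ (u / N) * dirichletKernel M u with hg
  have hgc : Continuous g :=
    (hφ.comp (continuous_id.div_const _)).mul (continuous_dirichletKernel M)
  have h1 : ∀ t : ℝ, φ t * dirichletKernel M (N * t) = g (N * t) := fun t => by
    simp only [hg, mul_div_cancel_left₀ t hNR]
  simp only [h1]
  rw [intervalIntegral.integral_comp_mul_left g hNR, mul_zero, mul_one, real_smul, ofReal_inv,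
    ofReal_natCast]
  congr 1
  have h2 := intervalIntegral.sum_integral_adjacent_intervals (f := g) (μ := volume)
    (a := fun j : ℕ => (j : ℝ)) (n := N) fun k _ => hgc.intervalIntegrable _ _
  rw [Nat.cast_zero] at h2
  rw [← h2]
  refine Finset.sum_congr rfl fun j _ => ?_
  have h3 := intervalIntegral.integral_comp_add_right (a := 0) (b := 1) g (j : ℝ)
  rw [zero_add, add_comm (1 : ℝ)] at h3
  push_cast
  rw [← h3]
  simp only [hg, dirichletKernel_add_natCast]

/-- The rectangular partial sums of a Fourier series sample a function by the trapezoidal rule;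
the error is controlled by two derivatives. -/
theorem exists_norm_integral_sub_trapezoid_le : ∃ ε : ℕ → ℝ, Tendsto ε atTop (𝓝 0) ∧
    (∀ M, 0 ≤ ε M) ∧
    ∀ N : ℕ, N ≠ 0 → ∀ (φ φ' φ'' : ℝ → ℂ), (∀ s, HasDerivAt φ (φ' s) s) →
      (∀ s, HasDerivAt φ' (φ'' s) s) → Continuous φ'' → ∀ B : ℝ,
      (∀ s ∈ Icc (0 : ℝ) 1, ‖φ' s‖ ≤ B) → (∀ s ∈ Icc (0 : ℝ) 1, ‖φ'' s‖ ≤ B) → ∀ M : ℕ,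
      ‖(∫ t in (0 : ℝ)..1, φ t * dirichletKernel M (N * t)) - trapezoid N φ‖ ≤ ε M * B := by
  obtain ⟨ε, hε, hle⟩ := exists_tendsto_abs_bernoulliTail_le
  have h0mem : (0 : ℝ) ∈ Icc (0 : ℝ) 1 := ⟨le_rfl, zero_le_one⟩
  have h1mem : (1 : ℝ) ∈ Icc (0 : ℝ) 1 := ⟨zero_le_one, le_rfl⟩
  have hε0 : ∀ M, 0 ≤ ε M := fun M => (abs_nonneg _).trans (hle M 0 h0mem)
  -- On each of the `N` intervals, integration by parts leaves two boundary terms and an integral,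
  -- each at most `ε M * B`.
  refine ⟨fun M => 3 * ε M, by simpa using hε.const_mul 3, fun M => by linarith [hε0 M], ?_⟩
  intro N hN φ φ' φ'' h1 h2 h3 B hB1 hB2 M
  have hB : 0 ≤ B := (norm_nonneg _).trans (hB1 0 h0mem)
  have hNR : (0 : ℝ) < N := Nat.cast_pos.mpr (Nat.pos_of_ne_zero hN)
  have hNC : (N : ℂ) ≠ 0 := Nat.cast_ne_zero.mpr hN
  have hN1 : (N : ℝ)⁻¹ ≤ 1 := inv_le_one_of_one_le₀ (by exact_mod_cast Nat.one_le_iff_ne_zero.mpr hN)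
  have hφ : Continuous φ := continuous_iff_continuousAt.mpr fun s => (h1 s).continuousAt
  have hterm : ∀ j ∈ Finset.range N, ‖(∫ s in (0 : ℝ)..1, φ ((s + j) / N) * dirichletKernel M s) -
      (φ (j / N) + φ ((j + 1 : ℕ) / N)) / 2‖ ≤ 3 * ε M * B := by
    intro j hj
    have hlin : ∀ s : ℝ, HasDerivAt (fun s : ℝ => (s + j) / N) ((N : ℝ)⁻¹) s := fun s => by
      simpa using ((hasDerivAt_id s).add_const (j : ℝ)).div_const (N : ℝ)
    have hmem : ∀ s ∈ Icc (0 : ℝ) 1, (s + j) / N ∈ Icc (0 : ℝ) 1 := by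
      intro s hs
      have hj' : (j : ℝ) + 1 ≤ N := by exact_mod_cast Finset.mem_range.mp hj
      exact ⟨div_nonneg (by linarith [hs.1, (Nat.cast_nonneg j : (0 : ℝ) ≤ j)]) hNR.le,
        (div_le_one hNR).mpr (by linarith [hs.2])⟩
    have hsmul : ∀ {z : ℂ}, ‖z‖ ≤ B → ‖(N : ℝ)⁻¹ • z‖ ≤ B := fun {z} hz => by
      rw [norm_smul, norm_inv, Real.norm_natCast]
      exact (mul_le_of_le_one_left (norm_nonneg _) hN1).trans hz
    have key := integral_mul_dirichletKernel (φ := fun s => φ ((s + j) / N))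
      (φ' := fun s => (N : ℝ)⁻¹ • φ' ((s + j) / N))
      (φ'' := fun s => (N : ℝ)⁻¹ • (N : ℝ)⁻¹ • φ'' ((s + j) / N))
      (fun s => (h1 _).scomp s (hlin s))
      (fun s => HasDerivAt.const_smul (N : ℝ)⁻¹ ((h2 _).scomp s (hlin s)))
      (by fun_prop) M
    rw [key, zero_add, show (1 : ℝ) + j = (j + 1 : ℕ) by push_cast; ring]
    have e1 : ‖(N : ℝ)⁻¹ • φ' ((j + 1 : ℕ) / N) * (bernoulliTail M 1 : ℂ)‖ ≤ B * ε M := by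
      rw [norm_mul, norm_real]
      have := hB1 _ (hmem 1 h1mem)
      rw [show (1 : ℝ) + j = (j + 1 : ℕ) by push_cast; ring] at this
      exact mul_le_mul (hsmul this) (hle M 1 h1mem) (norm_nonneg _) hB
    have e0 : ‖(N : ℝ)⁻¹ • φ' (j / N) * (bernoulliTail M 0 : ℂ)‖ ≤ B * ε M := by
      rw [norm_mul, norm_real]
      have := hB1 _ (hmem 0 h0mem)
      rw [zero_add] at this
      exact mul_le_mul (hsmul this) (hle M 0 h0mem) (norm_nonneg _) hB
    have e2 : ‖∫ s in (0 : ℝ)..1, (N : ℝ)⁻¹ • (N : ℝ)⁻¹ • φ'' ((s + j) / N) *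
        (bernoulliTail M s : ℂ)‖ ≤ B * ε M := by
      have := intervalIntegral.norm_integral_le_of_norm_le_const (a := 0) (b := 1) (C := B * ε M)
        (f := fun s : ℝ => (N : ℝ)⁻¹ • (N : ℝ)⁻¹ • φ'' ((s + j) / N) * (bernoulliTail M s : ℂ))
        fun s hs => by
          rw [uIoc_of_le zero_le_one] at hs
          have hs' : s ∈ Icc (0 : ℝ) 1 := ⟨hs.1.le, hs.2⟩
          rw [norm_mul, norm_real]
          exact mul_le_mul (hsmul (hsmul (hB2 _ (hmem s hs')))) (hle M s hs') (norm_nonneg _) hB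
      simpa using this
    rw [show ∀ a b c d : ℂ, a - (b - c) + d - a = -(b - c) + d by intros; ring]
    calc _ ≤ (B * ε M + B * ε M) + B * ε M := by
          refine (norm_add_le _ _).trans (add_le_add ?_ e2)
          rw [norm_neg]
          exact (norm_sub_le _ _).trans (add_le_add e1 e0)
      _ = _ := by ring
  rw [integral_mul_dirichletKernel_mul hN hφ, trapezoid, ← mul_sub, ← Finset.sum_sub_distrib,
    norm_mul, norm_inv, Complex.norm_natCast]
  calc _ ≤ (N : ℝ)⁻¹ * ∑ j ∈ Finset.range N, 3 * ε M * B := by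
        gcongr
        exact (norm_sum_le _ _).trans (Finset.sum_le_sum hterm)
    _ = _ := by
        rw [Finset.sum_const, Finset.card_range, nsmul_eq_mul]
        field_simp

/-! ### The trapezoidal rule on a cube -/


/-- The rectangular partial sum, with bounds `M`, of the Fourier coefficients of `f` at the
multiples of `N`. -/
noncomputable def cubeIntegral {ι : Type*} [Fintype ι] (N : ℕ) (M : ι → ℕ) (f : (ι → ℝ) → ℂ) : ℂ :=
  ∫ x in Icc (0 : ι → ℝ) 1, f x * ∏ i, dirichletKernel (M i) (N * x i)

/-- The trapezoidal rule on the cube, one coordinate at a time. -/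
noncomputable def iteratedTrapezoid (N : ℕ) : (d : ℕ) → ((Fin d → ℝ) → ℂ) → ℂ
  | 0, f => f 0
  | d + 1, f => trapezoid N fun t => iteratedTrapezoid N d fun x => f (Fin.cons t x)

theorem continuous_fin_cons {d : ℕ} :
    Continuous fun p : ℝ × (Fin d → ℝ) => (Fin.cons p.1 p.2 : Fin (d + 1) → ℝ) :=
  continuous_pi fun i => by
    induction i using Fin.cases with
    | zero => simpa using continuous_fst
    | succ j => simpa [Function.comp_def] using (continuous_apply j).comp continuous_snd

theorem cubeIntegral_succ {d : ℕ} (N : ℕ) (M : Fin (d + 1) → ℕ) {f : (Fin (d + 1) → ℝ) → ℂ}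
    (hf : Continuous f) : cubeIntegral N M f =
      ∫ t in (0 : ℝ)..1, cubeIntegral N (Fin.tail M) (fun x => f (Fin.cons t x)) *
        dirichletKernel (M 0) (N * t) := by
  set F : (Fin (d + 1) → ℝ) → ℂ := fun x => f x * ∏ i, dirichletKernel (M i) (N * x i) with hF
  have hFc : Continuous F := hf.mul (continuous_finsetProd _ fun i _ =>
    (continuous_dirichletKernel (M i)).comp (by fun_prop))
  have hmp := (volume_preserving_piFinSuccAbove (fun _ : Fin (d + 1) => ℝ) 0).symm
  have hpre : (MeasurableEquiv.piFinSuccAbove (fun _ : Fin (d + 1) => ℝ) 0).symm ⁻¹'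
      Icc (0 : Fin (d + 1) → ℝ) 1 = Icc (0 : ℝ) 1 ×ˢ Icc (0 : Fin d → ℝ) 1 := by
    ext p
    simp only [mem_preimage, mem_Icc, mem_prod, Pi.le_def, Fin.forall_fin_succ,
      MeasurableEquiv.piFinSuccAbove_symm_apply, Fin.insertNthEquiv_apply, Fin.insertNth_zero',
      Fin.cons_zero, Fin.cons_succ, Pi.zero_apply, Pi.one_apply]
    tauto
  have h1 : cubeIntegral N M f = ∫ p in Icc (0 : ℝ) 1 ×ˢ Icc (0 : Fin d → ℝ) 1,
      F (Fin.cons p.1 p.2) := by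
    rw [cubeIntegral, ← hpre, ← hmp.setIntegral_preimage_emb (MeasurableEquiv.measurableEmbedding _)]
    refine setIntegral_congr_fun ?_ fun p _ => ?_
    · rw [hpre]; exact measurableSet_Icc.prod measurableSet_Icc
    · exact congrArg F (Fin.insertNth_zero' p.1 p.2)
  have hint : IntegrableOn (fun p : ℝ × (Fin d → ℝ) => F (Fin.cons p.1 p.2))
      (Icc (0 : ℝ) 1 ×ˢ Icc (0 : Fin d → ℝ) 1) (volume.prod volume) :=
    (hFc.comp continuous_fin_cons).continuousOn.integrableOn_compact
      (isCompact_Icc.prod isCompact_Icc)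
  rw [h1, Measure.volume_eq_prod, setIntegral_prod _ hint,
    intervalIntegral.integral_of_le zero_le_one, integral_Icc_eq_integral_Ioc]
  congr 1
  funext t
  rw [cubeIntegral, ← integral_mul_const]
  congr 1
  funext x
  simp only [hF, Fin.prod_univ_succ, Fin.cons_zero, Fin.cons_succ, Fin.tail]
  ring

section

variable {Y : Type} [NormedAddCommGroup Y] [NormedSpace ℝ Y] {d : ℕ}

/-- The derivative in the direction of the added parameter. -/
noncomputable def lastParamDeriv (H : (Y × ℝ) × (Fin d → ℝ) → ℂ) (p : (Y × ℝ) × (Fin d → ℝ)) : ℂ :=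
  fderiv ℝ H p ((0, 1), 0)

theorem contDiff_lastParamDeriv {H : (Y × ℝ) × (Fin d → ℝ) → ℂ} (hH : ContDiff ℝ ∞ H) :
    ContDiff ℝ ∞ (lastParamDeriv H) :=
  (hH.fderiv_right (m := ∞) le_rfl).clm_apply contDiff_const

theorem hasDerivAt_lastParam {H : (Y × ℝ) × (Fin d → ℝ) → ℂ} (hH : ContDiff ℝ ∞ H) (y : Y)
    (x : Fin d → ℝ) (t : ℝ) :
    HasDerivAt (fun t => H ((y, t), x)) (lastParamDeriv H ((y, t), x)) t := by
  have h1 : HasFDerivAt H (fderiv ℝ H ((y, t), x)) ((y, t), x) :=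
    (hH.differentiable (by simp) _).hasFDerivAt
  have h2 : HasDerivAt (fun t : ℝ => (((y, t), x) : (Y × ℝ) × (Fin d → ℝ))) ((0, 1), 0) t :=
    ((hasDerivAt_const t y).prodMk (hasDerivAt_id t)).prodMk (hasDerivAt_const t x)
  exact h1.comp_hasDerivAt t h2

theorem hasDerivAt_cubeIntegral {H : (Y × ℝ) × (Fin d → ℝ) → ℂ} (hH : ContDiff ℝ ∞ H) (N : ℕ)
    (M : Fin d → ℕ) (y : Y) (t : ℝ) :
    HasDerivAt (fun t => cubeIntegral N M fun x => H ((y, t), x))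
      (cubeIntegral N M fun x => lastParamDeriv H ((y, t), x)) t := by
  set W : (Fin d → ℝ) → ℂ := fun x => ∏ i, dirichletKernel (M i) (N * x i) with hW
  have hWc : Continuous W := continuous_finsetProd _ fun i _ =>
    (continuous_dirichletKernel (M i)).comp (by fun_prop)
  have hHc : Continuous H := hH.continuous
  have hH' : Continuous (lastParamDeriv H) := (contDiff_lastParamDeriv hH).continuous
  obtain ⟨C, hC⟩ := ((isCompact_closedBall t 1).prod
    (isCompact_Icc (a := (0 : Fin d → ℝ)) (b := 1))).exists_bound_of_continuousOn
    (f := fun p : ℝ × (Fin d → ℝ) => lastParamDeriv H ((y, p.1), p.2) * W p.2)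
    (Continuous.continuousOn (by fun_prop))
  have hms : MeasurableSet (Icc (0 : Fin d → ℝ) 1) := measurableSet_Icc
  have hfin : volume (Icc (0 : Fin d → ℝ) 1) < ⊤ := isCompact_Icc.measure_lt_top
  refine (hasDerivAt_integral_of_dominated_loc_of_deriv_le
    (μ := volume.restrict (Icc (0 : Fin d → ℝ) 1))
    (F := fun t x => H ((y, t), x) * W x) (F' := fun t x => lastParamDeriv H ((y, t), x) * W x)
    (bound := fun _ => C) (Metric.closedBall_mem_nhds t one_pos) ?_ ?_ ?_ ?_ ?_ ?_).2
  · exact Eventually.of_forall fun s => (show Continuous fun x => H ((y, s), x) * W x by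
      fun_prop).aestronglyMeasurable
  · exact (show Continuous fun x => H ((y, t), x) * W x by
      fun_prop).continuousOn.integrableOn_compact isCompact_Icc
  · exact (show Continuous fun x => lastParamDeriv H ((y, t), x) * W x by
      fun_prop).aestronglyMeasurable
  · exact ae_restrict_of_forall_mem hms fun x hx s hs => hC (s, x) ⟨hs, hx⟩
  · exact integrableOn_const hfin.ne
  · exact Eventually.of_forall fun x s _ => (hasDerivAt_lastParam hH y x s).mul_const _

end

theorem norm_trapezoid_le {N : ℕ} (hN : N ≠ 0) {φ : ℝ → ℂ} {C : ℝ}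
    (h : ∀ t ∈ Icc (0 : ℝ) 1, ‖φ t‖ ≤ C) : ‖trapezoid N φ‖ ≤ C := by
  have hNR : (0 : ℝ) < N := Nat.cast_pos.mpr (Nat.pos_of_ne_zero hN)
  have hmem : ∀ j : ℕ, j ≤ N → (j / N : ℝ) ∈ Icc (0 : ℝ) 1 := fun j hj =>
    ⟨by positivity, (div_le_one hNR).mpr (by exact_mod_cast hj)⟩
  rw [trapezoid, norm_mul, norm_inv, Complex.norm_natCast]
  calc _ ≤ (N : ℝ)⁻¹ * ∑ j ∈ Finset.range N, C := by
        gcongr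
        refine (norm_sum_le _ _).trans (Finset.sum_le_sum fun j hj => ?_)
        have hj' := Finset.mem_range.mp hj
        have h1 := h _ (hmem j hj'.le)
        have h2 := h _ (hmem (j + 1) hj')
        rw [norm_div, Complex.norm_ofNat, div_le_iff₀ two_pos]
        exact (norm_add_le _ _).trans (by linarith)
    _ = C := by
        rw [Finset.sum_const, Finset.card_range, nsmul_eq_mul]
        field_simp

theorem tendsto_trapezoid {α : Type*} {l : Filter α} (N : ℕ) {φ : α → ℝ → ℂ} {ψ : ℝ → ℂ}
    (h : ∀ t, Tendsto (fun a => φ a t) l (𝓝 (ψ t))) :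
    Tendsto (fun a => trapezoid N (φ a)) l (𝓝 (trapezoid N ψ)) :=
  (tendsto_finsetSum _ fun _ _ => ((h _).add (h _)).div_const 2).const_mul _

/-- Convergence of the rectangular partial sums to the trapezoidal rule. The induction on the
dimension needs the uniform bound for families that depend smoothly on parameters: the remainder of
the one-dimensional statement is a partial sum of the derivatives in the added coordinate. -/
theorem cubeIntegral_bounded_and_tendsto {N : ℕ} (hN : N ≠ 0) (d : ℕ) :
    ∀ (Y : Type) [NormedAddCommGroup Y] [NormedSpace ℝ Y] (G : Y × (Fin d → ℝ) → ℂ),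
      ContDiff ℝ ∞ G →
      (∀ K : Set Y, IsCompact K → ∃ C : ℝ, ∀ y ∈ K, ∀ M : Fin d → ℕ,
        ‖cubeIntegral N M fun x => G (y, x)‖ ≤ C) ∧
      ∀ y, Tendsto (fun M : Fin d → ℕ => cubeIntegral N M fun x => G (y, x)) atTop
        (𝓝 (iteratedTrapezoid N d fun x => G (y, x))) := by
  induction d with
  | zero =>
    intro Y _ _ G hG
    have h : ∀ (y : Y) (M : Fin 0 → ℕ), (cubeIntegral N M fun x => G (y, x)) = G (y, 0) := by
      intro y M
      have hIcc : Icc (0 : Fin 0 → ℝ) 1 = univ := by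
        ext x; simp [Subsingleton.elim x 0]
      rw [cubeIntegral, hIcc, Measure.restrict_univ, Measure.volume_pi_eq_dirac 0, integral_dirac]
      simp
    refine ⟨fun K hK => ?_, fun y => ?_⟩
    · obtain ⟨C, hC⟩ := hK.exists_bound_of_continuousOn
        (f := fun y => G (y, (0 : Fin 0 → ℝ))) (by have := hG.continuous; fun_prop)
      exact ⟨C, fun y hy M => by rw [h]; exact hC y hy⟩
    · simp only [h, iteratedTrapezoid]
      exact tendsto_const_nhds
  | succ d ih =>
    intro Y _ _ G hG
    obtain ⟨ε, hε, hε0, hle⟩ := exists_norm_integral_sub_trapezoid_le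
    set H : (Y × ℝ) × (Fin d → ℝ) → ℂ := fun p => G (p.1.1, Fin.cons p.1.2 p.2) with hH
    have hHs : ContDiff ℝ ∞ H := by
      refine hG.comp ((contDiff_fst.comp contDiff_fst).prodMk (contDiff_pi.mpr fun i => ?_))
      induction i using Fin.cases with
      | zero => simpa [Function.comp_def] using contDiff_snd.comp contDiff_fst
      | succ j => simpa [Function.comp_def] using
          (contDiff_apply ℝ ℝ j).comp (contDiff_snd (E := Y × ℝ) (F := Fin d → ℝ))
    have hH1 := contDiff_lastParamDeriv hHs
    have hH2 := contDiff_lastParamDeriv hH1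
    obtain ⟨hb0, ht0⟩ := ih (Y × ℝ) H hHs
    have hb1 := (ih (Y × ℝ) (lastParamDeriv H) hH1).1
    have hb2 := (ih (Y × ℝ) (lastParamDeriv (lastParamDeriv H)) hH2).1
    have herr : ∀ K : Set Y, IsCompact K → ∃ B : ℝ, ∀ y ∈ K, ∀ M : Fin (d + 1) → ℕ,
        ‖(cubeIntegral N M fun x => G (y, x)) -
          trapezoid N fun t => cubeIntegral N (Fin.tail M) fun x => H ((y, t), x)‖ ≤
        ε (M 0) * B := by
      intro K hK
      obtain ⟨C1, hC1⟩ := hb1 (K ×ˢ Icc (0 : ℝ) 1) (hK.prod isCompact_Icc)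
      obtain ⟨C2, hC2⟩ := hb2 (K ×ˢ Icc (0 : ℝ) 1) (hK.prod isCompact_Icc)
      refine ⟨max C1 C2, fun y hy M => ?_⟩
      rw [cubeIntegral_succ N M (by have := hG.continuous; fun_prop)]
      exact hle N hN _ _ _ (fun s => hasDerivAt_cubeIntegral hHs N (Fin.tail M) y s)
        (fun s => hasDerivAt_cubeIntegral hH1 N (Fin.tail M) y s)
        (continuous_iff_continuousAt.mpr fun s =>
          (hasDerivAt_cubeIntegral hH2 N (Fin.tail M) y s).continuousAt) _
        (fun s hs => (hC1 (y, s) ⟨hy, hs⟩ _).trans (le_max_left _ _))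
        (fun s hs => (hC2 (y, s) ⟨hy, hs⟩ _).trans (le_max_right _ _)) (M 0)
    refine ⟨fun K hK => ?_, fun y => ?_⟩
    · obtain ⟨B, hB⟩ := herr K hK
      obtain ⟨C0, hC0⟩ := hb0 (K ×ˢ Icc (0 : ℝ) 1) (hK.prod isCompact_Icc)
      obtain ⟨E, hE⟩ := hε.bddAbove_range
      refine ⟨E * |B| + C0, fun y hy M => ?_⟩
      have h1 := norm_trapezoid_le hN (φ := fun t => cubeIntegral N (Fin.tail M)
        fun x => H ((y, t), x)) (C := C0) fun t ht => hC0 (y, t) ⟨hy, ht⟩ _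
      have h2 : ε (M 0) * B ≤ E * |B| :=
        (mul_le_mul_of_nonneg_left (le_abs_self B) (hε0 _)).trans
          (mul_le_mul_of_nonneg_right (hE ⟨M 0, rfl⟩) (abs_nonneg _))
      have h3 := norm_sub_norm_le (cubeIntegral N M fun x => G (y, x))
        (trapezoid N fun t => cubeIntegral N (Fin.tail M) fun x => H ((y, t), x))
      linarith [hB y hy M]
    · obtain ⟨B, hB⟩ := herr {y} isCompact_singleton
      have h0 : Tendsto (fun M : Fin (d + 1) → ℕ => M 0) atTop atTop :=
        Monotone.tendsto_atTop_atTop (fun a b hab => hab 0) fun b => ⟨fun _ => b, le_rfl⟩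
      have htail : Tendsto (fun M : Fin (d + 1) → ℕ => Fin.tail M) atTop atTop :=
        Monotone.tendsto_atTop_atTop (fun a b hab i => hab i.succ)
          fun b => ⟨Fin.cons 0 b, by rw [Fin.tail_cons]⟩
      have hmain : Tendsto (fun M : Fin (d + 1) → ℕ => trapezoid N fun t =>
          cubeIntegral N (Fin.tail M) fun x => H ((y, t), x)) atTop
          (𝓝 (iteratedTrapezoid N (d + 1) fun x => G (y, x))) :=
        tendsto_trapezoid N fun t => (ht0 (y, t)).comp htail
      have hdiff : Tendsto (fun M : Fin (d + 1) → ℕ => (cubeIntegral N M fun x => G (y, x)) -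
          trapezoid N fun t => cubeIntegral N (Fin.tail M) fun x => H ((y, t), x)) atTop (𝓝 0) := by
        refine squeeze_zero_norm (fun M => hB y rfl M) ?_
        simpa using (hε.comp h0).mul_const B
      simpa using hdiff.add hmain

/-! ### Poisson summation on a cube -/


theorem trapezoid_eq_of_eq {N : ℕ} {φ : ℝ → ℂ} (hN : N ≠ 0) (h : φ 1 = φ 0) :
    trapezoid N φ = (N : ℂ)⁻¹ * ∑ j : Fin N, φ ((j : ℕ) / N) := by
  have hNR : (N : ℝ) ≠ 0 := Nat.cast_ne_zero.mpr hN
  have h1 : ∑ j ∈ Finset.range N, φ ((j + 1 : ℕ) / N) = ∑ j ∈ Finset.range N, φ (j / N) := by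
    have h2 := Finset.sum_range_succ (fun j : ℕ => φ (j / N)) N
    rw [Finset.sum_range_succ', div_self hNR, h, Nat.cast_zero, zero_div] at h2
    exact add_right_cancel h2
  rw [trapezoid, ← Finset.sum_div, Finset.sum_add_distrib, h1, ← two_mul,
    mul_div_cancel_left₀ _ two_ne_zero, Finset.sum_range]

/-- If the values of `f` at the points of `(1 / N) ℤ^d` in the cube agree on opposite faces, then the
trapezoidal rule averages `f` over a fundamental domain of the lattice. -/
theorem iteratedTrapezoid_eq {N : ℕ} (hN : N ≠ 0) {d : ℕ} {f : (Fin d → ℝ) → ℂ}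
    (hper : ∀ (n : Fin d → ℕ) (i : Fin d),
      f (fun k => (Function.update n i N k : ℕ) / N) =
        f (fun k => (Function.update n i 0 k : ℕ) / N)) :
    iteratedTrapezoid N d f =
      ((N : ℂ) ^ d)⁻¹ * ∑ n : Fin d → Fin N, f (fun k => ((n k : ℕ) : ℝ) / N) := by
  induction d with
  | zero =>
    simp only [iteratedTrapezoid, Finset.univ_unique, Finset.sum_singleton]
    rw [pow_zero, inv_one, one_mul]
    congr 1
    exact Subsingleton.elim _ _
  | succ d ih =>
    have hNR : (N : ℝ) ≠ 0 := Nat.cast_ne_zero.mpr hN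
    have hcons : ∀ (j : ℕ) (n : Fin d → ℕ),
        (fun k => ((Fin.cons j n : Fin (d + 1) → ℕ) k : ℝ) / N) =
          Fin.cons ((j : ℝ) / N) (fun k => (n k : ℝ) / N) := by
      intro j n
      funext k
      induction k using Fin.cases with
      | zero => simp
      | succ k => simp
    have hslice : ∀ j : ℕ, (iteratedTrapezoid N d fun x => f (Fin.cons ((j : ℝ) / N) x)) =
        ((N : ℂ) ^ d)⁻¹ * ∑ n : Fin d → Fin N,
          f (Fin.cons ((j : ℝ) / N) fun k => ((n k : ℕ) : ℝ) / N) := by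
      intro j
      refine ih fun n i => ?_
      have h := hper (Fin.cons j n) i.succ
      rwa [← Fin.cons_update, ← Fin.cons_update, hcons, hcons] at h
    rw [iteratedTrapezoid, trapezoid_eq_of_eq hN]
    · simp only [hslice]
      rw [← Finset.mul_sum, ← mul_assoc, ← mul_inv, ← pow_succ', ← Fintype.sum_prod_type']
      congr 1
      refine Fintype.sum_equiv (Fin.consEquiv fun _ => Fin N) _ _ fun p => ?_
      congr 1
      funext k
      induction k using Fin.cases with
      | zero => simp
      | succ k => simp
    · have h1 := hslice N
      have h0 := hslice 0
      rw [div_self hNR] at h1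
      rw [Nat.cast_zero, zero_div] at h0
      rw [h1, h0]
      congr 1
      refine Finset.sum_congr rfl fun n _ => ?_
      have h := hper (Fin.cons 0 fun k => (n k : ℕ)) 0
      rw [Fin.update_cons_zero, Fin.update_cons_zero, hcons, hcons, div_self hNR, Nat.cast_zero,
        zero_div] at h
      exact h

/-- Poisson summation on the cube: for a smooth function whose values at lattice points agree on
opposite faces, the Fourier coefficients at the multiples of `N` sum to a lattice average. -/
theorem tendsto_sum_integral_mul_exp {ι : Type*} [Fintype ι] [DecidableEq ι] {N : ℕ} (hN : N ≠ 0)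
    {f : (ι → ℝ) → ℂ} (hf : ContDiff ℝ ∞ f)
    (hper : ∀ (n : ι → ℕ) (i : ι),
      f (fun k => (Function.update n i N k : ℕ) / N) =
        f (fun k => (Function.update n i 0 k : ℕ) / N)) :
    Tendsto (fun M : ι → ℕ => ∑ k ∈ Fintype.piFinset (fun i => Finset.Icc (-(M i : ℤ)) (M i)),
        ∫ t in Icc (0 : ι → ℝ) 1,
          f t * exp (-(N * (2 * Real.pi * I * ∑ i, (k i : ℂ) * (t i : ℂ))))) atTop
      (𝓝 (((N : ℂ) ^ Fintype.card ι)⁻¹ * ∑ n : ι → Fin N, f (fun k => ((n k : ℕ) : ℝ) / N))) := by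
  have hcube : ∀ M : ι → ℕ,
      ∑ k ∈ Fintype.piFinset (fun i => Finset.Icc (-(M i : ℤ)) (M i)),
        ∫ t in Icc (0 : ι → ℝ) 1,
          f t * exp (-(N * (2 * Real.pi * I * ∑ i, (k i : ℂ) * (t i : ℂ)))) =
      cubeIntegral N M f := by
    intro M
    rw [← integral_finsetSum, cubeIntegral]
    · congr 1
      funext t
      rw [← Finset.mul_sum]
      congr 1
      simp only [dirichletKernel]
      rw [Finset.prod_univ_sum]
      refine Finset.sum_congr rfl fun k _ => ?_
      rw [← Complex.exp_sum]
      congr 1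
      rw [Finset.mul_sum, Finset.mul_sum, ← Finset.sum_neg_distrib]
      refine Finset.sum_congr rfl fun i _ => ?_
      push_cast
      ring
    · intro k _
      exact (Continuous.continuousOn (by
        have := hf.continuous; fun_prop)).integrableOn_compact isCompact_Icc
  simp only [hcube]
  set d := Fintype.card ι with hd
  set e : Fin d ≃ ι := (Fintype.equivFin ι).symm
  set g : (Fin d → ℝ) → ℂ := fun x => f fun i => x (e.symm i) with hg
  have hgs : ContDiff ℝ ∞ g := hf.comp (contDiff_pi.mpr fun i => contDiff_apply ℝ ℝ (e.symm i))
  have htransfer : ∀ M : ι → ℕ, cubeIntegral N M f = cubeIntegral N (fun j => M (e j)) g := by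
    intro M
    have hmp := volume_measurePreserving_piCongrLeft (fun _ : ι => ℝ) e
    have happ : ∀ x : Fin d → ℝ, MeasurableEquiv.piCongrLeft (fun _ : ι => ℝ) e x =
        fun i => x (e.symm i) := by
      intro x
      funext i
      obtain ⟨j, rfl⟩ := e.surjective i
      rw [MeasurableEquiv.coe_piCongrLeft, Equiv.piCongrLeft_apply_apply, e.symm_apply_apply]
    have hpre : MeasurableEquiv.piCongrLeft (fun _ : ι => ℝ) e ⁻¹' Icc (0 : ι → ℝ) 1 =
        Icc (0 : Fin d → ℝ) 1 := by
      ext x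
      simp only [mem_preimage, happ, mem_Icc, Pi.le_def, Pi.zero_apply, Pi.one_apply,
        e.symm.forall_congr_left]
      simp
    rw [cubeIntegral, cubeIntegral, ← hmp.setIntegral_preimage_emb
      (MeasurableEquiv.measurableEmbedding _), hpre]
    congr 1
    funext x
    rw [happ, hg]
    congr 1
    exact (Fintype.prod_equiv e _ _ fun j => by simp only [e.symm_apply_apply]).symm
  have hlim := (cubeIntegral_bounded_and_tendsto hN d ℝ (fun p => g p.2)
    (hgs.comp contDiff_snd)).2 0
  have hre : Tendsto (fun (M : ι → ℕ) (j : Fin d) => M (e j)) atTop atTop :=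
    Monotone.tendsto_atTop_atTop (fun a b hab j => hab (e j))
      fun b => ⟨fun i => b (e.symm i), fun j => by simp⟩
  simp only [htransfer]
  have hgper : iteratedTrapezoid N d g =
      ((N : ℂ) ^ d)⁻¹ * ∑ n : Fin d → Fin N, g (fun k => ((n k : ℕ) : ℝ) / N) := by
    refine iteratedTrapezoid_eq hN fun n i => ?_
    have h := hper (fun i => n (e.symm i)) (e i)
    have hu : ∀ (c : ℕ) (k : ι), Function.update (fun i => n (e.symm i)) (e i) c k =
        Function.update n i c (e.symm k) := by
      intro c k
      simp only [Function.update_apply, Equiv.symm_apply_eq]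
    simp only [hu] at h
    exact h
  have hsum : ∑ n : ι → Fin N, f (fun k => ((n k : ℕ) : ℝ) / N) =
      ∑ n : Fin d → Fin N, g (fun k => ((n k : ℕ) : ℝ) / N) :=
    Fintype.sum_equiv (Equiv.arrowCongr e.symm (Equiv.refl (Fin N))) _ _ fun n => by simp [hg]
  rw [hsum, ← hgper]
  exact hlim.comp hre

/-! ### The crossing functions -/


section

variable {N : ℕ}

theorem one_sub_exp_ne_zero {w : ℂ} (hw : w.im ≠ 0) : 1 - exp (2 * Real.pi * I * w) ≠ 0 := by
  have h : (2 * Real.pi * I * w - Real.pi * I : ℂ).re ≠ 0 := by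
    have : (2 * Real.pi * I * w - Real.pi * I : ℂ).re = -(2 * Real.pi * w.im) := by simp
    rw [this]
    have := Real.pi_pos
    exact neg_ne_zero.mpr (by positivity)
  have h1 := one_add_exp_ne_zero h
  rwa [Complex.exp_sub_pi_mul_I, ← sub_eq_add_neg] at h1

theorem qlog_add_intCast (hN : 2 ≤ N) {s : ℂ} (hs : s.im ≠ 0) (k : ℤ) :
    qlog N (s + k) = qlog N s * (1 - exp (2 * Real.pi * I * (N * s))) ^ (-k) := by
  have hNR : (N : ℝ) ≠ 0 := Nat.cast_ne_zero.mpr (by omega)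
  have hper : ∀ k : ℤ, exp (2 * Real.pi * I * (N * (s + k))) = exp (2 * Real.pi * I * (N * s)) :=
    fun k => by
      rw [Complex.exp_eq_exp_iff_exists_int]
      exact ⟨N * k, by push_cast; ring⟩
  have hne : 1 - exp (2 * Real.pi * I * (N * s)) ≠ 0 :=
    one_sub_exp_ne_zero (by rw [← ofReal_natCast, im_ofReal_mul]; exact mul_ne_zero hNR hs)
  have hstep : ∀ k : ℤ, qlog N (s + (k + 1 : ℤ)) * (1 - exp (2 * Real.pi * I * (N * s))) =
      qlog N (s + k) := by
    intro k
    have h := qlog_add_one hN (t := s + k) (by simpa using hs)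
    rw [hper] at h
    rw [← h]
    push_cast
    ring_nf
  induction k using Int.induction_on with
  | zero => simp
  | succ k ih =>
    have h := hstep k
    rw [ih] at h
    rw [neg_add, zpow_add₀ hne, zpow_neg_one, ← mul_assoc, ← h, mul_inv_cancel_right₀ hne]
  | pred k ih =>
    have h := hstep (-(k : ℤ) - 1)
    rw [sub_add_cancel, ih] at h
    rw [← h, neg_sub, sub_neg_eq_add, neg_neg, add_comm (1 : ℤ), zpow_add₀ hne, zpow_one]
    ring

theorem contDiff_qlog_comp (hN : 2 ≤ N) {E : Type*} [NormedAddCommGroup E] [NormedSpace ℝ E]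
    {a : E → ℂ} (ha : ContDiff ℝ ∞ a) (him : ∀ t, (a t).im ≠ 0) :
    ContDiff ℝ ∞ fun t => qlog N (a t) := by
  have hopen : IsOpen {t : ℂ | t.im ≠ 0} := isOpen_ne_fun continuous_im continuous_const
  have hd : DifferentiableOn ℂ (qlog N) {t : ℂ | t.im ≠ 0} := fun t ht =>
    (differentiableAt_qlog hN ht).differentiableWithinAt
  have hc : ContDiffOn ℂ ∞ (qlog N) {t : ℂ | t.im ≠ 0} := hd.contDiffOn hopen
  rw [contDiff_iff_contDiffAt]
  intro t
  have h1 : ContDiffAt ℂ ∞ (qlog N) (a t) := hc.contDiffAt (hopen.mem_nhds (him t))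
  exact (h1.restrict_scalars ℝ).comp t ha.contDiffAt

theorem exp_natCast_mul_add_one_sub (hN : N ≠ 0) (s : ℂ) :
    exp (2 * Real.pi * I * (N * (s + 1 - 1 / N))) = exp (2 * Real.pi * I * (N * s)) := by
  have hNC : (N : ℂ) ≠ 0 := Nat.cast_ne_zero.mpr hN
  rw [Complex.exp_eq_exp_iff_exists_int]
  refine ⟨N - 1, ?_⟩
  push_cast
  field_simp
  ring

/-- The behaviour of the crossing function when its arguments are shifted by integers. -/
theorem expCrossing_add_intCast (hN : 2 ≤ N) (ε : CrossingSign) {μ t₁ t₂ t₁' t₂' : ℂ}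
    (hn : (t₂' - t₁).im ≠ 0) (hs : (t₂ - t₁').im ≠ 0) (hw : (t₂ - t₁ - μ / N).im ≠ 0)
    (he : (t₂' - t₁' + μ / N).im ≠ 0) (k₁ k₂ k₁' k₂' : ℤ) :
    expCrossing N ε μ (t₁ + k₁) (t₂ + k₂) (t₁' + k₁') (t₂' + k₂') =
      expCrossing N ε μ t₁ t₂ t₁' t₂' *
        ((1 - exp (2 * Real.pi * I * (N * (t₂' - t₁))) ^ ε.toInt) ^ (k₁ - k₂') *
          (1 - exp (2 * Real.pi * I * (N * (t₂ - t₁'))) ^ ε.toInt) ^ (k₁' - k₂) *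
          (1 - exp (2 * Real.pi * I * (N * (t₂ - t₁ - μ / N))) ^ ε.toInt) ^ (k₂ - k₁) *
          (1 - exp (2 * Real.pi * I * (N * (t₂' - t₁' + μ / N))) ^ ε.toInt) ^ (k₂' - k₁') *
          (exp (2 * Real.pi * I * μ) ^ ε.toInt) ^ (k₂ + k₁' - k₁ - k₂')) := by
  have hN0 : N ≠ 0 := by omega
  have him : ∀ {s : ℂ}, s.im ≠ 0 → (s + 1 - 1 / (N : ℂ)).im ≠ 0 := by
    intro s hs
    simpa using hs
  have hexp : exp (2 * Real.pi * I * ε.toInt * (1 - N) * (t₂ + k₂ - (t₁ + k₁) - μ / N) +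
      ε.toInt * (2 * Real.pi * I) * μ * (t₂ + k₂ + (t₁' + k₁') - (t₁ + k₁) - (t₂' + k₂'))) =
      exp (2 * Real.pi * I * ε.toInt * (1 - N) * (t₂ - t₁ - μ / N) +
        ε.toInt * (2 * Real.pi * I) * μ * (t₂ + t₁' - t₁ - t₂')) *
      (exp (2 * Real.pi * I * μ) ^ ε.toInt) ^ (k₂ + k₁' - k₁ - k₂') := by
    rw [← Complex.exp_int_mul, ← Complex.exp_int_mul, ← Complex.exp_add,
      Complex.exp_eq_exp_iff_exists_int]
    exact ⟨ε.toInt * (1 - N) * (k₂ - k₁), by push_cast; ring⟩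
  rw [expCrossing, hexp, expCrossing]
  have hfac : expLambda N ε μ (t₁ + k₁) (t₂ + k₂) (t₁' + k₁') (t₂' + k₂') =
      expLambda N ε μ t₁ t₂ t₁' t₂' *
        ((1 - exp (2 * Real.pi * I * (N * (t₂' - t₁))) ^ ε.toInt) ^ (k₁ - k₂') *
          (1 - exp (2 * Real.pi * I * (N * (t₂ - t₁'))) ^ ε.toInt) ^ (k₁' - k₂) *
          (1 - exp (2 * Real.pi * I * (N * (t₂ - t₁ - μ / N))) ^ ε.toInt) ^ (k₂ - k₁) *
          (1 - exp (2 * Real.pi * I * (N * (t₂' - t₁' + μ / N))) ^ ε.toInt) ^ (k₂' - k₁')) := by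
    cases ε with
    | pos =>
      simp only [expLambda, CrossingSign.toInt, zpow_one]
      rw [show t₂' + k₂' - (t₁ + k₁) = t₂' - t₁ + (k₂' - k₁ : ℤ) by push_cast; ring,
        show t₂ + k₂ - (t₁' + k₁') = t₂ - t₁' + (k₂ - k₁' : ℤ) by push_cast; ring,
        show t₂ + k₂ - (t₁ + k₁) - μ / N + 1 - 1 / N =
          t₂ - t₁ - μ / N + 1 - 1 / N + (k₂ - k₁ : ℤ) by push_cast; ring,
        show t₂' + k₂' - (t₁' + k₁') + μ / N = t₂' - t₁' + μ / N + (k₂' - k₁' : ℤ) by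
          push_cast; ring,
        qlog_add_intCast hN hn, qlog_add_intCast hN hs, qlog_add_intCast hN (him hw),
        qlog_add_intCast hN he, exp_natCast_mul_add_one_sub hN0, neg_sub, neg_sub,
        zpow_neg _ (k₂ - k₁), zpow_neg _ (k₂' - k₁')]
      simp only [div_eq_mul_inv, mul_inv, inv_inv]
      ring
    | neg =>
      have hinv : ∀ s : ℂ, exp (2 * Real.pi * I * (N * s)) ^ (-1 : ℤ) =
          exp (2 * Real.pi * I * (N * -s)) := by
        intro s
        rw [zpow_neg_one, ← Complex.exp_neg]
        congr 1; ring
      have hneg : ∀ {s : ℂ}, s.im ≠ 0 → (-s).im ≠ 0 := fun h => by simpa using h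
      simp only [expLambda, CrossingSign.toInt, hinv]
      rw [show t₁ + k₁ - (t₂' + k₂') + 1 - 1 / (N : ℂ) =
          -(t₂' - t₁) + 1 - 1 / N + (k₁ - k₂' : ℤ) by push_cast; ring,
        show t₁' + k₁' - (t₂ + k₂) + 1 - 1 / (N : ℂ) =
          -(t₂ - t₁') + 1 - 1 / N + (k₁' - k₂ : ℤ) by push_cast; ring,
        show t₁ + k₁ - (t₂ + k₂) + μ / N = -(t₂ - t₁ - μ / N) + (k₁ - k₂ : ℤ) by push_cast; ring,
        show t₁' + k₁' - (t₂' + k₂') - μ / N + 1 - 1 / N =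
          -(t₂' - t₁' + μ / N) + 1 - 1 / N + (k₁' - k₂' : ℤ) by push_cast; ring,
        show t₁ - t₂' + 1 - 1 / (N : ℂ) = -(t₂' - t₁) + 1 - 1 / N by ring,
        show t₁' - t₂ + 1 - 1 / (N : ℂ) = -(t₂ - t₁') + 1 - 1 / N by ring,
        show t₁ - t₂ + μ / N = -(t₂ - t₁ - μ / N) by ring,
        show t₁' - t₂' - μ / N + 1 - 1 / N = -(t₂' - t₁' + μ / N) + 1 - 1 / N by ring,
        qlog_add_intCast hN (him (hneg hn)), qlog_add_intCast hN (him (hneg hs)),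
        qlog_add_intCast hN (hneg hw), qlog_add_intCast hN (him (hneg he)),
        exp_natCast_mul_add_one_sub hN0, exp_natCast_mul_add_one_sub hN0,
        exp_natCast_mul_add_one_sub hN0, neg_sub k₁ k₂, neg_sub k₁' k₂',
        zpow_neg _ (k₁ - k₂'), zpow_neg _ (k₁' - k₂)]
      simp only [div_eq_mul_inv, mul_inv, inv_inv]
      ring
  rw [hfac]
  ring

theorem contDiff_expCrossing (hN : 2 ≤ N) (ε : CrossingSign) (μ : ℂ) {E : Type*}
    [NormedAddCommGroup E] [NormedSpace ℝ E] {t₁ t₂ t₁' t₂' : E → ℂ}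
    (h₁ : ContDiff ℝ ∞ t₁) (h₂ : ContDiff ℝ ∞ t₂) (h₁' : ContDiff ℝ ∞ t₁')
    (h₂' : ContDiff ℝ ∞ t₂')
    (hn : ∀ x, (t₂' x - t₁ x).im ≠ 0) (hs : ∀ x, (t₂ x - t₁' x).im ≠ 0)
    (hw : ∀ x, (t₂ x - t₁ x - μ / N).im ≠ 0) (he : ∀ x, (t₂' x - t₁' x + μ / N).im ≠ 0) :
    ContDiff ℝ ∞ fun x => expCrossing N ε μ (t₁ x) (t₂ x) (t₁' x) (t₂' x) := by
  have him : ∀ {s : ℂ}, s.im ≠ 0 → (s + 1 - 1 / (N : ℂ)).im ≠ 0 := by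
    intro s hs
    simpa using hs
  have hneg : ∀ {s s' : ℂ}, s.im ≠ 0 → s' = -s → s'.im ≠ 0 := by
    rintro s s' h rfl; simpa using h
  have hexp : ContDiff ℝ ∞ fun x => exp (2 * Real.pi * I * ε.toInt * (1 - N) *
      (t₂ x - t₁ x - μ / N) + ε.toInt * (2 * Real.pi * I) * μ * (t₂ x + t₁' x - t₁ x - t₂' x)) := by
    fun_prop
  refine ContDiff.mul ?_ hexp
  cases ε with
  | pos =>
    have hd : ∀ x, qlog N (t₂ x - t₁ x - μ / N + 1 - 1 / N) * qlog N (t₂' x - t₁' x + μ / N) ≠ 0 :=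
      fun x => mul_ne_zero (qlog_ne_zero hN (him (hw x))) (qlog_ne_zero hN (he x))
    refine (congrArg (ContDiff ℝ ∞) (funext fun x => div_eq_mul_inv _ _)).mpr
      (((contDiff_qlog_comp hN (h₂'.sub h₁) hn).mul
      (contDiff_qlog_comp hN (h₂.sub h₁') hs)).mul
      (((contDiff_qlog_comp hN (by fun_prop) fun x => him (hw x)).mul
        (contDiff_qlog_comp hN (by fun_prop) he)).inv hd))
  | neg =>
    have hn' : ∀ x, (t₁ x - t₂' x + 1 - 1 / (N : ℂ)).im ≠ 0 := fun x =>
      him (hneg (hn x) (by ring))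
    have hs' : ∀ x, (t₁' x - t₂ x + 1 - 1 / (N : ℂ)).im ≠ 0 := fun x =>
      him (hneg (hs x) (by ring))
    have hw' : ∀ x, (t₁ x - t₂ x + μ / N).im ≠ 0 := fun x => hneg (hw x) (by ring)
    have he' : ∀ x, (t₁' x - t₂' x - μ / N + 1 - 1 / N).im ≠ 0 := fun x =>
      him (hneg (he x) (by ring))
    refine (congrArg (ContDiff ℝ ∞) (funext fun x => div_eq_mul_inv _ _)).mpr
      (((contDiff_qlog_comp hN (by fun_prop) hw').mul
      (contDiff_qlog_comp hN (by fun_prop) he')).mul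
      (((contDiff_qlog_comp hN (by fun_prop) hn').mul
        (contDiff_qlog_comp hN (by fun_prop) hs')).inv
      fun x => mul_ne_zero (qlog_ne_zero hN (hn' x)) (qlog_ne_zero hN (hs' x))))

end

/-! ### Regions and meridians of a shadow coloring -/


section

variable {c : ℕ}

theorem exists_layer_of_mem_crossingsOf {X : Crossing c} {Ls : List (Layer c)}
    (h : X ∈ crossingsOf Ls) : ∃ L ∈ Ls, L.piece = .crossing X := by
  induction Ls with
  | nil => simp [crossingsOf] at h
  | cons L Ls ih =>
    rw [crossingsOf] at h
    split at h
    · rename_i Y hY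
      rcases List.mem_cons.mp h with rfl | h
      · exact ⟨L, List.mem_cons_self, hY⟩
      · obtain ⟨L', hL', hp⟩ := ih h
        exact ⟨L', List.mem_cons_of_mem _ hL', hp⟩
    · obtain ⟨L', hL', hp⟩ := ih h
      exact ⟨L', List.mem_cons_of_mem _ hL', hp⟩

theorem Composes.source_mem {S T : List (Strand c)} {Ls : List (Layer c)} (h : Composes S Ls T)
    {L : Layer c} (hL : L ∈ Ls) : L.source ∈ S :: Ls.map Layer.target := by
  induction Ls generalizing S with
  | nil => simp at hL
  | cons L' Ls ih =>
    obtain ⟨h1, h2⟩ := h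
    rcases List.mem_cons.mp hL with rfl | hL
    · rw [h1]; exact List.mem_cons_self
    · exact List.mem_cons_of_mem _ (ih h2 hL)

variable {col : Fin (2 * c + 1) → DecoratedMatrix} {left : Fin (2 * c + 1) → Fin 2 → ℂ}

theorem RegionsFit.append {u w : Fin 2 → ℂ} {S T : List (Strand c)}
    (h : RegionsFit col left u (S ++ T) w) :
    ∃ v, RegionsFit col left u S v ∧ RegionsFit col left v T w := by
  induction S generalizing u with
  | nil => exact ⟨u, rfl, h⟩
  | cons s S ih =>
    rw [List.cons_append, RegionsFit] at h
    by_cases hs : s.rightward = true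
    · rw [if_pos hs] at h
      obtain ⟨v, h1, h2⟩ := ih h.2
      exact ⟨v, by rw [RegionsFit, if_pos hs]; exact ⟨h.1, h1⟩, h2⟩
    · rw [if_neg hs] at h
      obtain ⟨v, h1, h2⟩ := ih h.2
      exact ⟨v, by rw [RegionsFit, if_neg hs]; exact ⟨h.1, h1⟩, h2⟩

theorem RegionsFit.end_unique {u w w' : Fin 2 → ℂ} {S : List (Strand c)}
    (h : RegionsFit col left u S w) (h' : RegionsFit col left u S w') : w = w' := by
  induction S generalizing u with
  | nil => exact Eq.trans (Eq.symm h) h'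
  | cons s S ih =>
    rw [RegionsFit] at h h'
    split_ifs at h h' with hs
    · exact ih h.2 h'.2
    · exact ih h.2 h'.2

theorem RegionsFit.start_unique {u u' w : Fin 2 → ℂ} {S : List (Strand c)}
    (h : RegionsFit col left u S w) (h' : RegionsFit col left u' S w) : u = u' := by
  cases S with
  | nil => exact Eq.trans h (Eq.symm h')
  | cons s S =>
    rw [RegionsFit] at h h'
    split_ifs at h h' with hs
    · exact h.1.symm.trans h'.1
    · exact h.1.symm.trans h'.1

/-- The four regions at a crossing, as seen from the adjacent segments. -/
theorem ShadowColoring.regions_crossing {D : OpenDiagram c} (Γ : ShadowColoring D) {X : Crossing c}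
    (hX : X ∈ D.crossings) :
    Γ.left X.out₂.seg = Γ.left X.in₁.seg ∧ Γ.left X.in₂.seg = Γ.right X.in₁.seg ∧
      Γ.left X.out₁.seg = Γ.right X.out₂.seg ∧ Γ.right X.out₁.seg = Γ.right X.in₂.seg := by
  obtain ⟨L, hL, hp⟩ := exists_layer_of_mem_crossingsOf hX
  have hs := Γ.fit _ (D.composes.source_mem hL)
  have ht := Γ.fit _ (List.mem_cons_of_mem _ (List.mem_map_of_mem hL) : L.target ∈ D.slices)
  rw [Layer.source, hp, List.append_assoc] at hs
  rw [Layer.target, hp, List.append_assoc] at ht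
  obtain ⟨u, hu, hs⟩ := hs.append
  obtain ⟨u', hu', ht⟩ := ht.append
  obtain rfl := hu.end_unique hu'
  obtain ⟨w, hs, hw⟩ := hs.append
  obtain ⟨w', ht, hw'⟩ := ht.append
  obtain rfl := hw.start_unique hw'
  simp only [Piece.source, Piece.target, RegionsFit, if_true] at hs ht
  exact ⟨ht.1.trans hs.1.symm, hs.2.1, ht.2.1, ht.2.2.trans hs.2.2.symm⟩

theorem DecoratedMatrix.m_eq_of_vecMul (x : DecoratedMatrix) {m : ℂ}
    (h : Matrix.vecMul x.v (x.g : Matrix (Fin 2) (Fin 2) ℂ) = m⁻¹ • x.v) : x.m = m := by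
  have h1 : x.m⁻¹ • x.v = m⁻¹ • x.v := x.eigen.symm.trans h
  exact inv_injective (smul_left_injective ℂ x.v_ne_zero h1)

theorem DecoratedMatrix.Same.m_eq {x y : DecoratedMatrix} (h : x.Same y) : x.m = y.m := by
  obtain ⟨hg, a, _, hv⟩ := h
  refine x.m_eq_of_vecMul ?_
  rw [hg, hv, Matrix.smul_vecMul, y.eigen, smul_comm]

theorem DecoratedMatrix.IsAct.m_eq {x y z : DecoratedMatrix} (h : x.IsAct y z) : z.m = x.m := by
  obtain ⟨hg, a, _, hv⟩ := h
  refine z.m_eq_of_vecMul ?_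
  rw [hv, Matrix.smul_vecMul, hg, Matrix.vecMul_vecMul, ← Matrix.SpecialLinearGroup.coe_mul,
    show y.g * (y.g⁻¹ * x.g * y.g) = x.g * y.g by group, Matrix.SpecialLinearGroup.coe_mul,
    ← Matrix.vecMul_vecMul, x.eigen, Matrix.smul_vecMul, smul_comm]

theorem DecoratedMatrix.IsInvAct.m_eq {x y z : DecoratedMatrix} (h : x.IsInvAct y z) :
    z.m = x.m := by
  obtain ⟨hg, a, _, hv⟩ := h
  refine z.m_eq_of_vecMul ?_
  rw [hv, Matrix.smul_vecMul, hg, Matrix.vecMul_vecMul, ← Matrix.SpecialLinearGroup.coe_mul,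
    show y.g⁻¹ * (y.g * x.g * y.g⁻¹) = x.g * y.g⁻¹ by group, Matrix.SpecialLinearGroup.coe_mul,
    ← Matrix.vecMul_vecMul, x.eigen, Matrix.smul_vecMul, smul_comm]

/-- Each segment but the last enters some crossing and continues there as the next segment. -/
theorem OpenDiagram.exists_passage (D : OpenDiagram c) (j : Fin (2 * c)) : ∃ X ∈ D.crossings,
    (X.in₁.seg = j.castSucc ∧ X.out₁.seg = j.succ) ∨
      (X.in₂.seg = j.castSucc ∧ X.out₂.seg = j.succ) := by
  have h : (j.castSucc, j.succ) ∈ (List.finRange (2 * c)).map fun j => (j.castSucc, j.succ) :=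
    List.mem_map_of_mem (List.mem_finRange j)
  rw [← D.passages.mem_iff, List.mem_flatMap] at h
  obtain ⟨X, hX, h⟩ := h
  refine ⟨X, hX, ?_⟩
  simp only [List.mem_cons, List.not_mem_nil, or_false, Prod.mk.injEq] at h
  exact h.imp (fun h => ⟨h.1.symm, h.2.symm⟩) fun h => ⟨h.1.symm, h.2.symm⟩

/-- All segments have the same distinguished eigenvalue, since it is preserved at each passage
through a crossing. -/
theorem DecoratedColoring.m_eq_meridian {D : OpenDiagram c} (ρ : DecoratedColoring D)
    (j : Fin (2 * c + 1)) : (ρ.color j).m = ρ.meridian := by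
  induction j using Fin.induction with
  | zero => rfl
  | succ j ih =>
    obtain ⟨X, hX, h⟩ := D.exists_passage j
    have hr := ρ.crossing X hX
    rw [← ih]
    unfold CrossingRelation at hr
    rcases h with ⟨h1, h2⟩ | ⟨h1, h2⟩ <;> rw [← h1, ← h2] <;> split at hr
    · exact hr.1.m_eq
    · exact hr.2.m_eq
    · exact hr.2.m_eq
    · exact hr.1.m_eq

end

/-! ### Shape parameters and region parameters -/

theorem dotProduct_mul_sub_dotProduct_mul (v w u : Fin 2 → ℂ) :
    dotProduct v u * w 1 - dotProduct w u * v 1 = u 0 * (v 0 * w 1 - v 1 * w 0) := by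
  simp [dotProduct, Fin.sum_univ_two]; ring

theorem vecMul_wedge {g : Matrix (Fin 2) (Fin 2) ℂ} (hg : g.det = 1) (v w : Fin 2 → ℂ) :
    Matrix.vecMul v g 0 * Matrix.vecMul w g 1 - Matrix.vecMul v g 1 * Matrix.vecMul w g 0 =
      v 0 * w 1 - v 1 * w 0 := by
  rw [Matrix.det_fin_two] at hg
  simp only [Matrix.vecMul, dotProduct, Fin.sum_univ_two]
  linear_combination (v 0 * w 1 - v 1 * w 0) * hg

/-- The segment parameter of a segment with row vector `v` and the vector `u` on its left. -/
noncomputable def segmentParam (v u : Fin 2 → ℂ) : ℂ := -(v 1) / dotProduct v u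

theorem segmentParam_smul {a : ℂ} (ha : a ≠ 0) (v u : Fin 2 → ℂ) :
    segmentParam (a • v) u = segmentParam v u := by
  rw [segmentParam, segmentParam, smul_dotProduct, Pi.smul_apply, smul_eq_mul, smul_eq_mul,
    ← mul_neg, mul_div_mul_left _ _ ha]

/-- At a positive crossing, the differences `1 - z` are proportional to the region parameters, up to
powers of the meridian eigenvalue. -/
theorem exists_proportional_pos {g₁ g₂ : Matrix (Fin 2) (Fin 2) ℂ} (hg : g₁.det = 1)
    {v₁ v₂ v₂' u uE : Fin 2 → ℂ} {m : ℂ} (hm : m ≠ 0) (h₁ : Matrix.vecMul v₁ g₁ = m⁻¹ • v₁)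
    (h₂ : Matrix.vecMul v₂ g₂ = m⁻¹ • v₂) (hv : v₂' = Matrix.vecMul v₂ g₁)
    (hE : g₁.mulVec uE = g₂.mulVec (g₁.mulVec u)) (hv₁ : v₁ 1 ≠ 0)
    (_hP : dotProduct v₁ u ≠ 0) (hQ : dotProduct v₂ (g₁.mulVec u) ≠ 0)
    (_hR : dotProduct v₁ uE ≠ 0) :
    ∃ κ : ℂ, 1 - segmentParam v₂' u / segmentParam v₁ u = κ * u 0 ∧
      m * (1 - segmentParam v₂ (g₁.mulVec u) / (m * segmentParam v₁ u)) = κ * g₁.mulVec u 0 ∧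
      1 - segmentParam v₂ (g₁.mulVec u) / segmentParam v₁ uE =
        κ * g₂.mulVec (g₁.mulVec u) 0 ∧
      1 - m * segmentParam v₂' u / segmentParam v₁ uE = m * κ * uE 0 := by
  set uW := g₁.mulVec u with huW
  set uS := g₂.mulVec uW with huS
  have e1 : dotProduct v₁ uW = m⁻¹ * dotProduct v₁ u := by
    rw [huW, Matrix.dotProduct_mulVec, h₁, smul_dotProduct, smul_eq_mul]
  have e2 : dotProduct v₂ uS = m⁻¹ * dotProduct v₂ uW := by
    rw [huS, Matrix.dotProduct_mulVec, h₂, smul_dotProduct, smul_eq_mul]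
  have e3 : dotProduct v₁ uS = m⁻¹ * dotProduct v₁ uE := by
    rw [← hE, Matrix.dotProduct_mulVec, h₁, smul_dotProduct, smul_eq_mul]
  have e4 : dotProduct v₂' u = dotProduct v₂ uW := by
    rw [hv, huW, Matrix.dotProduct_mulVec]
  have e5 : dotProduct v₂' uE = m⁻¹ * dotProduct v₂ uW := by
    rw [hv, ← Matrix.dotProduct_mulVec, hE, e2]
  have e6 : v₂' 0 * v₁ 1 - v₂' 1 * v₁ 0 = m * (v₂ 0 * v₁ 1 - v₂ 1 * v₁ 0) := by
    have h := vecMul_wedge hg v₂ v₁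
    rw [h₁, ← hv, Pi.smul_apply, Pi.smul_apply, smul_eq_mul, smul_eq_mul] at h
    rw [← h]; field_simp
  have dN := dotProduct_mul_sub_dotProduct_mul v₂' v₁ u
  have dW := dotProduct_mul_sub_dotProduct_mul v₂ v₁ uW
  have dS := dotProduct_mul_sub_dotProduct_mul v₂ v₁ uS
  have dE := dotProduct_mul_sub_dotProduct_mul v₂' v₁ uE
  rw [e4, e6] at dN
  rw [e1] at dW
  rw [e2, e3] at dS
  rw [e5, e6] at dE
  -- Each of the four differences has the wedge of `v₂` and `v₁` in its numerator.
  refine ⟨m * (v₂ 0 * v₁ 1 - v₂ 1 * v₁ 0) / (dotProduct v₂ uW * v₁ 1), ?_, ?_, ?_, ?_⟩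
  · rw [segmentParam, segmentParam, e4]
    field_simp
    linear_combination dN
  · rw [segmentParam, segmentParam]
    field_simp
    field_simp at dW
    linear_combination dW
  · rw [segmentParam, segmentParam]
    field_simp
    field_simp at dS
    linear_combination dS
  · rw [segmentParam, segmentParam, e4]
    field_simp
    field_simp at dE
    linear_combination dE

/-- The analogue of `exists_proportional_pos` for a negative crossing. -/
theorem exists_proportional_neg {g₁ g₂ : Matrix (Fin 2) (Fin 2) ℂ} (hg : g₂.det = 1)
    {v₁ v₂ v₁' u : Fin 2 → ℂ} {m : ℂ} (hm : m ≠ 0) (h₁ : Matrix.vecMul v₁ g₁ = m⁻¹ • v₁)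
    (h₂ : Matrix.vecMul v₂ g₂ = m⁻¹ • v₂) (hv : Matrix.vecMul v₁' g₂ = v₁) (hv₂ : v₂ 1 ≠ 0)
    (hP : dotProduct v₁ u ≠ 0) (_hQ : dotProduct v₂ (g₁.mulVec u) ≠ 0)
    (_hT : dotProduct v₂ u ≠ 0) :
    ∃ κ : ℂ, 1 - segmentParam v₁ u / segmentParam v₂ u = κ * u 0 ∧
      m⁻¹ * (1 - m * segmentParam v₁ u / segmentParam v₂ (g₁.mulVec u)) = κ * g₁.mulVec u 0 ∧
      1 - segmentParam v₁' (g₂.mulVec u) / segmentParam v₂ (g₁.mulVec u) =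
        κ * g₂.mulVec (g₁.mulVec u) 0 ∧
      1 - segmentParam v₁' (g₂.mulVec u) / (m * segmentParam v₂ u) =
        m⁻¹ * κ * g₂.mulVec u 0 := by
  set uW := g₁.mulVec u with huW
  set uS := g₂.mulVec uW with huS
  set uE := g₂.mulVec u with huE
  have e1 : dotProduct v₁ uW = m⁻¹ * dotProduct v₁ u := by
    rw [huW, Matrix.dotProduct_mulVec, h₁, smul_dotProduct, smul_eq_mul]
  have e2 : dotProduct v₂ uS = m⁻¹ * dotProduct v₂ uW := by
    rw [huS, Matrix.dotProduct_mulVec, h₂, smul_dotProduct, smul_eq_mul]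
  have e3 : dotProduct v₂ uE = m⁻¹ * dotProduct v₂ u := by
    rw [huE, Matrix.dotProduct_mulVec, h₂, smul_dotProduct, smul_eq_mul]
  have e4 : dotProduct v₁' uE = dotProduct v₁ u := by
    rw [huE, Matrix.dotProduct_mulVec, hv]
  have e5 : dotProduct v₁' uS = m⁻¹ * dotProduct v₁ u := by
    rw [huS, Matrix.dotProduct_mulVec, hv, e1]
  have e6 : v₁' 0 * v₂ 1 - v₁' 1 * v₂ 0 = m⁻¹ * (v₁ 0 * v₂ 1 - v₁ 1 * v₂ 0) := by
    have h := vecMul_wedge hg v₁' v₂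
    rw [h₂, hv, Pi.smul_apply, Pi.smul_apply, smul_eq_mul, smul_eq_mul] at h
    rw [← h]; ring
  have dN := dotProduct_mul_sub_dotProduct_mul v₁ v₂ u
  have dW := dotProduct_mul_sub_dotProduct_mul v₁ v₂ uW
  have dS := dotProduct_mul_sub_dotProduct_mul v₁' v₂ uS
  have dE := dotProduct_mul_sub_dotProduct_mul v₁' v₂ uE
  rw [e1] at dW
  rw [e5, e2, e6] at dS
  rw [e4, e3, e6] at dE
  refine ⟨(v₁ 0 * v₂ 1 - v₁ 1 * v₂ 0) / (dotProduct v₁ u * v₂ 1), ?_, ?_, ?_, ?_⟩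
  · rw [segmentParam, segmentParam]
    field_simp
    linear_combination dN
  · rw [segmentParam, segmentParam]
    field_simp
    field_simp at dW
    linear_combination dW
  · rw [segmentParam, segmentParam, e4]
    field_simp
    field_simp at dS
    linear_combination dS
  · rw [segmentParam, segmentParam, e4]
    field_simp
    field_simp at dE
    linear_combination dE

theorem ShadowColoring.b_eq_segmentParam {c : ℕ} {D : OpenDiagram c} (Γ : ShadowColoring D)
    (i : Fin (2 * c + 1)) : Γ.b i = segmentParam (Γ.color i).v (Γ.left i) := rfl

theorem ShadowColoring.exists_proportional {c : ℕ} {D : OpenDiagram c} (Γ : ShadowColoring D)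
    (hadm : Γ.Admissible) {X : Crossing c} (hX : X ∈ D.crossings) :
    ∃ κ : ℂ, 1 - (Γ.b X.out₂.seg / Γ.b X.in₁.seg) ^ X.sign.toInt = κ * Γ.left X.in₁.seg 0 ∧
      Γ.meridian ^ X.sign.toInt *
        (1 - (Γ.b X.in₂.seg / (Γ.meridian * Γ.b X.in₁.seg)) ^ X.sign.toInt) =
        κ * Γ.right X.in₁.seg 0 ∧
      1 - (Γ.b X.in₂.seg / Γ.b X.out₁.seg) ^ X.sign.toInt = κ * Γ.right X.in₂.seg 0 ∧
      1 - (Γ.meridian * Γ.b X.out₂.seg / Γ.b X.out₁.seg) ^ X.sign.toInt =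
        Γ.meridian ^ X.sign.toInt * κ * Γ.right X.out₂.seg 0 := by
  obtain ⟨hNreg, hWreg, hEreg, hSreg⟩ := Γ.regions_crossing hX
  have hrel := Γ.crossing X hX
  have hm : ∀ j, (Γ.color j).m = Γ.meridian := Γ.m_eq_meridian
  have heig : ∀ j, Matrix.vecMul (Γ.color j).v ((Γ.color j).g : Matrix (Fin 2) (Fin 2) ℂ) =
      Γ.meridian⁻¹ • (Γ.color j).v := fun j => by rw [← hm j]; exact (Γ.color j).eigen
  have hm0 : Γ.meridian ≠ 0 := (Γ.color 0).m_ne_zero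
  have hdet : ∀ j, ((Γ.color j).g : Matrix (Fin 2) (Fin 2) ℂ).det = 1 := fun j => (Γ.color j).g.2
  have hright : ∀ j, Γ.right j =
    ((Γ.color j).g : Matrix (Fin 2) (Fin 2) ℂ).mulVec (Γ.left j) := fun j => rfl
  have hWreg' := hWreg
  rw [hright] at hWreg'
  have hQ := (hadm X.in₂.seg).2.2.2
  rw [hWreg'] at hQ
  unfold CrossingRelation at hrel
  rcases hε : X.sign with _ | _
  · rw [hε] at hrel
    obtain ⟨⟨hg1, a, ha, hv1⟩, hg2, a', ha', hv2⟩ := hrel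
    have hR := (hadm X.out₁.seg).2.2.2
    rw [hEreg, hv1, smul_dotProduct] at hR
    obtain ⟨κ, kN, kW, kS, kE⟩ := exists_proportional_pos (hdet X.in₁.seg) hm0 (heig X.in₁.seg)
      (heig X.in₂.seg) rfl (u := Γ.left X.in₁.seg) (uE := Γ.right X.out₂.seg) (by
        rw [hright, hg2, hNreg, Matrix.mulVec_mulVec, Matrix.mulVec_mulVec,
          ← Matrix.SpecialLinearGroup.coe_mul, ← Matrix.SpecialLinearGroup.coe_mul]
        simp only [mul_assoc, mul_inv_cancel_left]) (hadm X.in₁.seg).2.2.1 (hadm X.in₁.seg).2.2.2 hQ (right_ne_zero_of_smul hR)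
    refine ⟨κ, ?_⟩
    simp only [CrossingSign.toInt, zpow_one]
    rw [Γ.b_eq_segmentParam X.out₂.seg, hv2, segmentParam_smul ha', Γ.b_eq_segmentParam X.out₁.seg,
      hv1, segmentParam_smul ha, Γ.b_eq_segmentParam X.in₂.seg, Γ.b_eq_segmentParam X.in₁.seg,
      hNreg, hEreg, hright X.in₁.seg, hright X.in₂.seg, hWreg']
    exact ⟨kN, kW, kS, kE⟩
  · rw [hε] at hrel
    obtain ⟨⟨hg2, a, ha, hv2⟩, hg1, a', ha', hv1⟩ := hrel
    have hT := (hadm X.out₂.seg).2.2.2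
    rw [hNreg, hv2, smul_dotProduct] at hT
    obtain ⟨κ, kN, kW, kS, kE⟩ := exists_proportional_neg (hdet X.in₂.seg) hm0 (heig X.in₁.seg)
      (heig X.in₂.seg) (v₁' := Matrix.vecMul (Γ.color X.in₁.seg).v
        (((Γ.color X.in₂.seg).g⁻¹ : Matrix.SpecialLinearGroup (Fin 2) ℂ) :
          Matrix (Fin 2) (Fin 2) ℂ)) (u := Γ.left X.in₁.seg) (by
        rw [Matrix.vecMul_vecMul, ← Matrix.SpecialLinearGroup.coe_mul, inv_mul_cancel,
          Matrix.SpecialLinearGroup.coe_one, Matrix.vecMul_one])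
      (hadm X.in₂.seg).2.2.1 (hadm X.in₁.seg).2.2.2 hQ (right_ne_zero_of_smul hT)
    refine ⟨κ, ?_⟩
    have hE' : Γ.right X.out₂.seg =
        ((Γ.color X.in₂.seg).g : Matrix (Fin 2) (Fin 2) ℂ).mulVec (Γ.left X.in₁.seg) := by
      rw [hright, hg2, hNreg]
    simp only [CrossingSign.toInt, zpow_neg_one, inv_div]
    rw [Γ.b_eq_segmentParam X.out₂.seg, hv2, segmentParam_smul ha, Γ.b_eq_segmentParam X.out₁.seg,
      hv1, segmentParam_smul ha', Γ.b_eq_segmentParam X.in₂.seg, Γ.b_eq_segmentParam X.in₁.seg,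
      hNreg, hEreg, hE', hright X.in₁.seg, hright X.in₂.seg, hWreg']
    exact ⟨kN, kW, kS, kE⟩

/-- With the proportionality to the region parameters, the factor by which the crossing function
changes under integer shifts splits into one factor for each adjacent segment. -/
theorem shift_factor_eq {aN aW aS aE AN AW AS AE m κ : ℂ} (hAN : AN ≠ 0) (hm : m ≠ 0)
    (hN : aN ≠ 0) (hW : aW ≠ 0) (hS : aS ≠ 0) (hE : aE ≠ 0)
    (kN : AN = κ * aN) (kW : m * AW = κ * aW) (kS : AS = κ * aS) (kE : AE = m * κ * aE)
    (k₁ k₂ k₁' k₂' : ℤ) :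
    AN ^ (k₁ - k₂') * AS ^ (k₁' - k₂) * AW ^ (k₂ - k₁) * AE ^ (k₂' - k₁') *
      m ^ (k₂ + k₁' - k₁ - k₂') =
    (aN / aW) ^ k₁ / (aE / aS) ^ k₁' * ((aW / aS) ^ k₂ / (aN / aE) ^ k₂') := by
  have hκ : κ ≠ 0 := by rintro rfl; exact hAN (by rw [kN, zero_mul])
  have kW' : AW = κ * aW / m := by rw [eq_div_iff hm, mul_comm, kW]
  rw [kN, kW', kS, kE]
  simp only [div_zpow, mul_zpow, zpow_sub₀ hκ, zpow_sub₀ hm, zpow_add₀ hm, zpow_sub₀ hN,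
    zpow_sub₀ hW, zpow_sub₀ hS, zpow_sub₀ hE]
  field_simp

/-! ### Smoothness and periodicity of the action -/


section

variable {c : ℕ}

/-- The extension of a function on the internal segments by `0` to the boundary segments. -/
noncomputable def extendZero (t : Internal c → ℂ) (j : Fin (2 * c + 1)) : ℂ :=
  if h : j ≠ 0 ∧ j ≠ Fin.last (2 * c) then t ⟨j, h⟩ else 0

theorem Port.value_eq (p : Port c) (N : ℕ) (t : Internal c → ℂ) :
    p.value N t = extendZero t p.seg + p.rot * (1 - 1 / N) := rfl

theorem Port.value_im (p : Port c) (N : ℕ) (t : Internal c → ℂ) :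
    (p.value N t).im = (extendZero t p.seg).im := by
  rw [p.value_eq, show (p.rot : ℂ) * (1 - 1 / N) = ((p.rot * (1 - 1 / N) : ℝ) : ℂ) by push_cast; rfl,
    add_im, ofReal_im, add_zero]

variable {D : OpenDiagram c} {Γ : ShadowColoring D} {β : Internal c → ℂ} {μ : ℂ} {N : ℕ}

theorem exp_extendZero (hnorm : Γ.Normalized) (hβ : Γ.IsLogColoring β) (j : Fin (2 * c + 1)) :
    exp (2 * Real.pi * I * extendZero β j) = Γ.b j := by
  rw [extendZero]
  split_ifs with h
  · exact hβ ⟨j, h⟩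
  · rw [mul_zero, Complex.exp_zero]
    rw [not_and_or, not_not, not_not] at h
    rcases h with rfl | rfl
    · exact hnorm.2.1.symm
    · exact hnorm.2.2.symm

theorem norm_exp_two_pi_I_mul (w : ℂ) :
    ‖exp (2 * Real.pi * I * w)‖ = Real.exp (-(2 * Real.pi * w.im)) := by
  rw [norm_exp]
  congr 1
  simp

/-- As no shape parameter lies on the unit circle, the arguments of the quantum dilogarithms stay
off the real line, whatever the real parts of the variables. -/
theorem im_ne_zero_of_avoidsUnitCircle (hN : N ≠ 0) (hnorm : Γ.Normalized)
    (hcirc : Γ.AvoidsUnitCircle) (hμ : Γ.IsLogMeridian μ) (hβ : Γ.IsLogColoring β)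
    {X : Crossing c} (hX : X ∈ D.crossings) {t : Internal c → ℂ}
    (ht : ∀ j, (extendZero t j).im = (extendZero β j).im / N) :
    (X.out₂.value N t - X.in₁.value N t).im ≠ 0 ∧
      (X.in₂.value N t - X.out₁.value N t).im ≠ 0 ∧
      (X.in₂.value N t - X.in₁.value N t - μ / N).im ≠ 0 ∧
      (X.out₂.value N t - X.out₁.value N t + μ / N).im ≠ 0 := by
  have hNR : (N : ℝ) ≠ 0 := Nat.cast_ne_zero.mpr hN
  have hμN : (μ / N).im = μ.im / N := by rw [← ofReal_natCast, div_ofReal_im]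
  have key : ∀ w : ℂ, w.im = 0 → ‖exp (2 * Real.pi * I * w) ^ X.sign.toInt‖ = 1 := by
    intro w hw
    rw [norm_zpow, norm_exp_two_pi_I_mul, hw, mul_zero, neg_zero, Real.exp_zero, one_zpow]
  have hz : ∀ z ∈ Γ.shapes X, ‖z‖ ≠ 1 := hcirc X hX
  simp only [ShadowColoring.shapes, List.mem_cons, List.not_mem_nil, or_false, forall_eq_or_imp,
    forall_eq] at hz
  obtain ⟨zN, zS, zW, zE⟩ := hz
  have hμ' : exp (2 * Real.pi * I * μ) = Γ.meridian := hμ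
  simp only [← exp_extendZero hnorm hβ, ← hμ'] at zN zS zW zE
  rw [← Complex.exp_sub, ← mul_sub] at zN zS
  rw [← Complex.exp_add, ← Complex.exp_sub, ← mul_add, ← mul_sub] at zW zE
  refine ⟨fun h => zN (key _ ?_), fun h => zS (key _ ?_), fun h => zW (key _ ?_),
    fun h => zE (key _ ?_)⟩ <;>
  · simp only [sub_im, add_im, Port.value_im, ht, hμN] at h ⊢
    field_simp at h
    linarith

/-- The product of the quotients of a weight over all passages telescopes along the knot. -/
theorem OpenDiagram.prod_passages (D : OpenDiagram c) {w : Fin (2 * c + 1) → ℂ}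
    (hw : ∀ j, w j ≠ 0) : (D.crossings.map fun X =>
      w X.in₁.seg / w X.out₁.seg * (w X.in₂.seg / w X.out₂.seg)).prod =
      w 0 / w (Fin.last (2 * c)) := by
  have h1 : ∀ l : List (Crossing c), (l.map fun X =>
      w X.in₁.seg / w X.out₁.seg * (w X.in₂.seg / w X.out₂.seg)).prod =
      ((l.flatMap fun X => [(X.in₁.seg, X.out₁.seg), (X.in₂.seg, X.out₂.seg)]).map
        fun p => w p.1 / w p.2).prod := by
    intro l
    induction l with
    | nil => rfl
    | cons X l ih => simp [ih, mul_assoc]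
  rw [h1, OpenDiagram.crossings, (D.passages.map _).prod_eq, List.map_map]
  change ((List.finRange (2 * c)).map fun j : Fin (2 * c) => w j.castSucc / w j.succ).prod = _
  rw [← Fin.prod_univ_def, Finset.prod_div_distrib, div_eq_div_iff
    (Finset.prod_ne_zero_iff.mpr fun j _ => hw _) (hw _), ← Fin.prod_univ_castSucc,
    Fin.prod_univ_succ]

/-- The exponential of the action is periodic on the lattice of the state sum. At a crossing,
the shift of the variable of a segment changes it by the quotient of the region parameters on the
two sides of the segment, or by its inverse, according to the direction of the segment. -/
theorem expAction_add_period (hN : 2 ≤ N) (hnorm : Γ.Normalized) (hcirc : Γ.AvoidsUnitCircle)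
    (hμ : Γ.IsLogMeridian μ) (hβ : Γ.IsLogColoring β) (i : Internal c) {n n' : Internal c → ℤ}
    (hn : ∀ k, n' k = n k + if k = i then (N : ℤ) else 0) :
    D.expAction N μ (fun k => (β k + n' k) / N) = D.expAction N μ (fun k => (β k + n k) / N) := by
  have hN0 : N ≠ 0 := by omega
  have hNC : (N : ℂ) ≠ 0 := Nat.cast_ne_zero.mpr hN0
  set t : Internal c → ℂ := fun k => (β k + n k) / N with ht
  set t' : Internal c → ℂ := fun k => (β k + n' k) / N with ht'
  -- `δ` marks the shifted segment; `w` is `1` on the others.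
  set δ : Fin (2 * c + 1) → ℤ := fun j => if j = i.1 then 1 else 0 with hδ
  set w : Fin (2 * c + 1) → ℂ := fun j => (Γ.left j 0 / Γ.right j 0) ^ δ j with hw
  have hw0 : ∀ j, w j ≠ 0 := fun j =>
    zpow_ne_zero _ (div_ne_zero (hnorm.1 j).1 (hnorm.1 j).2.1)
  have him : ∀ j, (extendZero t j).im = (extendZero β j).im / N := by
    intro j
    simp only [extendZero]
    split_ifs with h
    · simp only [ht]
      rw [← ofReal_natCast, div_ofReal_im, add_im, ← ofReal_intCast, ofReal_im, add_zero]
    · simp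
  have hval : ∀ p : Port c, p.value N t' = p.value N t + δ p.seg := by
    intro p
    rw [p.value_eq, p.value_eq, add_right_comm]
    congr 1
    simp only [extendZero, hδ]
    split_ifs with h hi hi
    · have : (⟨p.seg, h⟩ : Internal c) = i := Subtype.ext hi
      simp only [ht, ht', hn, if_pos this]
      push_cast
      field_simp
      ring
    · have : (⟨p.seg, h⟩ : Internal c) ≠ i := fun h' => hi (congrArg Subtype.val h')
      simp only [ht, ht', hn, if_neg this]
      push_cast
      ring
    · exact absurd (hi ▸ i.2) h
    · simp
  have hexp : ∀ p : Port c, exp (2 * Real.pi * I * (N * p.value N t)) = Γ.b p.seg := by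
    intro p
    rw [← exp_extendZero hnorm hβ, Complex.exp_eq_exp_iff_exists_int, p.value_eq]
    simp only [extendZero]
    split_ifs with h
    · refine ⟨n ⟨p.seg, h⟩ + p.rot * (N - 1), ?_⟩
      simp only [ht]
      push_cast
      field_simp
      ring
    · refine ⟨p.rot * (N - 1), ?_⟩
      push_cast
      field_simp
      ring
  have hμN : (N : ℂ) * (μ / N) = μ := by field_simp
  have hμ' : exp (2 * Real.pi * I * μ) = Γ.meridian := hμ
  have hfac : ∀ X ∈ D.crossings, expCrossing N X.sign μ
      (X.in₁.value N t') (X.in₂.value N t') (X.out₁.value N t') (X.out₂.value N t') =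
      expCrossing N X.sign μ
        (X.in₁.value N t) (X.in₂.value N t) (X.out₁.value N t) (X.out₂.value N t) *
      (w X.in₁.seg / w X.out₁.seg * (w X.in₂.seg / w X.out₂.seg)) := by
    intro X hX
    obtain ⟨iN, iS, iW, iE⟩ := im_ne_zero_of_avoidsUnitCircle hN0 hnorm hcirc hμ hβ hX him
    obtain ⟨κ, kN, kW, kS, kE⟩ := Γ.exists_proportional hnorm.1 hX
    obtain ⟨rN, rW, rE, rS⟩ := Γ.regions_crossing hX
    have hAN : 1 - (Γ.b X.out₂.seg / Γ.b X.in₁.seg) ^ X.sign.toInt ≠ 0 := by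
      intro h
      have hz := hcirc X hX ((Γ.b X.out₂.seg / Γ.b X.in₁.seg) ^ X.sign.toInt)
        (by simp [ShadowColoring.shapes])
      rw [← sub_eq_zero.mp h] at hz
      exact hz norm_one
    have hm0 : Γ.meridian ^ X.sign.toInt ≠ 0 := zpow_ne_zero _ (Γ.color 0).m_ne_zero
    rw [hval, hval, hval, hval, expCrossing_add_intCast hN X.sign iN iS iW iE]
    congr 1
    have eN : exp (2 * Real.pi * I * (N * (X.out₂.value N t - X.in₁.value N t))) =
        Γ.b X.out₂.seg / Γ.b X.in₁.seg := by
      rw [mul_sub, mul_sub, Complex.exp_sub, hexp, hexp]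
    have eS : exp (2 * Real.pi * I * (N * (X.in₂.value N t - X.out₁.value N t))) =
        Γ.b X.in₂.seg / Γ.b X.out₁.seg := by
      rw [mul_sub, mul_sub, Complex.exp_sub, hexp, hexp]
    have eW : exp (2 * Real.pi * I * (N * (X.in₂.value N t - X.in₁.value N t - μ / N))) =
        Γ.b X.in₂.seg / (Γ.meridian * Γ.b X.in₁.seg) := by
      rw [mul_sub, mul_sub, mul_sub, mul_sub, hμN, Complex.exp_sub, Complex.exp_sub, hexp, hexp, hμ',
        div_div, mul_comm (Γ.b X.in₁.seg)]
    have eE : exp (2 * Real.pi * I * (N * (X.out₂.value N t - X.out₁.value N t + μ / N))) =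
        Γ.meridian * Γ.b X.out₂.seg / Γ.b X.out₁.seg := by
      rw [mul_add, mul_add, mul_sub, mul_sub, hμN, Complex.exp_add, Complex.exp_sub, hexp, hexp, hμ']
      ring
    rw [eN, eS, eW, eE, hμ', shift_factor_eq hAN hm0 (hnorm.1 _).1 (hnorm.1 _).2.1 (hnorm.1 _).2.1
      (hnorm.1 _).2.1 kN kW kS kE]
    simp only [hw, rN, rW, rE, rS]
  have hw_ne : ∀ j, j ≠ i.1 → w j = 1 := fun j hj => by simp [hw, hδ, hj]
  rw [OpenDiagram.expAction, OpenDiagram.expAction, List.map_congr_left hfac, List.prod_map_mul,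
    D.prod_passages hw0, hw_ne 0 i.2.1.symm, hw_ne _ i.2.2.symm, div_one, mul_one]

theorem contDiff_list_prod {α E : Type*} [NormedAddCommGroup E] [NormedSpace ℝ E] {l : List α}
    {f : α → E → ℂ} (h : ∀ a ∈ l, ContDiff ℝ ∞ (f a)) :
    ContDiff ℝ ∞ fun x => (l.map fun a => f a x).prod := by
  induction l with
  | nil => simpa using contDiff_const
  | cons a l ih =>
    simp only [List.map_cons, List.prod_cons]
    exact (h a List.mem_cons_self).mul (ih fun b hb => h b (List.mem_cons_of_mem _ hb))

theorem contDiff_expAction (hN : 2 ≤ N) (hnorm : Γ.Normalized) (hcirc : Γ.AvoidsUnitCircle)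
    (hμ : Γ.IsLogMeridian μ) (hβ : Γ.IsLogColoring β) :
    ContDiff ℝ ∞ fun x : Internal c → ℝ => D.expAction N μ fun i => (x i : ℂ) + β i / N := by
  have hval : ∀ p : Port c,
      ContDiff ℝ ∞ fun x : Internal c → ℝ => p.value N fun i => (x i : ℂ) + β i / N := by
    intro p
    simp only [p.value_eq, extendZero]
    split_ifs with h
    · have h1 : ContDiff ℝ ∞ fun x : Internal c → ℝ => (x ⟨p.seg, h⟩ : ℂ) :=
        ofRealCLM.contDiff.comp (contDiff_apply ℝ ℝ _)
      fun_prop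
    · fun_prop
  have him : ∀ (x : Internal c → ℝ) j, (extendZero (fun i => (x i : ℂ) + β i / N) j).im =
      (extendZero β j).im / N := by
    intro x j
    simp only [extendZero]
    split_ifs with h
    · rw [add_im, ofReal_im, zero_add, ← ofReal_natCast, div_ofReal_im]
    · simp
  refine contDiff_list_prod fun X hX => ?_
  have h := fun x : Internal c → ℝ =>
    im_ne_zero_of_avoidsUnitCircle (by omega) hnorm hcirc hμ hβ hX (him x)
  exact contDiff_expCrossing hN X.sign μ (hval _) (hval _) (hval _) (hval _)
    (fun x => (h x).1) (fun x => (h x).2.1) (fun x => (h x).2.2.1) fun x => (h x).2.2.2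

end

end StateIntegral

theorem theorem1 {c : ℕ} (D : StateIntegral.OpenDiagram c) (N : ℕ) (hN : 2 ≤ N)
    (Γ : StateIntegral.ShadowColoring D) (hnorm : Γ.Normalized) (hpinch : ¬ Γ.Pinched)
    (hcirc : Γ.AvoidsUnitCircle)
    (μ : ℂ) (hμ : Γ.IsLogMeridian μ)
    (β : StateIntegral.Internal c → ℂ) (hβ : Γ.IsLogColoring β) :
    (∀ k : StateIntegral.Internal c → ℤ, MeasureTheory.IntegrableOn (D.stateIntegrand N μ β k)
      (Set.Icc (0 : StateIntegral.Internal c → ℝ) 1)) ∧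
    Filter.Tendsto
      (fun M : StateIntegral.Internal c → ℕ =>
        (((N : ℝ) ^ ((Fintype.card (StateIntegral.Internal c) : ℝ) / 2 - 1 / 2) : ℝ) : ℂ) *
          ∑ k ∈ Fintype.piFinset (fun i => Finset.Icc (-(M i : ℤ)) (M i)),
            D.stateIntegral N μ β k)
      Filter.atTop (nhds (D.qinv N μ β)) := by
  have hN0 : N ≠ 0 := by omega
  have hNpos : (0 : ℝ) < N := Nat.cast_pos.mpr (by omega)
  have hsmooth := StateIntegral.contDiff_expAction hN hnorm hcirc hμ hβ
  refine ⟨fun k => ?_, ?_⟩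
  · have hcont : Continuous (D.stateIntegrand N μ β k) :=
      hsmooth.continuous.mul (by fun_prop)
    exact hcont.continuousOn.integrableOn_compact isCompact_Icc
  · have hcast : ∀ n : StateIntegral.Internal c → ℕ,
        (fun i => (((n i : ℝ) / N : ℝ) : ℂ) + β i / N) = fun i => (β i + ((n i : ℤ) : ℂ)) / N := by
      intro n
      funext i
      push_cast
      ring
    have hlim := StateIntegral.tendsto_sum_integral_mul_exp hN0 hsmooth (fun n i => by
      simp only [hcast]
      refine StateIntegral.expAction_add_period hN hnorm hcirc hμ hβ i fun k => ?_
      by_cases hk : k = i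
      · subst hk; simp
      · simp [hk])
    have hlim' := hlim.const_mul
      (((N : ℝ) ^ ((Fintype.card (StateIntegral.Internal c) : ℝ) / 2 - 1 / 2) : ℝ) : ℂ)
    have hval : D.qinv N μ β =
        (((N : ℝ) ^ ((Fintype.card (StateIntegral.Internal c) : ℝ) / 2 - 1 / 2) : ℝ) : ℂ) *
          (((N : ℂ) ^ Fintype.card (StateIntegral.Internal c))⁻¹ *
            ∑ n : StateIntegral.Internal c → Fin N, D.expAction N μ fun i =>
              ((((n i : ℕ) : ℝ) / N : ℝ) : ℂ) + β i / N) := by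
      have hconst : (1 : ℝ) / (N : ℝ) ^ ((Fintype.card (StateIntegral.Internal c) : ℝ) / 2 + 1 / 2) =
          (N : ℝ) ^ ((Fintype.card (StateIntegral.Internal c) : ℝ) / 2 - 1 / 2) *
            ((N : ℝ) ^ Fintype.card (StateIntegral.Internal c))⁻¹ := by
        rw [one_div, ← Real.rpow_neg hNpos.le, ← Real.rpow_natCast, ← Real.rpow_neg hNpos.le,
          ← Real.rpow_add hNpos]
        congr 1
        ring
      have hconst' := congrArg (fun x : ℝ => (x : ℂ)) hconst
      simp only [Complex.ofReal_div, Complex.ofReal_mul, Complex.ofReal_inv, Complex.ofReal_pow,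
        Complex.ofReal_one, Complex.ofReal_natCast] at hconst'
      rw [StateIntegral.OpenDiagram.qinv, ← mul_assoc, hconst']
      refine congrArg _ (Finset.sum_congr rfl fun n _ => ?_)
      rw [hcast]
      simp only [Int.cast_natCast]
    rw [hval]
    exact hlim'
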